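/- All $\mathbb{Q}$-algebras are associative and unital, not necessarily commutative, and algebra maps preserve units. For a ring $A$ let $M_q=A^{\otimes(q+1)}$ ($q\ge 0$, tensor products over $\mathbb{Z}$; for a $\mathbb{Q}$-algebra this is the same as over $\mathbb{Q}$) be the Hochschild cyclic abelian group of $A$, with faces $d_i(a_0\otimes\dots\otimes a_q)=a_0\otimes\dots\otimes a_ia_{i+1}\otimes\dots\otimes a_q$ for $0\le i<q$, $d_q(a_0\otimes\dots\otimes a_q)=a_qa_0\otimes a_1\otimes\dots\otimes a_{q-1}$, degeneracies inserting $1$, and cyclic operator $t(a_0\otimes\dots\otimes a_q)=a_q\otimes a_0\otimes\dots\otimes a_{q-1}$. The periodic bicomplex $CP(A)$ has $CP_{p,q}(A)=M_q$ for $p\in\mathbb{Z}$ and $q\ge 0$; its vertical differential $M_q\to M_{q-1}$ is $b=\sum_{i=0}^{q}(-1)^id_i$ in even columns $p$ and $-b'=-\sum_{i=0}^{q-1}(-1)^id_i$ in odd columns, and its horizontal differential from column $p$ to column $p-1$ in row $q$ is $\sum_{i=0}^{q}\tau^i$ for $p$ even and $1-\tau$ for $p$ odd, where $\tau=(-1)^qt$.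 The periodic cyclic homology $HP_n(A)$, $n\in\mathbb{Z}$, is the $n$-th homology group of the product total complex $n\mapsto\prod_{p+q=n}CP_{p,q}(A)$; it is functorial in $A$. **Proposition 1.3.** 1. If $f\colon A\to B$ is a surjective map of $\mathbb{Q}$-algebras whose kernel $I$ is nilpotent (that is, $I^m=0$ for some $m$), then the induced map $f_*\colon HP_n(A)\to HP_n(B)$ is an isomorphism for every $n\in\mathbb{Z}$. 2. Let $$\begin{array}{ccc}A^0&\xrightarrow{\;g^1\;}&A^1\\ {\scriptstyle g^2}\downarrow&&\downarrow{\scriptstyle f^1}\\ A^2&\xrightarrow{\;f^2\;}&A^{12}\end{array}$$ be a cartesian square of $\mathbb{Q}$-algebras in which all four maps are surjective. Then there are homomorphisms $\partial_n\colon HP_n(A^{12})\to HP_{n-1}(A^0)$, $n\in\mathbb{Z}$, such that the sequence $$\cdots\to HP_n(A^0)\xrightarrow{(g^1_*,\,g^2_*)}HP_n(A^1)\oplus HP_n(A^2)\xrightarrow{f^1_*-f^2_*}HP_n(A^{12})\xrightarrow{\partial_n}HP_{n-1}(A^0)\to\cdots$$ is exact. -/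

import Mathlib

open CategoryTheory

universe u v

open scoped TensorProduct


/-! ### The cyclic operators on tuples of elements of a monoid -/

namespace CyclicTuple

section

variable {A : Type u}

/-- The cyclic operator `(a₀, …, aₙ) ↦ (aₙ, a₀, …, aₙ₋₁)`; the subtraction in `Fin (n + 1)`
is modulo `n + 1`. -/
def rot {n : ℕ} (a : Fin (n + 1) → A) : Fin (n + 1) → A := fun k => a (k - 1)

theorem rot_iterate {n : ℕ} (m : ℕ) (a : Fin (n + 1) → A) :
    rot^[m] a = fun k => a (k - m • (1 : Fin (n + 1))) := by
  induction m with
  | zero => simp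
  | succ m ih =>
    rw [Function.iterate_succ_apply', ih]
    funext k
    simp [rot, sub_sub, add_smul, add_comm]

theorem rot_cycle {n : ℕ} (a : Fin (n + 1) → A) : rot^[n + 1] a = a := by
  rw [rot_iterate]; funext k
  have : (n + 1) • (1 : Fin (n + 1)) = 0 := by
    simpa using card_nsmul_eq_zero' (G := Fin (n + 1)) (x := 1)
  rw [this, sub_zero]

variable [Monoid A]

/-- The faces `(a₀, …, aₙ₊₁) ↦ (a₀, …, aᵢ aᵢ₊₁, …, aₙ₊₁)` for `i ≤ n`, and
`(a₀, …, aₙ₊₁) ↦ (aₙ₊₁ a₀, a₁, …, aₙ)` for `i = n + 1`. -/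
def face {n : ℕ} (i : Fin (n + 2)) (a : Fin (n + 2) → A) : Fin (n + 1) → A :=
  if i = Fin.last (n + 1) then
    fun k => if k = 0 then a (Fin.last (n + 1)) * a 0 else a k.castSucc
  else i.contractNth (· * ·) a

/-- The degeneracies `(a₀, …, aₙ) ↦ (a₀, …, aᵢ, 1, aᵢ₊₁, …, aₙ)`. -/
def degen {n : ℕ} (i : Fin (n + 1)) (a : Fin (n + 1) → A) : Fin (n + 2) → A :=
  i.succ.insertNth (α := fun _ => A) 1 a

/-- The entries of a tuple indexed by natural numbers, extended by `1`. -/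
def ev {n : ℕ} (a : Fin (n + 1) → A) (m : ℕ) : A := if h : m < n + 1 then a ⟨m, h⟩ else 1

theorem ext_ev {n : ℕ} {a b : Fin (n + 1) → A} (h : ∀ m, m < n + 1 → ev a m = ev b m) : a = b := by
  funext k
  have := h k k.2
  simpa only [ev, k.2, dif_pos, Fin.eta] using this

theorem ev_face {n : ℕ} (i : Fin (n + 2)) (a : Fin (n + 2) → A) (k : ℕ) :
    ev (face i a) k = if k < n + 1 then
      (if (i : ℕ) = n + 1 then (if k = 0 then ev a (n + 1) * ev a 0 else ev a k)
       else if k < i then ev a k else if k = i then ev a k * ev a (k + 1) else ev a (k + 1))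
      else 1 := by
  by_cases hk : k < n + 1
  · have h0 : k < n + 1 + 1 := by omega
    by_cases hi : i = Fin.last (n + 1)
    · by_cases k0 : k = 0 <;> simp [ev, face, hi, hk, h0, Fin.ext_iff, Fin.last, k0]
    · have hi' : (i : ℕ) ≠ n + 1 := fun h => hi (Fin.ext h)
      have h1 : k ≤ n := by omega
      simp [ev, face, hi, hi', Fin.contractNth, h0, h1]
  · simp [ev, hk]

theorem ev_degen {n : ℕ} (i : Fin (n + 1)) (a : Fin (n + 1) → A) (k : ℕ) :
    ev (degen i a) k = if k < n + 2 then
      (if k ≤ i then ev a k else if k = i + 1 then 1 else ev a (k - 1)) else 1 := by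
  by_cases hk : k < n + 2
  · rcases lt_trichotomy k (i + 1) with h | h | h
    · have h1 : k < n + 1 := by omega
      have h2 : (⟨k, hk⟩ : Fin (n + 2)) = i.succ.succAbove ⟨k, h1⟩ := by
        rw [Fin.succAbove_of_castSucc_lt _ _ (by simpa [Fin.lt_def] using h)]
        rfl
      simp [ev, degen, hk, h1, h2, Nat.lt_succ_iff.mp h]
    · subst h
      have : (⟨(i : ℕ) + 1, hk⟩ : Fin (n + 2)) = i.succ := rfl
      simp [ev, degen, this]
    · have h1 : k - 1 < n + 1 := by omega
      have h2 : (⟨k, hk⟩ : Fin (n + 2)) = i.succ.succAbove ⟨k - 1, h1⟩ := by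
        rw [Fin.succAbove_of_le_castSucc _ _ (by simp [Fin.le_def]; omega)]
        ext; simp; omega
      have h3 : ¬ k ≤ i := by omega
      have h4 : ¬ k = i + 1 := by omega
      simp only [ev, hk, h1, dif_pos, h3, h4, if_false, if_true, degen, h2,
        Fin.insertNth_apply_succAbove]
  · simp [ev, hk]

theorem ev_update {n : ℕ} (a : Fin (n + 1) → A) (j : Fin (n + 1)) (x : A) (k : ℕ) :
    ev (Function.update a j x) k = if k = j then x else ev a k := by
  by_cases hk : k < n + 1
  · simp [ev, hk, Function.update_apply, Fin.ext_iff]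
  · have : k ≠ j := by omega
    simp [ev, hk, this]

theorem ev_rot {n : ℕ} (a : Fin (n + 1) → A) (k : ℕ) :
    ev (rot a) k = if k < n + 1 then (if k = 0 then ev a n else ev a (k - 1)) else 1 := by
  by_cases hk : k < n + 1
  · have h1 : k - 1 < n + 1 := by omega
    simp only [ev, rot, hk, h1, dif_pos, if_true, Nat.lt_succ_self]
    split_ifs with h
    · subst h
      congr 1
      ext; simp
    · congr 1
      have h3 : (1 : ℕ) < n + 1 := by omega
      have : (⟨k, hk⟩ : Fin (n+1)) ≠ 0 := by simpa [Fin.ext_iff] using h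
      ext; rw [Fin.val_sub_one_of_ne_zero this]
  · simp [ev, hk]

theorem face_face {n : ℕ} (i j : Fin (n + 2)) (hij : i ≤ j) (a : Fin (n + 3) → A) :
    face i (face j.succ a) = face j (face i.castSucc a) := by
  apply ext_ev; intro m hm
  have : (i : ℕ) ≤ j := hij
  have hj : (j : ℕ) < n + 2 := j.2
  simp only [ev_face, Fin.val_succ, Fin.val_castSucc]
  grind [mul_assoc]

theorem degen_degen {n : ℕ} (i j : Fin (n + 1)) (hij : i ≤ j) (a : Fin (n + 1) → A) :
    degen i.castSucc (degen j a) = degen j.succ (degen i a) := by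
  apply ext_ev; intro m hm
  have : (i : ℕ) ≤ j := hij
  have hj : (j : ℕ) < n + 1 := j.2
  simp only [ev_degen, Fin.val_succ, Fin.val_castSucc]
  grind

theorem face_degen_lt {n : ℕ} (i : Fin (n + 2)) (j : Fin (n + 1)) (hij : i ≤ j.castSucc)
    (a : Fin (n + 2) → A) : face i.castSucc (degen j.succ a) = degen j (face i a) := by
  apply ext_ev; intro m hm
  have : (i : ℕ) ≤ j := hij
  have hj : (j : ℕ) < n + 1 := j.2
  simp only [ev_face, ev_degen, Fin.val_succ, Fin.val_castSucc]
  grind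

theorem face_degen_self {n : ℕ} (i : Fin (n + 1)) (a : Fin (n + 1) → A) :
    face i.castSucc (degen i a) = a := by
  apply ext_ev; intro m hm
  have hj : (i : ℕ) < n + 1 := i.2
  simp only [ev_face, ev_degen, Fin.val_castSucc]
  grind [mul_one]

theorem face_degen_succ {n : ℕ} (i : Fin (n + 1)) (a : Fin (n + 1) → A) :
    face i.succ (degen i a) = a := by
  apply ext_ev; intro m hm
  have hj : (i : ℕ) < n + 1 := i.2
  simp only [ev_face, ev_degen, Fin.val_succ]
  grind [one_mul]

theorem face_degen_gt {n : ℕ} (i : Fin (n + 2)) (j : Fin (n + 1)) (hij : j.castSucc < i)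
    (a : Fin (n + 2) → A) : face i.succ (degen j.castSucc a) = degen j (face i a) := by
  apply ext_ev; intro m hm
  have : (j : ℕ) < i := hij
  have hj : (i : ℕ) < n + 2 := i.2
  simp only [ev_face, ev_degen, Fin.val_succ, Fin.val_castSucc]
  grind

theorem face_zero_rot {n : ℕ} (a : Fin (n + 2) → A) :
    face 0 (rot a) = face (Fin.last (n + 1)) a := by
  apply ext_ev; intro m hm
  simp only [ev_face, ev_rot, Fin.val_zero, Fin.val_last]
  grind

theorem face_succ_rot {n : ℕ} (i : Fin (n + 1)) (a : Fin (n + 2) → A) :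
    face i.succ (rot a) = rot (face i.castSucc a) := by
  apply ext_ev; intro m hm
  have hj : (i : ℕ) < n + 1 := i.2
  simp only [ev_face, ev_rot, Fin.val_succ, Fin.val_castSucc]
  grind

theorem degen_zero_rot {n : ℕ} (a : Fin (n + 1) → A) :
    degen 0 (rot a) = rot (rot (degen (Fin.last n) a)) := by
  apply ext_ev; intro m hm
  simp only [ev_degen, ev_rot, Fin.val_zero, Fin.val_last]
  grind

theorem degen_succ_rot {n : ℕ} (i : Fin n) (a : Fin (n + 1) → A) :
    degen i.succ (rot a) = rot (degen i.castSucc a) := by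
  apply ext_ev; intro m hm
  have hj : (i : ℕ) < n := i.2
  simp only [ev_degen, ev_rot, Fin.val_succ, Fin.val_castSucc]
  grind

end

end CyclicTuple

/-- A cyclic `k`-module (a contravariant functor from Connes' cyclic category to `k`-modules),
given by its faces `d`, degeneracies `s` and cyclic operators `t`, subject to the usual
presentation of the cyclic category. For `k = ℤ` this is a cyclic abelian group. -/
structure CyclicModule (k : Type v) [CommRing k] where
  obj : ℕ → Type u
  [addCommGroup : ∀ n, AddCommGroup (obj n)]
  [module : ∀ n, Module k (obj n)]
  d : ∀ n, Fin (n + 2) → (obj (n + 1) →ₗ[k] obj n)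
  s : ∀ n, Fin (n + 1) → (obj n →ₗ[k] obj (n + 1))
  t : ∀ n, obj n →ₗ[k] obj n
  d_comp_d : ∀ n (i j : Fin (n + 2)), i ≤ j →
    d n i ∘ₗ d (n + 1) j.succ = d n j ∘ₗ d (n + 1) i.castSucc
  s_comp_s : ∀ n (i j : Fin (n + 1)), i ≤ j →
    s (n + 1) i.castSucc ∘ₗ s n j = s (n + 1) j.succ ∘ₗ s n i
  d_comp_s_of_le : ∀ n (i : Fin (n + 2)) (j : Fin (n + 1)), i ≤ j.castSucc →
    d (n + 1) i.castSucc ∘ₗ s (n + 1) j.succ = s n j ∘ₗ d n i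
  d_comp_s_self : ∀ n (i : Fin (n + 1)), d n i.castSucc ∘ₗ s n i = LinearMap.id
  d_comp_s_succ : ∀ n (i : Fin (n + 1)), d n i.succ ∘ₗ s n i = LinearMap.id
  d_comp_s_of_gt : ∀ n (i : Fin (n + 2)) (j : Fin (n + 1)), j.castSucc < i →
    d (n + 1) i.succ ∘ₗ s (n + 1) j.castSucc = s n j ∘ₗ d n i
  d_zero_comp_t : ∀ n, d n 0 ∘ₗ t (n + 1) = d n (Fin.last (n + 1))
  d_succ_comp_t : ∀ n (i : Fin (n + 1)), d n i.succ ∘ₗ t (n + 1) = t n ∘ₗ d n i.castSucc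
  s_zero_comp_t : ∀ n, s n 0 ∘ₗ t n = t (n + 1) ∘ₗ t (n + 1) ∘ₗ s n (Fin.last n)
  s_succ_comp_t : ∀ n (i : Fin n), s n i.succ ∘ₗ t n = t (n + 1) ∘ₗ s n i.castSucc
  t_pow : ∀ n, (t n : Module.End k (obj n)) ^ (n + 1) = 1

namespace CyclicModule

attribute [instance] CyclicModule.addCommGroup CyclicModule.module

section Aux

variable {k : Type v} [CommRing k] {L M N : Type*} [AddCommGroup L] [AddCommGroup M]
  [AddCommGroup N] [Module k L] [Module k M] [Module k N]

theorem comp_sum {ι : Type*} (S : Finset ι) (f : M →ₗ[k] N) (g : ι → L →ₗ[k] M) :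
    f ∘ₗ (∑ i ∈ S, g i) = ∑ i ∈ S, f ∘ₗ g i := by
  ext x
  simp [LinearMap.sum_apply, map_sum]

theorem sum_comp {ι : Type*} (S : Finset ι) (f : ι → M →ₗ[k] N) (g : L →ₗ[k] M) :
    (∑ i ∈ S, f i) ∘ₗ g = ∑ i ∈ S, f i ∘ₗ g := by
  ext x
  simp [LinearMap.sum_apply]

end Aux

section Operators

variable {k : Type v} [CommRing k] (M : CyclicModule.{u} k)

/-- The Hochschild boundary `d₀ - d₁ + ⋯ ± d_{n+1}`. -/
def b (n : ℕ) : M.obj (n + 1) →ₗ[k] M.obj n :=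
  ∑ i : Fin (n + 2), (-1 : k) ^ (i : ℕ) • M.d n i

/-- The boundary `d₀ - d₁ + ⋯ ± d_n`, omitting the last face. -/
def b' (n : ℕ) : M.obj (n + 1) →ₗ[k] M.obj n :=
  ∑ i : Fin (n + 1), (-1 : k) ^ (i : ℕ) • M.d n i.castSucc

/-- The cyclic operator with its sign, `(-1)ⁿ t`. -/
def signedT (n : ℕ) : Module.End k (M.obj n) := (-1 : k) ^ n • M.t n

/-- The norm `1 + τ + ⋯ + τⁿ`, where `τ = (-1)ⁿ t`. -/
def norm (n : ℕ) : Module.End k (M.obj n) := ∑ i ∈ Finset.range (n + 1), M.signedT n ^ i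

/-- The vertical differential of the periodic bicomplex in column `p`, from row `q + 1` to row `q`:
`b` in the even columns and `-b'` in the odd ones. -/
def vert (p : ℤ) (q : ℕ) : M.obj (q + 1) →ₗ[k] M.obj q :=
  if Even p then M.b q else -M.b' q

/-- The horizontal differential of the periodic bicomplex in row `q`, from column `p` to
column `p - 1`: the norm if `p` is even and `1 - (-1)^q t` if `p` is odd. -/
def horiz (p : ℤ) (q : ℕ) : M.obj q →ₗ[k] M.obj q :=
  if Even p then M.norm q else 1 - M.signedT q

/-- The differential from degree `n` to degree `n - 1` of the product total complex of the periodic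
bicomplex. The bicomplex has `M.obj q` in each bidegree `(p, q)` with `p : ℤ` and `q : ℕ`, so its
part of total degree `n` is `∏ q, M.obj q`, the factor `q` being the one in column `n - q`. -/
def totalD (n : ℤ) : (∀ q, M.obj q) →ₗ[k] (∀ q, M.obj q) :=
  LinearMap.pi fun q =>
    M.horiz (n - q) q ∘ₗ LinearMap.proj q +
      M.vert (n - (q + 1)) q ∘ₗ LinearMap.proj (q + 1)

/-- The faces with their signs, indexed by natural numbers. -/
def signedD (n i : ℕ) : M.obj (n + 1) →ₗ[k] M.obj n :=
  if h : i < n + 2 then (-1 : k) ^ i • M.d n ⟨i, h⟩ else 0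

theorem b_eq (n : ℕ) : M.b n = ∑ i ∈ Finset.range (n + 2), M.signedD n i := by
  rw [Finset.sum_range, b]
  refine Finset.sum_congr rfl fun i _ => ?_
  simp [signedD]

theorem b'_eq (n : ℕ) : M.b' n = ∑ i ∈ Finset.range (n + 1), M.signedD n i := by
  rw [Finset.sum_range, b']
  refine Finset.sum_congr rfl fun i _ => ?_
  have : (i : ℕ) < n + 2 := by omega
  rw [signedD, dif_pos this]
  rfl

theorem signedD_comp (n i j : ℕ) (hij : i ≤ j) (hj : j < n + 2) :
    M.signedD n i ∘ₗ M.signedD (n + 1) (j + 1) = -(M.signedD n j ∘ₗ M.signedD (n + 1) i) := by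
  have h1 : i < n + 2 := by omega
  have h2 : j + 1 < n + 1 + 2 := by omega
  have h3 : i < n + 1 + 2 := by omega
  have key := M.d_comp_d n ⟨i, h1⟩ ⟨j, hj⟩ hij
  simp only [Fin.succ_mk, Fin.castSucc_mk] at key
  simp only [signedD, h1, h2, h3, hj, dif_pos, LinearMap.smul_comp, LinearMap.comp_smul, key]
  rw [smul_smul, smul_smul, ← neg_smul]
  congr 1
  ring

theorem sum_eq_zero_aux {G : Type*} [AddCommGroup G] (f : ℕ → ℕ → G) (m : ℕ)
    (hf : ∀ i j, i ≤ j → j ≤ m → f i (j + 1) = -f j i) :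
    ∑ i ∈ Finset.range (m + 1), ∑ j ∈ Finset.range (m + 2), f i j = 0 := by
  induction m with
  | zero => simp [Finset.sum_range_succ, hf 0 0 le_rfl le_rfl]
  | succ m ih =>
    have ih' := ih fun i j h h' => hf i j h (by omega)
    rw [Finset.sum_range_succ]
    have h1 : ∀ i ∈ Finset.range (m + 1), ∑ j ∈ Finset.range (m + 1 + 2), f i j
        = ∑ j ∈ Finset.range (m + 2), f i j - f (m + 1) i := by
      intro i hi
      rw [Finset.sum_range_succ, hf i (m + 1) (by simp at hi; omega) le_rfl, sub_eq_add_neg]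
    rw [Finset.sum_congr rfl h1, Finset.sum_sub_distrib, ih', Finset.sum_range_succ _ (m + 2),
      Finset.sum_range_succ _ (m + 1), hf (m + 1) (m + 1) le_rfl le_rfl]
    abel

theorem b_comp_b (n : ℕ) : M.b n ∘ₗ M.b (n + 1) = 0 := by
  rw [b_eq, b_eq]
  simp only [sum_comp, comp_sum]
  rw [Finset.sum_comm]
  exact sum_eq_zero_aux (fun i j => M.signedD n i ∘ₗ M.signedD (n + 1) j) (n + 1)
    fun i j h h' => M.signedD_comp n i j h (by omega)

theorem b'_comp_b' (n : ℕ) : M.b' n ∘ₗ M.b' (n + 1) = 0 := by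
  rw [b'_eq, b'_eq]
  simp only [sum_comp, comp_sum]
  rw [Finset.sum_comm]
  exact sum_eq_zero_aux (fun i j => M.signedD n i ∘ₗ M.signedD (n + 1) j) n
    fun i j h h' => M.signedD_comp n i j h (by omega)

theorem signedD_zero_comp (n : ℕ) :
    M.signedD n 0 ∘ₗ M.signedT (n + 1) = M.signedD n (n + 1) := by
  have h0 : 0 < n + 2 := by omega
  have h1 : n + 1 < n + 2 := by omega
  have key := M.d_zero_comp_t n
  simp only [signedD, h0, h1, dif_pos, signedT, LinearMap.comp_smul, pow_zero, one_smul]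
  rw [show (⟨0, h0⟩ : Fin (n + 2)) = 0 from rfl, key]
  rfl

theorem signedD_succ_comp (n i : ℕ) (hi : i < n + 1) :
    M.signedD n (i + 1) ∘ₗ M.signedT (n + 1) = M.signedT n ∘ₗ M.signedD n i := by
  have h0 : i < n + 2 := by omega
  have h1 : i + 1 < n + 2 := by omega
  have key := M.d_succ_comp_t n ⟨i, hi⟩
  simp only [Fin.succ_mk, Fin.castSucc_mk] at key
  simp only [signedD, h0, h1, dif_pos, signedT, LinearMap.smul_comp, LinearMap.comp_smul, key]
  rw [smul_smul, smul_smul]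
  congr 1
  ring

theorem signedT_pow (n : ℕ) : M.signedT n ^ (n + 1) = 1 := by
  rw [signedT, smul_pow, M.t_pow, ← pow_mul, (Nat.even_mul_succ_self n).neg_one_pow, one_smul]

theorem b_comp_sub (n : ℕ) :
    M.b n ∘ₗ (1 - M.signedT (n + 1)) = (1 - M.signedT n) ∘ₗ M.b' n := by
  have h1 : M.b n ∘ₗ M.signedT (n + 1) = M.signedT n ∘ₗ M.b' n + M.signedD n (n + 1) := by
    rw [b_eq, b'_eq, sum_comp, comp_sum, Finset.sum_range_succ',
      signedD_zero_comp]
    congr 1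
    exact Finset.sum_congr rfl fun i hi => M.signedD_succ_comp n i (by simpa using hi)
  have h2 : M.b n = M.b' n + M.signedD n (n + 1) := by
    rw [b_eq, b'_eq, Finset.sum_range_succ]
  rw [LinearMap.comp_sub, LinearMap.sub_comp, h1, Module.End.one_eq_id, LinearMap.comp_id,
    Module.End.one_eq_id, LinearMap.id_comp]
  rw [h2]
  abel

theorem signedD_comp_pow (n i j : ℕ) (h : i + j < n + 2) :
    M.signedD n (i + j) ∘ₗ (M.signedT (n + 1) ^ j) = (M.signedT n ^ j) ∘ₗ M.signedD n i := by
  induction j with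
  | zero => simp [Module.End.one_eq_id]
  | succ j ih =>
    rw [pow_succ', Module.End.mul_eq_comp, ← LinearMap.comp_assoc, ← add_assoc,
      M.signedD_succ_comp n (i + j) (by omega), LinearMap.comp_assoc, ih (by omega),
      ← LinearMap.comp_assoc, ← Module.End.mul_eq_comp, ← pow_succ']

theorem signedD_comp_pow' (n i l : ℕ) (h : i < n + 2) (h' : l < n + 2) :
    M.signedD n i ∘ₗ (M.signedT (n + 1) ^ (i + 1 + l)) =
      (M.signedT n ^ (i + l)) ∘ₗ M.signedD n (n + 1 - l) := by
  have h1 := M.signedD_comp_pow n 0 i (by omega)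
  have h2 := M.signedD_comp_pow n (n + 1 - l) l (by omega)
  rw [zero_add] at h1
  rw [Nat.sub_add_cancel (by omega)] at h2
  rw [pow_add, pow_add, pow_one, Module.End.mul_eq_comp, Module.End.mul_eq_comp,
    ← LinearMap.comp_assoc, ← LinearMap.comp_assoc, h1, LinearMap.comp_assoc _ _ (M.signedT n ^ i),
    signedD_zero_comp, LinearMap.comp_assoc, h2, ← LinearMap.comp_assoc, ← Module.End.mul_eq_comp,
    ← pow_add]

theorem b'_comp_norm (n : ℕ) : M.b' n ∘ₗ M.norm (n + 1) = M.norm n ∘ₗ M.b n := by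
  rw [b_eq, b'_eq, norm, norm]
  simp only [sum_comp, comp_sum]
  rw [← Finset.sum_product', ← Finset.sum_product']
  refine Finset.sum_bij'
    (fun x _ => if x.1 ≤ x.2 then (x.2 - x.1, x.1) else (n + 2 + x.2 - x.1, x.1 - 1))
    (fun y _ => if y.1 + y.2 ≤ n then (y.2, y.1 + y.2) else (y.2 + 1, y.1 + y.2 - (n + 1)))
    ?_ ?_ ?_ ?_ ?_
  · rintro ⟨j, i⟩ h
    simp only [Finset.mem_product, Finset.mem_range] at h ⊢
    split_ifs <;> simp only <;> omega
  · rintro ⟨r, m⟩ h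
    simp only [Finset.mem_product, Finset.mem_range] at h ⊢
    split_ifs <;> simp only <;> omega
  · rintro ⟨j, i⟩ h
    simp only [Finset.mem_product, Finset.mem_range] at h ⊢
    grind
  · rintro ⟨r, m⟩ h
    simp only [Finset.mem_product, Finset.mem_range] at h ⊢
    grind
  · rintro ⟨j, i⟩ h
    simp only [Finset.mem_product, Finset.mem_range] at h ⊢
    split_ifs with hji
    · have := M.signedD_comp_pow n (i - j) j (by omega)
      rwa [Nat.sub_add_cancel hji] at this
    · have := M.signedD_comp_pow' n i (j - i - 1) (by omega) (by omega)
      rw [show i + 1 + (j - i - 1) = j by omega, show i + (j - i - 1) = j - 1 by omega,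
        show n + 1 - (j - i - 1) = n + 2 + i - j by omega] at this
      exact this

theorem horiz_comp_horiz (p : ℤ) (q : ℕ) : M.horiz (p - 1) q ∘ₗ M.horiz p q = 0 := by
  have h1 : (1 - M.signedT q) * M.norm q = 0 := by
    rw [norm, mul_neg_geom_sum, signedT_pow, sub_self]
  have h2 : M.norm q * (1 - M.signedT q) = 0 := by
    rw [norm, geom_sum_mul_neg, signedT_pow, sub_self]
  by_cases hp : Even p
  · have : ¬ Even (p - 1) := by grind
    simp only [horiz, hp, this, if_true, if_false]
    exact h1
  · have : Even (p - 1) := by grind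
    simp only [horiz, hp, this, if_true, if_false]
    exact h2

theorem vert_comp_vert (p : ℤ) (q : ℕ) : M.vert p q ∘ₗ M.vert p (q + 1) = 0 := by
  by_cases hp : Even p
  · simpa [vert, hp] using M.b_comp_b q
  · simpa [vert, hp, LinearMap.neg_comp, LinearMap.comp_neg] using M.b'_comp_b' q

theorem horiz_comp_vert (p : ℤ) (q : ℕ) :
    M.horiz p q ∘ₗ M.vert p q + M.vert (p - 1) q ∘ₗ M.horiz p (q + 1) = 0 := by
  by_cases hp : Even p
  · have : ¬ Even (p - 1) := by grind
    simp [horiz, vert, hp, this, LinearMap.neg_comp, M.b'_comp_norm q]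
  · have : Even (p - 1) := by grind
    simp [horiz, vert, hp, this, LinearMap.comp_neg, M.b_comp_sub q]

theorem totalD_comp (n : ℤ) : M.totalD (n - 1) ∘ₗ M.totalD n = 0 := by
  ext1 x
  funext q
  have h1 := LinearMap.congr_fun (M.horiz_comp_horiz (n - q) q) (x q)
  have h2 := LinearMap.congr_fun (M.horiz_comp_vert (n - (q + 1)) q) (x (q + 1))
  have h3 := LinearMap.congr_fun (M.vert_comp_vert (n - (q + 1) - 1) q) (x (q + 1 + 1))
  have e1 : n - 1 - (q : ℤ) = n - (q + 1) := by ring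
  have e2 : n - (q : ℤ) - 1 = n - (q + 1) := by ring
  have e3 : n - 1 - ((q : ℤ) + 1) = n - (q + 1) - 1 := by ring
  have e4 : n - (((q + 1 : ℕ) : ℤ) + 1) = n - (q + 1) - 1 := by push_cast; ring
  have e5 : n - ((q + 1 : ℕ) : ℤ) = n - (q + 1) := by push_cast; ring
  simp only [LinearMap.comp_apply, LinearMap.add_apply, LinearMap.zero_apply, e2] at h1 h2 h3
  simp only [totalD, LinearMap.comp_apply, LinearMap.pi_apply, LinearMap.add_apply,
    LinearMap.proj_apply, LinearMap.zero_apply, Pi.zero_apply, e1, e3, e4, e5, map_add, h1, h3,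
    zero_add, add_zero]
  exact h2

/-- The product total complex of the periodic bicomplex of `M`. -/
def periodicComplex : ChainComplex (ModuleCat.{u} k) ℤ where
  X _ := ModuleCat.of k (∀ q, M.obj q)
  d i j := if j + 1 = i then ModuleCat.ofHom (M.totalD i) else 0
  shape i j h := if_neg h
  d_comp_d' i j l hij hjl := by
    obtain rfl : j + 1 = i := hij
    obtain rfl : l + 1 = j := hjl
    rw [if_pos rfl, if_pos rfl, ← ModuleCat.ofHom_comp]
    have h := M.totalD_comp (l + 1 + 1)
    rw [add_sub_cancel_right] at h
    rw [h]
    rfl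

/-- The periodic cyclic homology `HP_n` of a cyclic module. -/
noncomputable def periodicHomology (n : ℤ) : ModuleCat.{u} k := M.periodicComplex.homology n

end Operators

/-- Maps of cyclic modules. -/
structure Hom {k : Type v} [CommRing k] (M N : CyclicModule.{u} k) where
  app : ∀ n, M.obj n →ₗ[k] N.obj n
  comp_d : ∀ n i, app n ∘ₗ M.d n i = N.d n i ∘ₗ app (n + 1)
  comp_s : ∀ n i, app (n + 1) ∘ₗ M.s n i = N.s n i ∘ₗ app n
  comp_t : ∀ n, app n ∘ₗ M.t n = N.t n ∘ₗ app n

namespace Hom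

variable {k : Type v} [CommRing k] {M N : CyclicModule.{u} k} (f : Hom M N)

theorem comp_b (n : ℕ) : f.app n ∘ₗ M.b n = N.b n ∘ₗ f.app (n + 1) := by
  simp only [b, comp_sum, sum_comp, LinearMap.comp_smul, LinearMap.smul_comp,
    f.comp_d]

theorem comp_b' (n : ℕ) : f.app n ∘ₗ M.b' n = N.b' n ∘ₗ f.app (n + 1) := by
  simp only [b', comp_sum, sum_comp, LinearMap.comp_smul, LinearMap.smul_comp,
    f.comp_d]

theorem comp_signedT (n : ℕ) : f.app n ∘ₗ M.signedT n = N.signedT n ∘ₗ f.app n := by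
  simp only [signedT, LinearMap.comp_smul, LinearMap.smul_comp, f.comp_t]

theorem comp_signedT_pow (n i : ℕ) :
    f.app n ∘ₗ (M.signedT n ^ i) = (N.signedT n ^ i) ∘ₗ f.app n := by
  induction i with
  | zero => simp [Module.End.one_eq_id]
  | succ i ih =>
    rw [pow_succ', pow_succ', Module.End.mul_eq_comp, Module.End.mul_eq_comp,
      ← LinearMap.comp_assoc, comp_signedT, LinearMap.comp_assoc, ih, LinearMap.comp_assoc]

theorem comp_norm (n : ℕ) : f.app n ∘ₗ M.norm n = N.norm n ∘ₗ f.app n := by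
  simp only [norm, comp_sum, sum_comp, comp_signedT_pow]

theorem comp_vert (p : ℤ) (q : ℕ) : f.app q ∘ₗ M.vert p q = N.vert p q ∘ₗ f.app (q + 1) := by
  unfold vert
  split_ifs
  · exact f.comp_b q
  · rw [LinearMap.comp_neg, LinearMap.neg_comp, comp_b']

theorem comp_horiz (p : ℤ) (q : ℕ) : f.app q ∘ₗ M.horiz p q = N.horiz p q ∘ₗ f.app q := by
  unfold horiz
  split_ifs
  · exact f.comp_norm q
  · rw [LinearMap.comp_sub, LinearMap.sub_comp, comp_signedT]
    simp [Module.End.one_eq_id]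

/-- The map induced on the part of a given degree of the product total complexes. -/
def totalMap : (∀ q, M.obj q) →ₗ[k] (∀ q, N.obj q) :=
  LinearMap.pi fun q => f.app q ∘ₗ LinearMap.proj q

theorem totalMap_comp (n : ℤ) : f.totalMap ∘ₗ M.totalD n = N.totalD n ∘ₗ f.totalMap := by
  ext1 x
  funext q
  have h1 := LinearMap.congr_fun (f.comp_horiz (n - q) q) (x q)
  have h2 := LinearMap.congr_fun (f.comp_vert (n - (q + 1)) q) (x (q + 1))
  simp only [LinearMap.comp_apply] at h1 h2
  simp [totalMap, totalD, h1, h2]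

/-- The chain map induced on the product total complexes. -/
def periodicComplexMap : M.periodicComplex ⟶ N.periodicComplex where
  f _ := ModuleCat.ofHom f.totalMap
  comm' i j hij := by
    obtain rfl : j + 1 = i := hij
    simp only [periodicComplex, if_true, ← ModuleCat.ofHom_comp, totalMap_comp]

/-- The map induced on periodic cyclic homology. -/
noncomputable def periodicHomologyMap (n : ℤ) : M.periodicHomology n ⟶ N.periodicHomology n :=
  HomologicalComplex.homologyMap f.periodicComplexMap n

end Hom

end CyclicModule

/-! ### The Hochschild cyclic module and periodic cyclic homology of algebras -/

section Hochschild

variable (k : Type) [CommRing k] (A : Type u) [Ring A] [Algebra k A]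

/-- An operation on tuples which, in each variable, changes only one entry of the result, and
that one linearly. -/
structure IsMultilinearOp {m n : ℕ} (f : (Fin m → A) → (Fin n → A)) : Prop where
  exists_update : ∀ (a : Fin m → A) (i : Fin m), ∃ (j : Fin n) (L : A →ₗ[k] A),
    ∀ x, f (Function.update a i x) = Function.update (f a) j (L x)

variable {A}

/-- The linear map `A^{⊗m} → A^{⊗n}` sending `a₁ ⊗ ⋯ ⊗ aₘ` to the pure tensor of `f a`. -/
noncomputable def tensorOp {m n : ℕ} (f : (Fin m → A) → (Fin n → A)) (hf : IsMultilinearOp k A f) :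
    (⨂[k] _ : Fin m, A) →ₗ[k] (⨂[k] _ : Fin n, A) :=
  PiTensorProduct.lift
    { toFun := fun a => PiTensorProduct.tprod k (f a)
      map_update_add' := by
        intro inst a i x y
        rw [Subsingleton.elim inst (instDecidableEqFin m)]
        obtain ⟨j, L, h⟩ := hf.exists_update a i
        rw [h, h, h, map_add, MultilinearMap.map_update_add]
      map_update_smul' := by
        intro inst a i c x
        rw [Subsingleton.elim inst (instDecidableEqFin m)]
        obtain ⟨j, L, h⟩ := hf.exists_update a i
        rw [h, h, map_smul, MultilinearMap.map_update_smul] }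

@[simp]
theorem tensorOp_tprod {m n : ℕ} (f : (Fin m → A) → (Fin n → A)) (hf : IsMultilinearOp k A f)
    (a : Fin m → A) :
    tensorOp k f hf (PiTensorProduct.tprod k a) = PiTensorProduct.tprod k (f a) := by
  simp [tensorOp]

open CyclicTuple

theorem isMultilinearOp_rot (n : ℕ) : IsMultilinearOp k A (rot (A := A) (n := n)) where
  exists_update a i := by
    refine ⟨i + 1, LinearMap.id, fun x => ?_⟩
    funext j
    simp only [rot, Function.update_apply, LinearMap.id_apply, sub_eq_iff_eq_add]

theorem isMultilinearOp_degen {n : ℕ} (i : Fin (n + 1)) :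
    IsMultilinearOp k A (degen (A := A) i) where
  exists_update a j := by
    refine ⟨i.succ.succAbove j, LinearMap.id, fun x => ?_⟩
    simp [degen]

theorem isMultilinearOp_face {n : ℕ} (i : Fin (n + 2)) :
    IsMultilinearOp k A (face (A := A) i) where
  exists_update a j := by
    have hi := i.2
    have hj := j.2
    by_cases hl : (i : ℕ) = n + 1
    · by_cases h0 : (j : ℕ) = 0
      · refine ⟨0, LinearMap.mulLeft k (ev a (n + 1)), fun x => ext_ev fun m hm => ?_⟩
        simp only [ev_face, ev_update, LinearMap.mulLeft_apply, Fin.val_zero]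
        grind
      · by_cases h1 : (j : ℕ) = n + 1
        · refine ⟨0, LinearMap.mulRight k (ev a 0), fun x => ext_ev fun m hm => ?_⟩
          simp only [ev_face, ev_update, LinearMap.mulRight_apply, Fin.val_zero]
          grind
        · refine ⟨⟨j, by omega⟩, LinearMap.id, fun x => ext_ev fun m hm => ?_⟩
          simp only [ev_face, ev_update, LinearMap.id_apply]
          grind
    · by_cases h0 : (j : ℕ) = i
      · refine ⟨⟨i, by omega⟩, LinearMap.mulRight k (ev a (i + 1)), fun x => ext_ev fun m hm => ?_⟩
        simp only [ev_face, ev_update, LinearMap.mulRight_apply]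
        grind
      · by_cases h1 : (j : ℕ) = i + 1
        · refine ⟨⟨i, by omega⟩, LinearMap.mulLeft k (ev a i), fun x => ext_ev fun m hm => ?_⟩
          simp only [ev_face, ev_update, LinearMap.mulLeft_apply]
          grind
        · refine ⟨⟨if (j : ℕ) < i then j else j - 1, by split_ifs <;> omega⟩, LinearMap.id,
            fun x => ext_ev fun m hm => ?_⟩
          simp only [ev_face, ev_update, LinearMap.id_apply]
          grind

variable (A)

/-- The Hochschild cyclic module `[q] ↦ A^{⊗(q+1)}` of an associative unital `k`-algebra,
with tensor products over `k`. -/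
noncomputable def hochschild : CyclicModule.{u} k where
  obj q := ⨂[k] _ : Fin (q + 1), A
  d _ i := tensorOp k (face i) (isMultilinearOp_face k i)
  s _ i := tensorOp k (degen i) (isMultilinearOp_degen k i)
  t n := tensorOp k rot (isMultilinearOp_rot k n)
  d_comp_d n i j h := by
    ext a; simp [face_face i j h]
  s_comp_s n i j h := by
    ext a; simp [degen_degen i j h]
  d_comp_s_of_le n i j h := by
    ext a; simp [face_degen_lt i j h]
  d_comp_s_self n i := by
    ext a; simp [face_degen_self]
  d_comp_s_succ n i := by
    ext a; simp [face_degen_succ]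
  d_comp_s_of_gt n i j h := by
    ext a; simp [face_degen_gt i j h]
  d_zero_comp_t n := by
    ext a; simp [face_zero_rot]
  d_succ_comp_t n i := by
    ext a; simp [face_succ_rot]
  s_zero_comp_t n := by
    ext a; simp [degen_zero_rot]
  s_succ_comp_t n i := by
    ext a; simp [degen_succ_rot]
  t_pow n := by
    have h : ∀ (m : ℕ) (a : Fin (n + 1) → A),
        ((tensorOp k rot (isMultilinearOp_rot k n) : Module.End k (⨂[k] _ : Fin (n + 1), A)) ^ m)
          (PiTensorProduct.tprod k a) = PiTensorProduct.tprod k (rot^[m] a) := by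
      intro m a
      induction m with
      | zero => simp
      | succ m ih => rw [pow_succ', Module.End.mul_apply, ih, tensorOp_tprod,
          Function.iterate_succ_apply']
    ext a
    simp [h, rot_cycle]

variable {A} {B : Type u} [Ring B] [Algebra k B]

theorem map_face (f : A →ₐ[k] B) {n : ℕ} (i : Fin (n + 2)) (a : Fin (n + 2) → A) :
    (fun j => f (face i a j)) = face i (fun j => f (a j)) := by
  funext j
  by_cases hi : i = Fin.last (n + 1)
  · simp only [face, hi, if_true]
    split_ifs <;> simp
  · simp only [face, hi, if_false, Fin.contractNth]
    split_ifs <;> simp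

theorem map_degen (f : A →ₐ[k] B) {n : ℕ} (i : Fin (n + 1)) (a : Fin (n + 1) → A) :
    (fun j => f (degen i a j)) = degen i (fun j => f (a j)) := by
  funext j
  refine Fin.succAboveCases i.succ ?_ (fun l => ?_) j <;> simp [degen]

/-- The map of Hochschild cyclic modules `a₀ ⊗ ⋯ ⊗ a_q ↦ f a₀ ⊗ ⋯ ⊗ f a_q`. -/
noncomputable def hochschildMap (f : A →ₐ[k] B) :
    CyclicModule.Hom (hochschild k A) (hochschild k B) where
  app _ := PiTensorProduct.map fun _ => f.toLinearMap
  comp_d n i := PiTensorProduct.ext <| MultilinearMap.ext fun a => by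
    change PiTensorProduct.map (fun _ => f.toLinearMap)
        (tensorOp k (face i) (isMultilinearOp_face k i)
        (PiTensorProduct.tprod k a)) =
      tensorOp k (face i) (isMultilinearOp_face k i)
        (PiTensorProduct.map (fun _ => f.toLinearMap) (PiTensorProduct.tprod k a))
    rw [tensorOp_tprod, PiTensorProduct.map_tprod, PiTensorProduct.map_tprod, tensorOp_tprod]
    exact congrArg _ (map_face k f i a)
  comp_s n i := PiTensorProduct.ext <| MultilinearMap.ext fun a => by
    change PiTensorProduct.map (fun _ => f.toLinearMap)
        (tensorOp k (degen i) (isMultilinearOp_degen k i)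
        (PiTensorProduct.tprod k a)) =
      tensorOp k (degen i) (isMultilinearOp_degen k i)
        (PiTensorProduct.map (fun _ => f.toLinearMap) (PiTensorProduct.tprod k a))
    rw [tensorOp_tprod, PiTensorProduct.map_tprod, PiTensorProduct.map_tprod, tensorOp_tprod]
    exact congrArg _ (map_degen k f i a)
  comp_t n := PiTensorProduct.ext <| MultilinearMap.ext fun a => by
    change PiTensorProduct.map (fun _ => f.toLinearMap)
        (tensorOp k rot (isMultilinearOp_rot k n)
        (PiTensorProduct.tprod k a)) =
      tensorOp k rot (isMultilinearOp_rot k n)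
        (PiTensorProduct.map (fun _ => f.toLinearMap) (PiTensorProduct.tprod k a))
    rw [tensorOp_tprod, PiTensorProduct.map_tprod, PiTensorProduct.map_tprod, tensorOp_tprod]
    rfl

end Hochschild

/-- Periodic cyclic homology `HP_n(A)` of a ring `A`, with tensor products over the integers. -/
noncomputable def HP (A : Type u) [Ring A] (n : ℤ) : ModuleCat.{u} ℤ :=
  (hochschild ℤ A).periodicHomology n

/-- The map `HP_n(A) → HP_n(B)` induced by a ring homomorphism `A → B`. -/
noncomputable def HP.map {A B : Type u} [Ring A] [Ring B] (f : A →+* B) (n : ℤ) :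
    HP A n →ₗ[ℤ] HP B n :=
  ((hochschildMap ℤ f.toIntAlgHom).periodicHomologyMap n).hom

/-! Both statements reduce to the acyclicity of a kernel of maps of product total complexes: for a
surjection with square-zero kernel, the kernel of the induced map; for a cartesian square, the
common kernel of the two maps out of `A₀`. A nilpotent kernel is reached by factoring through
quotients by its powers (`HP.bijective_map_of_ker_pow`). The long exact sequence is a snake
argument: the Hochschild modules of the square form an exact sequence `M₀ → M₁ ⊕ M₂ → M₁₂ → 0`, and
the kernel on the left does not contribute once it is acyclic (`isExcisive_of_cartesian`,
`IsExcisive.connecting`).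

Acyclicity comes from a Cartan homotopy formula. An operator `D` acting at the initial entry, with
its conjugates by the cyclic operator acting at the other entries, gives a homotopy `h`. If `D`
behaves like a derivation under multiplication of neighbouring entries, then `∂h + h∂` is the sum
`L` of all the conjugates. For the applications, split `A` linearly into the relevant ideals and a
complement, and call elements of the summands letters. A word is a pure tensor of letters, and `D`
multiplies it by an integer telling whether its initial letter is marked, so `L` multiplies it by
its number of marks. For a square-zero ideal the letters of the ideal are marked. For two ideals
with zero intersection a letter of the second ideal is marked when the preceding letter outside the
complement, in cyclic order, lies in the first. The words spanning the kernel have a positive number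
of marks, which is invertible because `A` is a `ℚ`-algebra.

The complement need not be a subalgebra, so `D` is only a derivation up to the error measured by
`defect`, and the exact formula is `totalD_homotopy_add`. An error arises only when two letters of
the complement have a product with a component in an ideal, which increases the number of ideal
letters (`defect_natCast_mem`). Hence `∂h + h∂ = L + T`, where `T` raises a filtration that is
finite in each row (`errorOne_mem`, `errorTwo_mem`). A locally finite Neumann series, available
because the total complex is a product, shows that `L + T` is bijective
(`exists_unique_of_filtration`). A bijective null-homotopic chain map forces acyclicity
(`exists_totalD_eq_of_filtration`). -/

namespace CyclicModule

/-! ### Cartan homotopy of an operator on a cyclic module -/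

section Homotopy

variable {k : Type v} [CommRing k] (M : CyclicModule.{u} k)

/-- The signed cyclic operator as a unit. -/
def signedTUnit (n : ℕ) : (Module.End k (M.obj n))ˣ where
  val := M.signedT n
  inv := M.signedT n ^ n
  val_inv := by rw [← pow_succ', signedT_pow]
  inv_val := by rw [← pow_succ, signedT_pow]

/-- The integral powers of the signed cyclic operator. -/
def rho (n : ℕ) (z : ℤ) : M.obj n →ₗ[k] M.obj n :=
  ((M.signedTUnit n ^ z : (Module.End k (M.obj n))ˣ) : Module.End k (M.obj n))

theorem rho_rho (n : ℕ) (a c : ℤ) (x : M.obj n) : M.rho n a (M.rho n c x) = M.rho n (a + c) x := by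
  rw [rho, rho, rho, zpow_add]; rfl

@[simp]
theorem rho_zero (n : ℕ) (x : M.obj n) : M.rho n 0 x = x := by
  simp [rho]

theorem rho_natCast (n j : ℕ) : M.rho n j = M.signedT n ^ j := by
  rw [rho, zpow_natCast, Units.val_pow_eq_pow_val]; rfl

theorem rho_one (n : ℕ) : M.rho n 1 = M.signedT n := by
  simpa using M.rho_natCast n 1

theorem rho_period (n : ℕ) (x : M.obj n) : M.rho n (n + 1) x = x := by
  have := M.rho_natCast n (n + 1)
  rw [signedT_pow] at this
  push_cast at this
  rw [this]; rfl

theorem rho_add_period (n : ℕ) (z : ℤ) (x : M.obj n) : M.rho n (z + (n + 1)) x = M.rho n z x := by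
  rw [← rho_rho, rho_period]

theorem rho_sub_period (n : ℕ) (z : ℤ) (x : M.obj n) : M.rho n (z - (n + 1)) x = M.rho n z x := by
  rw [← rho_add_period, sub_add_cancel]

/-- All faces are conjugates of the face of index `0` by rotations, so every later computation
involves a single face and integer exponents of the signed cyclic operator. -/
theorem signedD_eq_rho (n j : ℕ) (hj : j < n + 2) (x : M.obj (n + 1)) :
    M.signedD n j x = M.rho n j (M.signedD n 0 (M.rho (n + 1) (-j) x)) := by
  have h := LinearMap.congr_fun (M.signedD_comp_pow n 0 j (by omega)) (M.rho (n + 1) (-j) x)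
  rw [← rho_natCast, ← rho_natCast, LinearMap.comp_apply, LinearMap.comp_apply, rho_rho,
    add_neg_cancel, rho_zero, zero_add] at h
  exact h

theorem b_apply_rho (n : ℕ) (x : M.obj (n + 1)) :
    M.b n x = ∑ j ∈ Finset.range (n + 2), M.rho n j (M.signedD n 0 (M.rho (n + 1) (-j) x)) := by
  rw [b_eq, LinearMap.sum_apply]
  exact Finset.sum_congr rfl fun j hj => M.signedD_eq_rho n j (by simpa using hj) x

theorem b'_apply_rho (n : ℕ) (x : M.obj (n + 1)) :
    M.b' n x = ∑ j ∈ Finset.range (n + 1), M.rho n j (M.signedD n 0 (M.rho (n + 1) (-j) x)) := by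
  rw [b'_eq, LinearMap.sum_apply]
  exact Finset.sum_congr rfl fun j hj => M.signedD_eq_rho n j (by simp at hj; omega) x

theorem norm_apply_rho (n : ℕ) (x : M.obj n) :
    M.norm n x = ∑ j ∈ Finset.range (n + 1), M.rho n j x := by
  rw [norm, LinearMap.sum_apply]
  exact Finset.sum_congr rfl fun j _ => by rw [rho_natCast]

variable (D : ∀ n, M.obj n →ₗ[k] M.obj n)

/-- The conjugate of an operator by a power of the signed cyclic operator. -/
def conj (n : ℕ) (z : ℤ) : M.obj n →ₗ[k] M.obj n := M.rho n z ∘ₗ D n ∘ₗ M.rho n (-z)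

theorem conj_apply (n : ℕ) (z : ℤ) (x : M.obj n) :
    M.conj D n z x = M.rho n z (D n (M.rho n (-z) x)) := rfl

theorem conj_zero (n : ℕ) (x : M.obj n) : M.conj D n 0 x = D n x := by
  simp [conj_apply]

theorem conj_rho (n : ℕ) (z w : ℤ) (x : M.obj n) :
    M.conj D n z (M.rho n w x) = M.rho n w (M.conj D n (z - w) x) := by
  simp only [conj_apply, rho_rho]
  rw [show -z + w = -(z - w) by ring, show w + (z - w) = z by ring]

theorem rho_conj (n : ℕ) (z w : ℤ) (x : M.obj n) :
    M.rho n w (M.conj D n z x) = M.conj D n (z + w) (M.rho n w x) := by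
  rw [conj_rho, add_sub_cancel_right]

theorem conj_add_period (n : ℕ) (z : ℤ) (x : M.obj n) :
    M.conj D n (z + (n + 1)) x = M.conj D n z x := by
  rw [conj_apply, conj_apply, rho_add_period,
    show -(z + ((n : ℤ) + 1)) = -z - (n + 1) by ring, rho_sub_period]

/-- The sum of the conjugates of an operator by the powers of the cyclic operator. -/
def totalConj (n : ℕ) : M.obj n →ₗ[k] M.obj n := ∑ j ∈ Finset.range (n + 1), M.conj D n j

/-- The component from the even to the odd columns of the homotopy attached to an operator. -/
def homotopyEven (n : ℕ) : M.obj n →ₗ[k] M.obj n :=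
  ∑ i ∈ Finset.range (n + 1), ∑ l ∈ Finset.range i, M.conj D n i ∘ₗ M.rho n l

/-- The component between the even columns of the homotopy attached to an operator. -/
def homotopyFace (n : ℕ) : M.obj (n + 1) →ₗ[k] M.obj n := M.signedD n 0 ∘ₗ M.conj D (n + 1) 1

theorem totalConj_apply (n : ℕ) (x : M.obj n) :
    M.totalConj D n x = ∑ j ∈ Finset.range (n + 1), M.conj D n j x := by
  rw [totalConj, LinearMap.sum_apply]

theorem homotopyEven_apply (n : ℕ) (x : M.obj n) : M.homotopyEven D n x =
    ∑ i ∈ Finset.range (n + 1), ∑ l ∈ Finset.range i, M.conj D n i (M.rho n l x) := by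
  simp [homotopyEven, LinearMap.sum_apply]

/-- For each `i` the inner sum telescopes to `conj i - conj i ∘ τ^i`, and the second term is `τ^i ∘
D`. These terms add up to the norm of `D x`. -/
theorem homotopyEven_add_norm (n : ℕ) (x : M.obj n) :
    M.homotopyEven D n (x - M.rho n 1 x) + M.norm n (D n x) = M.totalConj D n x := by
  rw [homotopyEven_apply, norm_apply_rho, totalConj_apply, ← Finset.sum_add_distrib]
  refine Finset.sum_congr rfl fun i _ => ?_
  have h : ∀ l ∈ Finset.range i, M.conj D n i (M.rho n l (x - M.rho n 1 x)) =
      M.conj D n i (M.rho n l x) - M.conj D n i (M.rho n (l + 1 : ℕ) x) := by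
    intro l _
    rw [map_sub, map_sub, rho_rho, Nat.cast_succ]
  rw [Finset.sum_congr rfl h, Finset.sum_range_sub', Nat.cast_zero, rho_zero, conj_rho, sub_self,
    conj_zero, sub_add_cancel]

theorem homotopyEven_sub_add (n : ℕ) (x : M.obj n) :
    M.homotopyEven D n x - M.rho n 1 (M.homotopyEven D n x) + D n (M.norm n x) =
      M.totalConj D n x := by
  set a : ℕ → M.obj n := fun i => ∑ l ∈ Finset.range i, M.conj D n i (M.rho n l x) with ha
  -- Applying `τ` raises both indices of a summand by one; the result is the next inner sum without
  -- its term `l = 0`.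
  have h : ∀ i ∈ Finset.range (n + 1),
      M.rho n 1 (a i) = a (i + 1) - M.conj D n (i + 1) x := by
    intro i _
    simp only [ha, Finset.sum_range_succ', map_sum, rho_conj, rho_rho, Nat.cast_zero, rho_zero,
      Nat.cast_succ, add_sub_cancel_right]
    exact Finset.sum_congr rfl fun l _ => by rw [add_comm (1 : ℤ)]
  have h1 : a (n + 1) = D n (M.norm n x) := by
    rw [ha, norm_apply_rho, ← conj_zero, map_sum]
    refine Finset.sum_congr rfl fun l _ => ?_
    rw [Nat.cast_succ, ← conj_add_period (z := 0), zero_add]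
  have h2 : M.totalConj D n x = ∑ i ∈ Finset.range (n + 1), M.conj D n (i + 1) x := by
    rw [totalConj_apply, Finset.sum_range_succ', Finset.sum_range_succ, Nat.cast_zero,
      ← conj_add_period (z := 0), zero_add]
    simp only [Nat.cast_succ]
  rw [homotopyEven_apply, map_sum, Finset.sum_congr rfl h, ← Finset.sum_sub_distrib, ← h1, h2]
  have h3 : ∀ i ∈ Finset.range (n + 1), a i - (a (i + 1) - M.conj D n (i + 1) x) =
      (a i - a (i + 1)) + M.conj D n (i + 1) x := fun i _ => by abel
  rw [Finset.sum_congr rfl h3, Finset.sum_add_distrib, Finset.sum_range_sub']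
  simp [ha]

/-- The shifted operator: what the conjugate `M.conj D n z` becomes above the face `d₀`, were `D`
a derivation in the entry of index `0`. -/
def conjShift (n : ℕ) (z : ℤ) : M.obj (n + 1) →ₗ[k] M.obj (n + 1) :=
  if z % (n + 1) = 0 then M.conj D (n + 1) 0 + M.conj D (n + 1) 1
  else M.conj D (n + 1) (z % (n + 1) + 1)

/-- The defect of compatibility of an operator with the face `d₀`. -/
def defect (n : ℕ) (z : ℤ) : M.obj (n + 1) →ₗ[k] M.obj n :=
  M.signedD n 0 ∘ₗ M.conjShift D n z - M.conj D n z ∘ₗ M.signedD n 0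

theorem conj_signedD (n : ℕ) (z : ℤ) (x : M.obj (n + 1)) :
    M.conj D n z (M.signedD n 0 x) =
      M.signedD n 0 (M.conjShift D n z x) - M.defect D n z x := by
  simp [defect]

theorem conjShift_zero (n : ℕ) (x : M.obj (n + 1)) :
    M.conjShift D n 0 x = M.conj D (n + 1) 0 x + M.conj D (n + 1) 1 x := by
  simp [conjShift]

theorem conjShift_of_pos (n : ℕ) (z : ℤ) (h0 : 0 < z) (h1 : z < n + 1) (x : M.obj (n + 1)) :
    M.conjShift D n z x = M.conj D (n + 1) (z + 1) x := by
  rw [conjShift, Int.emod_eq_of_lt h0.le h1, if_neg h0.ne']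

theorem conjShift_add_period (n : ℕ) (z : ℤ) :
    M.conjShift D n (z + (n + 1)) = M.conjShift D n z := by
  simp [conjShift]

theorem conjShift_of_neg (n : ℕ) (z : ℤ) (h0 : z < 0) (h1 : -(n + 1) < z) (x : M.obj (n + 1)) :
    M.conjShift D n z x = M.conj D (n + 1) z x := by
  rw [← conjShift_add_period, conjShift_of_pos _ _ _ _ (by omega) (by omega),
    ← conj_add_period (z := z)]
  congr 1
  push_cast
  ring_nf

theorem defect_add_period (n : ℕ) (z : ℤ) :
    M.defect D n (z + (n + 1)) = M.defect D n z := by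
  ext x
  simp only [defect, conjShift_add_period, LinearMap.sub_apply, LinearMap.comp_apply,
    conj_add_period]

theorem defect_emod (n : ℕ) (z : ℤ) : M.defect D n (z % (n + 1)) = M.defect D n z := by
  have h : ∀ (m : ℕ) (z : ℤ), M.defect D n (z + m * (n + 1)) = M.defect D n z := by
    intro m z
    induction m with
    | zero => simp
    | succ m ih => rw [← ih, ← defect_add_period (z := z + m * (n + 1))]; congr 1; push_cast; ring
  have e := Int.emod_add_mul_ediv z (n + 1)
  rcases Int.eq_nat_or_neg (z / (n + 1)) with ⟨m, hm | hm⟩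
  · rw [← h m (z % (n + 1))]; congr 1; rw [← hm]; linarith
  · rw [← h m z]; congr 1
    have : (m : ℤ) = - (z / (n + 1)) := by omega
    rw [this]; linarith

/-- The homotopy relation in the odd columns. -/
theorem homotopy_odd (n : ℕ) (x : M.obj (n + 1)) :
    M.b n (D (n + 1) x) - D n (M.b' n x) + M.homotopyFace D n (x - M.rho (n + 1) 1 x) =
      ∑ j ∈ Finset.range (n + 1), M.rho n j (M.defect D n (-j) (M.rho (n + 1) (-j) x)) := by
  have h1 : ∀ j ∈ Finset.range n,
      M.rho n (j + 1 : ℕ) (M.defect D n (-(j + 1 : ℕ)) (M.rho (n + 1) (-(j + 1 : ℕ)) x)) =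
      M.rho n (j + 1 : ℕ) (M.signedD n 0 (M.rho (n + 1) (-(j + 1 : ℕ)) (D (n + 1) x))) -
      D n (M.rho n (j + 1 : ℕ) (M.signedD n 0 (M.rho (n + 1) (-(j + 1 : ℕ)) x))) := by
    intro j hj
    have hj : j < n := by simpa using hj
    rw [defect, LinearMap.sub_apply, LinearMap.comp_apply, LinearMap.comp_apply,
      conjShift_of_neg _ _ _ _ (by omega) (by omega), map_sub, ← conj_zero, ← conj_zero]
    rw [conj_rho, sub_self, conj_zero, conj_zero, rho_conj, neg_add_cancel, conj_zero]
  -- Since `conj 1 ∘ τ = τ ∘ D`, the subtracted term is the last face of `D x`, exactly what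
  -- distinguishes `b` from `b'`.
  have h2 : M.b n (D (n + 1) x) - M.homotopyFace D n (M.rho (n + 1) 1 x) =
      M.b' n (D (n + 1) x) := by
    rw [b_apply_rho, b'_apply_rho, Finset.sum_range_succ, add_sub_assoc, add_eq_left, sub_eq_zero,
      homotopyFace, LinearMap.comp_apply, conj_rho, sub_self, conj_zero, Nat.cast_succ, rho_period,
      ← rho_add_period]
    congr 2
    push_cast
    ring_nf
  have h3 : M.b n (D (n + 1) x) - D n (M.b' n x) + M.homotopyFace D n (x - M.rho (n + 1) 1 x) =
      M.b' n (D (n + 1) x) - D n (M.b' n x) + M.homotopyFace D n x := by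
    rw [← h2, map_sub]; abel
  rw [h3, b'_apply_rho, b'_apply_rho, Finset.sum_range_succ', Finset.sum_range_succ' _ n,
    Finset.sum_range_succ' _ n, Finset.sum_congr rfl h1, Finset.sum_sub_distrib, map_add, map_sum]
  simp only [Nat.cast_zero, neg_zero, rho_zero, defect, LinearMap.sub_apply, LinearMap.comp_apply,
    conjShift_zero, conj_zero, map_add, homotopyFace]
  abel

/-- The homotopy relation in the even columns. -/
theorem homotopy_even (n : ℕ) (x : M.obj (n + 1)) :
    M.norm n (M.homotopyFace D n x) - M.b' n (M.homotopyEven D (n + 1) x) +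
      M.homotopyEven D n (M.b n x) =
    -∑ i ∈ Finset.range (n + 1), ∑ l ∈ Finset.range i, ∑ j ∈ Finset.range (n + 2),
      M.rho n (l + j) (M.defect D n (i - l - j) (M.rho (n + 1) (-j) x)) := by
  -- For `a ≤ n + 1` this is the signed face of index `a` applied to `conj i (τ^l x)`, with all
  -- rotations brought into normal form. The whole identity is then a matching of index ranges for
  -- `g`.
  set g : ℕ → ℕ → ℕ → M.obj n := fun i l a =>
    M.rho n a (M.signedD n 0 (M.conj D (n + 1) (i - a) (M.rho (n + 1) (l - a) x))) with hg
  have hN : M.norm n (M.homotopyFace D n x) = ∑ a ∈ Finset.range (n + 1), g (a + 1) a a := by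
    rw [norm_apply_rho]
    refine Finset.sum_congr rfl fun a _ => ?_
    simp [hg, homotopyFace]
  have hb' : M.b' n (M.homotopyEven D (n + 1) x) = ∑ i ∈ Finset.range (n + 1),
      ∑ l ∈ Finset.range (i + 1), ∑ a ∈ Finset.range (n + 1), g (i + 1) l a := by
    have h0 : M.b' n (M.homotopyEven D (n + 1) x) = ∑ i ∈ Finset.range (n + 2),
      ∑ l ∈ Finset.range i, ∑ a ∈ Finset.range (n + 1), g i l a := by
      simp only [homotopyEven_apply, map_sum, b'_apply_rho, rho_conj, rho_rho, ← sub_eq_add_neg,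
        neg_add_eq_sub]
      rfl
    rw [h0, Finset.sum_range_succ', Finset.range_zero, Finset.sum_empty, add_zero]
  have hb : M.homotopyEven D n (M.b n x) +
      ∑ i ∈ Finset.range (n + 1), ∑ l ∈ Finset.range i, ∑ j ∈ Finset.range (n + 2),
        M.rho n (l + j) (M.defect D n (i - l - j) (M.rho (n + 1) (-j) x)) =
      ∑ i ∈ Finset.range (n + 1), ∑ l ∈ Finset.range i, (∑ a ∈ Finset.Ico l (i + 1), g (i + 1) l a +
        ∑ a ∈ Finset.Ico i (n + 1), g i l a + ∑ a ∈ Finset.range (l + 1), g (i + 1) (l + 1) a) := by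
    rw [homotopyEven_apply, ← Finset.sum_add_distrib]
    refine Finset.sum_congr rfl fun i hi => ?_
    rw [← Finset.sum_add_distrib]
    refine Finset.sum_congr rfl fun l hl => ?_
    have hi : i < n + 1 := by simpa using hi
    have hl : l < i := by simpa using hl
    rw [b_apply_rho, map_sum, map_sum, ← Finset.sum_add_distrib]
    simp only [rho_rho, conj_rho, conj_signedD, map_sub, ← sub_sub, sub_add_cancel]
    set f : ℕ → M.obj n := fun j => M.rho n (l + j)
      (M.signedD n 0 (M.conjShift D n (i - l - j) (M.rho (n + 1) (-j) x))) with hf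
    change ∑ j ∈ Finset.range (n + 2), f j = _
    -- The index of the shifted operator is `i - l - j`. It is positive on the first range, zero at
    -- `j = i - l`, and negative afterwards; the final range consists of the terms whose rotation
    -- passes a full turn.
    have e0 : ∑ j ∈ Finset.range (n + 2), f j = ∑ j ∈ Finset.Ico 0 (i - l), f j + f (i - l) +
        ∑ j ∈ Finset.Ico (i - l + 1) (n + 1 - l), f j +
        ∑ j ∈ Finset.Ico (n + 1 - l) (n + 2), f j := by
      rw [← Finset.sum_Ico_succ_top (by omega), Finset.sum_Ico_consecutive _ (by omega) (by omega),
        Finset.sum_Ico_consecutive _ (by omega) (by omega), Finset.range_eq_Ico]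
    have e1 : ∑ j ∈ Finset.Ico 0 (i - l), f j = ∑ a ∈ Finset.Ico l i, g (i + 1) l a := by
      have := Finset.sum_Ico_add (fun a => g (i + 1) l a) 0 (i - l) l
      rw [zero_add, Nat.sub_add_cancel hl.le] at this
      rw [← this]
      refine Finset.sum_congr rfl fun j hj => ?_
      simp only [Finset.mem_Ico] at hj
      simp only [hf, hg]
      rw [conjShift_of_pos _ _ _ _ (by omega) (by omega)]
      congr 3 <;> push_cast <;> ring_nf
    -- Here the operator acts on the merged entry, so the Leibniz rule contributes two terms.
    have e2 : f (i - l) = g (i + 1) l i + g i l i := by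
      have : ((i - l : ℕ) : ℤ) = i - l := by omega
      simp only [hf, hg, this, sub_self, conjShift_zero, map_add, add_sub_cancel, Nat.cast_succ,
        add_sub_cancel_left, neg_sub]
      abel
    have e3 : ∑ j ∈ Finset.Ico (i - l + 1) (n + 1 - l), f j =
        ∑ a ∈ Finset.Ico (i + 1) (n + 1), g i l a := by
      have := Finset.sum_Ico_add (fun a => g i l a) (i - l + 1) (n + 1 - l) l
      rw [show i - l + 1 + l = i + 1 by omega, show n + 1 - l + l = n + 1 by omega] at this
      rw [← this]
      refine Finset.sum_congr rfl fun j hj => ?_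
      simp only [Finset.mem_Ico] at hj
      simp only [hf, hg]
      rw [conjShift_of_neg _ _ _ _ (by omega) (by omega)]
      congr 3 <;> push_cast <;> ring_nf
    have e4 : ∑ j ∈ Finset.Ico (n + 1 - l) (n + 2), f j =
        ∑ a ∈ Finset.range (l + 1), g (i + 1) (l + 1) a := by
      have := Finset.sum_Ico_add f 0 (l + 1) (n + 1 - l)
      rw [zero_add, show l + 1 + (n + 1 - l) = n + 2 by omega] at this
      rw [← this, Finset.range_eq_Ico]
      refine Finset.sum_congr rfl fun j hj => ?_
      simp only [Finset.mem_Ico] at hj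
      simp only [hf, hg]
      -- A full turn is `n + 1` after the face but `n + 2` before it; this discrepancy turns `i`,
      -- `l` into `i + 1`, `l + 1`.
      rw [conjShift_of_neg _ _ _ _ (by omega) (by omega), ← conj_add_period,
        ← rho_add_period (z := -((n + 1 - l + j : ℕ) : ℤ)), ← rho_add_period (z := j)]
      have : ((n + 1 - l : ℕ) : ℤ) = n + 1 - l := by omega
      push_cast
      rw [this]
      ring_nf
    rw [e0, e1, e2, e3, e4, Finset.sum_Ico_succ_top hl.le,
      Finset.sum_eq_sum_Ico_succ_bot hi (fun a => g i l a)]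
    abel
  have key : ∑ i ∈ Finset.range (n + 1), ∑ l ∈ Finset.range (i + 1),
      ∑ a ∈ Finset.range (n + 1), g (i + 1) l a =
      ∑ a ∈ Finset.range (n + 1), g (a + 1) a a +
      ∑ i ∈ Finset.range (n + 1), ∑ l ∈ Finset.range i, (∑ a ∈ Finset.Ico l (i + 1), g (i + 1) l a +
        ∑ a ∈ Finset.Ico i (n + 1), g i l a +
        ∑ a ∈ Finset.range (l + 1), g (i + 1) (l + 1) a) := by
    have e1 : ∀ i ∈ Finset.range (n + 1), ∑ l ∈ Finset.range (i + 1),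
        ∑ a ∈ Finset.range (n + 1), g (i + 1) l a =
        (g (i + 1) i i + ∑ l ∈ Finset.range i, ∑ a ∈ Finset.Ico l (i + 1), g (i + 1) l a) +
        ∑ l ∈ Finset.range i, ∑ a ∈ Finset.range (l + 1), g (i + 1) (l + 1) a +
        ∑ l ∈ Finset.range (i + 1), ∑ a ∈ Finset.Ico (i + 1) (n + 1), g (i + 1) l a := by
      intro i hi
      have hi : i < n + 1 := by simpa using hi
      have e2 : ∀ l ∈ Finset.range (i + 1), ∑ a ∈ Finset.range (n + 1), g (i + 1) l a =
          ∑ a ∈ Finset.range l, g (i + 1) l a + ∑ a ∈ Finset.Ico l (i + 1), g (i + 1) l a +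
          ∑ a ∈ Finset.Ico (i + 1) (n + 1), g (i + 1) l a := by
        intro l hl
        have hl : l < i + 1 := by simpa using hl
        rw [Finset.range_eq_Ico, Finset.range_eq_Ico,
          Finset.sum_Ico_consecutive _ (by omega) (by omega),
          Finset.sum_Ico_consecutive _ (by omega) (by omega)]
      rw [Finset.sum_congr rfl e2, Finset.sum_add_distrib, Finset.sum_add_distrib,
        Finset.sum_range_succ' (fun l => ∑ a ∈ Finset.range l, g (i + 1) l a),
        Finset.sum_range_succ (fun l => ∑ a ∈ Finset.Ico l (i + 1), g (i + 1) l a)]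
      simp only [Finset.range_zero, Finset.sum_empty, add_zero, Nat.Ico_succ_singleton,
        Finset.sum_singleton]
      abel
    have e3 : ∑ i ∈ Finset.range (n + 1), ∑ l ∈ Finset.range (i + 1),
        ∑ a ∈ Finset.Ico (i + 1) (n + 1), g (i + 1) l a =
        ∑ i ∈ Finset.range (n + 1), ∑ l ∈ Finset.range i, ∑ a ∈ Finset.Ico i (n + 1), g i l a := by
      have h1 := Finset.sum_range_succ'
        (fun i => ∑ l ∈ Finset.range i, ∑ a ∈ Finset.Ico i (n + 1), g i l a) (n + 1)
      rw [Finset.sum_range_succ] at h1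
      simpa using h1.symm
    rw [Finset.sum_congr rfl e1]
    simp only [Finset.sum_add_distrib]
    rw [e3]
    abel
  rw [hN, hb', key, ← hb]
  abel

/-- The component of the square of the homotopy that lowers the degree by two. -/
theorem homotopyFace_b (n : ℕ) (x : M.obj (n + 2)) :
    M.b n (M.homotopyFace D (n + 1) x) + M.homotopyFace D n (M.b (n + 1) x) =
    -∑ j ∈ Finset.range (n + 3), M.signedD n 0
      (M.rho (n + 1) j (M.defect D (n + 1) (1 - j) (M.rho (n + 2) (-j) x))) := by
  -- The signed simplicial identity `d₀ dⱼ₊₁ = -dⱼ d₀` pairs off the summands. The summand with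
  -- `conj 2` cancels against one half of the Leibniz term, and the rest cancel `b` applied after
  -- the homotopy.
  have h1 : ∀ (j : ℕ), j < n + 2 → ∀ y : M.obj (n + 2), M.signedD n 0 (M.rho (n + 1) (j + 1 : ℕ)
      (M.signedD (n + 1) 0 (M.rho (n + 2) (-(j + 1 : ℕ)) y))) =
      -M.signedD n j (M.signedD (n + 1) 0 y) := by
    intro j hj y
    rw [← signedD_eq_rho _ _ _ (by omega)]
    exact LinearMap.congr_fun (M.signedD_comp n 0 j (by omega) hj) y
  have h2 : M.homotopyFace D n (M.b (n + 1) x) + ∑ j ∈ Finset.range (n + 3), M.signedD n 0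
      (M.rho (n + 1) j (M.defect D (n + 1) (1 - j) (M.rho (n + 2) (-j) x))) =
      ∑ j ∈ Finset.range (n + 3), M.signedD n 0 (M.rho (n + 1) j
        (M.signedD (n + 1) 0 (M.conjShift D (n + 1) (1 - j) (M.rho (n + 2) (-j) x)))) := by
    rw [b_apply_rho, map_sum, ← Finset.sum_add_distrib]
    refine Finset.sum_congr rfl fun j _ => ?_
    simp only [homotopyFace, LinearMap.comp_apply, conj_rho, conj_signedD, map_sub, sub_add_cancel]
  have h3 : ∀ j ∈ Finset.range (n + 1), M.signedD n 0 (M.rho (n + 1) (j + 1 + 1 : ℕ)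
      (M.signedD (n + 1) 0 (M.conjShift D (n + 1) (1 - (j + 1 + 1 : ℕ))
        (M.rho (n + 2) (-(j + 1 + 1 : ℕ)) x)))) =
      -M.signedD n (j + 1) (M.signedD (n + 1) 0 (M.conj D (n + 2) 1 x)) := by
    intro j hj
    have hj : j < n + 1 := by simpa using hj
    rw [conjShift_of_neg _ _ _ _ (by push_cast; omega) (by push_cast; omega),
      ← h1 _ (by omega), rho_conj, sub_eq_add_neg]
  have h4 : M.b n (M.homotopyFace D (n + 1) x) =
      ∑ j ∈ Finset.range (n + 2), M.signedD n j (M.signedD (n + 1) 0 (M.conj D (n + 2) 1 x)) := by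
    rw [b_eq, LinearMap.sum_apply]; rfl
  have h5 := h1 0 (by omega)
  have h6 : M.conjShift D (n + 1) 1 x = M.conj D (n + 2) (1 + 1) x :=
    M.conjShift_of_pos D (n + 1) 1 (by omega) (by push_cast; omega) x
  rw [eq_neg_iff_add_eq_zero, add_assoc, h2, h4, Finset.sum_range_succ' _ (n + 1),
    Finset.sum_range_succ' _ (n + 2), Finset.sum_range_succ' _ (n + 1), Finset.sum_congr rfl h3, Finset.sum_neg_distrib]
  simp only [zero_add, Nat.cast_one] at h5
  simp only [zero_add, Nat.cast_one, Nat.cast_zero, sub_self, sub_zero, neg_zero, rho_zero,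
    conjShift_zero, h6, conj_rho, map_add, h5, sub_neg_eq_add]
  abel

end Homotopy

end CyclicModule

namespace CyclicModule

/-! ### The homotopy formula on the product total complex -/

section Acyclic

variable {k : Type v} [CommRing k] (M : CyclicModule.{u} k) (D : ∀ n, M.obj n →ₗ[k] M.obj n)

/-- The homotopy on the product total complex attached to an operator. -/
def homotopy (n : ℤ) (x : ∀ q, M.obj q) : ∀ q, M.obj q := fun q =>
  if Even (n - q) then M.homotopyEven D q (x q)
  else D q (x q) + M.homotopyFace D q (x (q + 1))

theorem totalD_apply (n : ℤ) (x : ∀ q, M.obj q) (q : ℕ) :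
    M.totalD n x q = M.horiz (n - q) q (x q) + M.vert (n - (q + 1)) q (x (q + 1)) := rfl

theorem totalD_apply_of_even (n : ℤ) (x : ∀ q, M.obj q) (q : ℕ) (h : Even (n - q)) :
    M.totalD n x q = M.norm q (x q) - M.b' q (x (q + 1)) := by
  have h' : ¬ Even (n - (q + 1)) := by grind
  rw [totalD_apply, horiz, vert, if_pos h, if_neg h', LinearMap.neg_apply, sub_eq_add_neg]

theorem totalD_apply_of_odd (n : ℤ) (x : ∀ q, M.obj q) (q : ℕ) (h : ¬ Even (n - q)) :
    M.totalD n x q = x q - M.rho q 1 (x q) + M.b q (x (q + 1)) := by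
  have h' : Even (n - (q + 1)) := by grind
  rw [totalD_apply, horiz, vert, if_neg h, if_pos h', rho_one]
  rfl

/-- The component of `∂h + h∂` lowering the degree by one, in the rows of a given parity. -/
def errorOne (n : ℤ) (q : ℕ) : M.obj (q + 1) →ₗ[k] M.obj q :=
  if Even (n - q) then
    ∑ j ∈ Finset.range (q + 1), M.rho q j ∘ₗ M.defect D q (-j) ∘ₗ M.rho (q + 1) (-j)
  else -∑ i ∈ Finset.range (q + 1), ∑ l ∈ Finset.range i, ∑ j ∈ Finset.range (q + 2),
      M.rho q (l + j) ∘ₗ M.defect D q (i - l - j) ∘ₗ M.rho (q + 1) (-j)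

/-- The component of `∂h + h∂` lowering the degree by two, in the rows of a given parity. -/
def errorTwo (n : ℤ) (q : ℕ) : M.obj (q + 2) →ₗ[k] M.obj q :=
  if Even (n - q) then
    M.b q ∘ₗ M.homotopyFace D (q + 1) + M.homotopyFace D q ∘ₗ M.b (q + 1)
  else 0

/-- The two telescoping identities give the diagonal term in both parities. The identities for `b`,
`b'` and the face part of the homotopy give the terms that vanish when the defect does. -/
theorem totalD_homotopy_add (n : ℤ) (x : ∀ q, M.obj q) (q : ℕ) :
    M.totalD (n + 1) (M.homotopy D n x) q + M.homotopy D (n - 1) (M.totalD n x) q =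
      M.totalConj D q (x q) + M.errorOne D n q (x (q + 1)) + M.errorTwo D n q (x (q + 2)) := by
  by_cases h : Even (n - q)
  · have h1 : ¬ Even (n + 1 - q) := by grind
    have h2 : ¬ Even (n - 1 - q) := by grind
    have h3 : ¬ Even (n - (q + 1 : ℕ)) := by grind
    rw [totalD_apply_of_odd _ _ _ _ h1, homotopy, homotopy, homotopy, if_pos h, if_neg h2,
      if_neg h3, totalD_apply_of_even _ _ _ _ h, totalD_apply_of_odd _ _ _ _ h3, errorOne,
      errorTwo, if_pos h, if_pos h, ← homotopyEven_sub_add]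
    simp only [LinearMap.sum_apply, LinearMap.comp_apply, LinearMap.add_apply]
    rw [← homotopy_odd]
    simp only [map_sub, map_add]
    abel
  · have h1 : Even (n + 1 - q) := by grind
    have h2 : Even (n - 1 - q) := by grind
    have h3 : Even (n - (q + 1 : ℕ)) := by grind
    rw [totalD_apply_of_even _ _ _ _ h1, homotopy, homotopy, homotopy, if_neg h, if_pos h2,
      if_pos h3, totalD_apply_of_odd _ _ _ _ h, errorOne,
      errorTwo, if_neg h, if_neg h, ← homotopyEven_add_norm]
    simp only [LinearMap.sum_apply, LinearMap.comp_apply, LinearMap.neg_apply,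
      LinearMap.zero_apply]
    rw [← homotopy_even]
    simp only [map_sub, map_add]
    abel

theorem homotopy_zero (n : ℤ) : M.homotopy D n 0 = 0 := by
  funext q
  simp [homotopy]

theorem totalD_totalD (n : ℤ) (x : ∀ q, M.obj q) : M.totalD n (M.totalD (n + 1) x) = 0 := by
  have h := LinearMap.congr_fun (M.totalD_comp (n + 1)) x
  rwa [add_sub_cancel_right] at h

end Acyclic

end CyclicModule

/-! ### Locally finite Neumann series -/

section Neumann

variable {X : ℕ → Type u} [∀ q, AddCommGroup (X q)]

/-- Locally finite Neumann series: `L + T` is bijective on sequences with entries in `G 0 q` if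
`L` is so and `T` lowers the index and raises a filtration which is finite in each index. -/
theorem exists_unique_of_filtration (G : ℕ → ∀ q, AddSubgroup (X q)) (c : ℕ → ℕ)
    (hG : ∀ s q, c q ≤ s → G s q = ⊥)
    (L W : ∀ q, X q →+ X q) (T₁ : ∀ q, X (q + 1) →+ X q) (T₂ : ∀ q, X (q + 2) →+ X q)
    (hW : ∀ s q, ∀ x ∈ G s q, W q x ∈ G s q)
    (hLW : ∀ q, ∀ x ∈ G 0 q, L q (W q x) = x) (hWL : ∀ q, ∀ x ∈ G 0 q, W q (L q x) = x)
    (hT₁ : ∀ s q, ∀ x ∈ G s (q + 1), T₁ q x ∈ G (s + 1) q)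
    (hT₂ : ∀ s q, ∀ x ∈ G s (q + 2), T₂ q x ∈ G (s + 1) q)
    (hanti : ∀ s q, G (s + 1) q ≤ G s q) :
    (∀ x : ∀ q, X q, (∀ q, x q ∈ G 0 q) → ∃ y : ∀ q, X q, (∀ q, y q ∈ G 0 q) ∧
      ∀ q, L q (y q) + T₁ q (y (q + 1)) + T₂ q (y (q + 2)) = x q) ∧
    (∀ y : ∀ q, X q, (∀ q, y q ∈ G 0 q) →
      (∀ q, L q (y q) + T₁ q (y (q + 1)) + T₂ q (y (q + 2)) = 0) → y = 0) := by
  have hle : ∀ s q, G s q ≤ G 0 q := by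
    intro s q
    induction s with
    | zero => exact le_rfl
    | succ s ih => exact (hanti s q).trans ih
  let Z : (∀ q, X q) → ∀ q, X q := fun y q => -W q (T₁ q (y (q + 1)) + T₂ q (y (q + 2)))
  have hZ : ∀ s y, (∀ q, y q ∈ G s q) → ∀ q, Z y q ∈ G (s + 1) q := fun s y hy q =>
    neg_mem (hW _ _ _ (add_mem (hT₁ _ _ _ (hy _)) (hT₂ _ _ _ (hy _))))
  have hZi : ∀ s y, (∀ q, y q ∈ G 0 q) → ∀ q, Z^[s] y q ∈ G s q := by
    intro s y hy
    induction s with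
    | zero => exact hy
    | succ s ih => rw [Function.iterate_succ_apply']; exact hZ s _ ih
  have hzero : ∀ s y q, (∀ q, y q ∈ G 0 q) → c q ≤ s → Z^[s] y q = 0 := by
    intro s y q hy hs
    have := hZi s y hy q
    rwa [hG s q hs, AddSubgroup.mem_bot] at this
  have hL : ∀ y : ∀ q, X q, (∀ q, y q ∈ G 0 q) → ∀ q,
      L q (y q) + T₁ q (y (q + 1)) + T₂ q (y (q + 2)) = L q (y q - Z y q) := by
    intro y hy q
    have h0 : T₁ q (y (q + 1)) + T₂ q (y (q + 2)) ∈ G 0 q :=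
      hle 1 q (add_mem (hT₁ _ _ _ (hy _)) (hT₂ _ _ _ (hy _)))
    rw [map_sub, map_neg, hLW q _ h0, sub_neg_eq_add, add_assoc]
  constructor
  · intro x hx
    set w : ∀ q, X q := fun q => W q (x q) with hw
    have hw0 : ∀ q, w q ∈ G 0 q := fun q => hW _ _ _ (hx q)
    have hmem : ∀ s q, Z^[s] w q ∈ G 0 q := fun s q => hle s q (hZi s w hw0 q)
    -- The iterate of order `s` lies in filtration level `s`, so in entry `q` only the first `c q`
    -- terms of the series can be nonzero.
    let y : ∀ q, X q := fun q => ∑ s ∈ Finset.range (c q), Z^[s] w q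
    have hy : ∀ N q, c q ≤ N → y q = ∑ s ∈ Finset.range N, Z^[s] w q := by
      intro N q hN
      refine Finset.sum_subset (Finset.range_mono hN) fun s _ hs => ?_
      exact hzero s w q hw0 (by simpa using hs)
    have hy0 : ∀ q, y q ∈ G 0 q := fun q => sum_mem fun s _ => hmem s q
    refine ⟨y, hy0, fun q => ?_⟩
    rw [hL y hy0]
    have hyZ : y q - Z y q = w q := by
      -- Entry `q` of `Z y` involves `y` in the entries `q + 1` and `q + 2`, so all three
      -- truncations need a common length before telescoping.
      obtain ⟨N, h0, h1, h2⟩ : ∃ N, c q ≤ N ∧ c (q + 1) ≤ N ∧ c (q + 2) ≤ N :=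
        ⟨max (c q) (max (c (q + 1)) (c (q + 2))), by simp⟩
      have hs : Z y q = ∑ s ∈ Finset.range N, Z^[s + 1] w q := by
        simp only [Z, hy N _ h1, hy N _ h2, map_sum, ← Finset.sum_add_distrib,
          ← Finset.sum_neg_distrib, Function.iterate_succ_apply']
      rw [hs, hy (N + 1) q (by omega), Finset.sum_range_succ' _ N, add_sub_cancel_left]
      rfl
    rw [hyZ, hw, hLW q _ (hx q)]
  · intro y hy h
    have hfix : Z y = y := by
      funext q
      have h1 := h q
      rw [hL y hy] at h1
      have h2 := hWL q (y q - Z y q) (sub_mem (hy q) (hle 1 q (hZ 0 y hy q)))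
      rw [h1, map_zero] at h2
      exact (sub_eq_zero.mp h2.symm).symm
    funext q
    have := hzero (c q) y q hy le_rfl
    rwa [Function.iterate_fixed hfix] at this

end Neumann

/-! ### Acyclicity of a stable subcomplex -/

namespace CyclicModule

variable {k : Type v} [CommRing k] (M : CyclicModule.{u} k) (D : ∀ n, M.obj n →ₗ[k] M.obj n)

theorem rho_mem_of_signedT {K : ∀ q, Submodule k (M.obj q)}
    (ht : ∀ q, ∀ x ∈ K q, M.signedT q x ∈ K q) (q : ℕ) (z : ℤ) (x : M.obj q) (hx : x ∈ K q) :
    M.rho q z x ∈ K q := by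
  have h : ∀ (j : ℕ) (y : M.obj q), y ∈ K q → M.rho q j y ∈ K q := by
    intro j y hy
    induction j with
    | zero => simpa using hy
    | succ j ih => rw [Nat.cast_succ, add_comm, ← rho_rho, rho_one]; exact ht _ _ ih
  rcases Int.eq_nat_or_neg z with ⟨m, rfl | rfl⟩
  · exact h m x hx
  · have h1 : M.rho q (-m) x = M.rho q (m * q : ℕ) x := by
      have h2 : ∀ j : ℕ, M.rho q (j * (q + 1)) x = x := by
        intro j
        induction j with
        | zero => simp
        | succ j ih => rw [Nat.cast_succ, add_mul, one_mul, rho_add_period, ih]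
      conv_lhs => rw [← h2 m, rho_rho]
      congr 2; push_cast; ring
    rw [h1]
    exact h _ x hx

/-- A criterion for the acyclicity of the subcomplex of the product total complex given by
subgroups stable under all the operators. -/
theorem exists_totalD_eq_of_filtration (K : ∀ q, Submodule k (M.obj q))
    (hd : ∀ q i, ∀ x ∈ K (q + 1), M.d q i x ∈ K q) (ht : ∀ q, ∀ x ∈ K q, M.t q x ∈ K q)
    (hD : ∀ q, ∀ x ∈ K q, D q x ∈ K q) (F : ℕ → ∀ q, Submodule k (M.obj q)) (c : ℕ → ℕ)
    (hF0 : ∀ q, F 0 q = ⊤) (hanti : ∀ s q, F (s + 1) q ≤ F s q)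
    (hFc : ∀ s q, c q ≤ s → F s q = ⊥)
    (W : ∀ q, M.obj q →ₗ[k] M.obj q) (hWK : ∀ q, ∀ x ∈ K q, W q x ∈ K q)
    (hWF : ∀ s q, ∀ x ∈ F s q, W q x ∈ F s q)
    (hLW : ∀ q, ∀ x ∈ K q, M.totalConj D q (W q x) = x)
    (hWL : ∀ q, ∀ x ∈ K q, W q (M.totalConj D q x) = x)
    (h₁ : ∀ n s q, ∀ x ∈ F s (q + 1), M.errorOne D n q x ∈ F (s + 1) q)
    (h₂ : ∀ n s q, ∀ x ∈ F s (q + 2), M.errorTwo D n q x ∈ F (s + 1) q)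
    (n : ℤ) (x : ∀ q, M.obj q) (hx : ∀ q, x q ∈ K q) (hdx : M.totalD n x = 0) :
    ∃ y : ∀ q, M.obj q, (∀ q, y q ∈ K q) ∧ M.totalD (n + 1) y = x := by
  have hst : ∀ q, ∀ x ∈ K q, M.signedT q x ∈ K q := fun q x hx =>
    Submodule.smul_mem _ _ (ht q x hx)
  have hrho := M.rho_mem_of_signedT hst
  have hsd : ∀ q i, ∀ x ∈ K (q + 1), M.signedD q i x ∈ K q := by
    intro q i x hx
    unfold signedD
    split_ifs
    · exact Submodule.smul_mem _ _ (hd _ _ _ hx)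
    · exact zero_mem _
  have hb : ∀ q, ∀ x ∈ K (q + 1), M.b q x ∈ K q := by
    intro q x hx
    rw [b_eq, LinearMap.sum_apply]
    exact sum_mem fun i _ => hsd _ _ _ hx
  have hb' : ∀ q, ∀ x ∈ K (q + 1), M.b' q x ∈ K q := by
    intro q x hx
    rw [b'_eq, LinearMap.sum_apply]
    exact sum_mem fun i _ => hsd _ _ _ hx
  have hN : ∀ q, ∀ x ∈ K q, M.norm q x ∈ K q := by
    intro q x hx
    rw [norm_apply_rho]
    exact sum_mem fun i _ => hrho _ _ _ hx
  have hconj : ∀ q z, ∀ x ∈ K q, M.conj D q z x ∈ K q := fun q z x hx =>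
    hrho _ _ _ (hD _ _ (hrho _ _ _ hx))
  have hface : ∀ q, ∀ x ∈ K (q + 1), M.homotopyFace D q x ∈ K q := fun q x hx =>
    hsd q 0 _ (hconj _ 1 _ hx)
  have heven : ∀ q, ∀ x ∈ K q, M.homotopyEven D q x ∈ K q := by
    intro q x hx
    rw [homotopyEven_apply]
    exact sum_mem fun i _ => sum_mem fun l _ => hconj _ _ _ (hrho _ _ _ hx)
  have hshift : ∀ q z, ∀ x ∈ K (q + 1), M.conjShift D q z x ∈ K (q + 1) := by
    intro q z x hx
    unfold conjShift
    split_ifs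
    · exact add_mem (hconj _ _ _ hx) (hconj _ _ _ hx)
    · exact hconj _ _ _ hx
  have hdef : ∀ q z, ∀ x ∈ K (q + 1), M.defect D q z x ∈ K q := fun q z x hx =>
    sub_mem (hsd q 0 _ (hshift q z _ hx)) (hconj q z _ (hsd q 0 _ hx))
  have herr₁ : ∀ n q, ∀ x ∈ K (q + 1), M.errorOne D n q x ∈ K q := by
    intro n q x hx
    unfold errorOne
    split_ifs
    · simp only [LinearMap.sum_apply, LinearMap.comp_apply]
      exact sum_mem fun j _ => hrho _ _ _ (hdef _ _ _ (hrho _ _ _ hx))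
    · simp only [LinearMap.neg_apply, LinearMap.sum_apply, LinearMap.comp_apply]
      exact neg_mem (sum_mem fun i _ => sum_mem fun l _ => sum_mem fun j _ =>
        hrho _ _ _ (hdef _ _ _ (hrho _ _ _ hx)))
  have herr₂ : ∀ n q, ∀ x ∈ K (q + 2), M.errorTwo D n q x ∈ K q := by
    intro n q x hx
    unfold errorTwo
    split_ifs
    · exact add_mem (hb _ _ (hface _ _ hx)) (hface _ _ (hb _ _ hx))
    · exact zero_mem _
  have htot : ∀ n (x : ∀ q, M.obj q), (∀ q, x q ∈ K q) → ∀ q, M.totalD n x q ∈ K q := by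
    intro n x hx q
    by_cases h : Even (n - q)
    · rw [totalD_apply_of_even _ _ _ _ h]
      exact sub_mem (hN _ _ (hx _)) (hb' _ _ (hx _))
    · rw [totalD_apply_of_odd _ _ _ _ h]
      exact add_mem (sub_mem (hx _) (hrho _ _ _ (hx _))) (hb _ _ (hx _))
  have hhom : ∀ n (x : ∀ q, M.obj q), (∀ q, x q ∈ K q) → ∀ q, M.homotopy D n x q ∈ K q := by
    intro n x hx q
    unfold homotopy
    split_ifs
    · exact heven _ _ (hx _)
    · exact add_mem (hD _ _ (hx _)) (hface _ _ (hx _))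
  have main := fun n => exists_unique_of_filtration
    (fun s q => (K q ⊓ F s q).toAddSubgroup) c
    (fun s q h => by rw [hFc s q h, inf_bot_eq]; rfl)
    (fun q => (M.totalConj D q).toAddMonoidHom) (fun q => (W q).toAddMonoidHom)
    (fun q => (M.errorOne D n q).toAddMonoidHom) (fun q => (M.errorTwo D n q).toAddMonoidHom)
    (fun s q x hx => ⟨hWK q x hx.1, hWF s q x hx.2⟩) (fun q x hx => hLW q x hx.1)
    (fun q x hx => hWL q x hx.1)
    (fun s q x hx => ⟨herr₁ n q x hx.1, h₁ n s q x hx.2⟩)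
    (fun s q x hx => ⟨herr₂ n q x hx.1, h₂ n s q x hx.2⟩)
    (fun s q x hx => ⟨hx.1, hanti s q hx.2⟩)
  have hK0 : ∀ q (x : M.obj q), x ∈ (K q ⊓ F 0 q).toAddSubgroup ↔ x ∈ K q := by
    intro q x
    simp [hF0]
  simp only [hK0] at main
  obtain ⟨y, hy, hyx⟩ := (main n).1 x hx
  have hU : ∀ n (y : ∀ q, M.obj q), (fun q => M.totalConj D q (y q) +
      M.errorOne D n q (y (q + 1)) + M.errorTwo D n q (y (q + 2))) =
      M.totalD (n + 1) (M.homotopy D n y) + M.homotopy D (n - 1) (M.totalD n y) := by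
    intro n y
    funext q
    exact (M.totalD_homotopy_add D n y q).symm
  have hUy : M.totalD (n + 1) (M.homotopy D n y) + M.homotopy D (n - 1) (M.totalD n y) = x := by
    rw [← hU]
    funext q
    exact hyx q
  -- The operator `∂h + h∂` commutes with `∂`, hence sends `∂y` to `∂x = 0`; its injectivity one
  -- degree lower gives `∂y = 0`, and then `x = ∂(h y)`.
  have hdy : M.totalD n y = 0 := by
    refine (main (n - 1)).2 _ (htot n y hy) fun q => ?_
    have h1 := M.totalD_totalD (n - 1) y
    have h2 := congrFun (hU (n - 1) (M.totalD n y)) q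
    rw [sub_add_cancel] at h1 h2
    rw [h1, homotopy_zero, add_zero] at h2
    refine h2.trans ?_
    have h3 := congrArg (M.totalD n) hUy
    rw [map_add, totalD_totalD, zero_add, hdx] at h3
    rw [h3]; rfl
  rw [hdy, homotopy_zero, add_zero] at hUy
  exact ⟨_, hhom n y hy, hUy⟩

end CyclicModule

set_option linter.unusedSectionVars false

/-! ### Words in typed letters, their marks and their filtrations -/

namespace HochschildWord

open CyclicTuple

section Pure

variable (k : Type) [CommRing k] {A : Type u} [Ring A] [Algebra k A]

/-- The pure tensor of a tuple, as a multilinear map. -/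
noncomputable def pure (q : ℕ) :
    MultilinearMap k (fun _ : Fin (q + 1) => A) ((hochschild k A).obj q) :=
  PiTensorProduct.tprod k

theorem span_pure (q : ℕ) : Submodule.span k (Set.range (pure (A := A) k q)) = ⊤ :=
  PiTensorProduct.span_tprod_eq_top

theorem d_pure (q : ℕ) (i : Fin (q + 2)) (a : Fin (q + 2) → A) :
    (hochschild k A).d q i (pure k (q + 1) a) = pure k q (face i a) :=
  tensorOp_tprod k (face i) (isMultilinearOp_face k i) a

theorem t_pure (q : ℕ) (a : Fin (q + 1) → A) :
    (hochschild k A).t q (pure k q a) = pure k q (rot a) :=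
  tensorOp_tprod k rot (isMultilinearOp_rot k q) a

theorem signedD_zero_pure (q : ℕ) (a : Fin (q + 2) → A) :
    (hochschild k A).signedD q 0 (pure k (q + 1) a) = pure k q (face 0 a) := by
  rw [CyclicModule.signedD, dif_pos (by omega), pow_zero, LinearMap.smul_apply, one_smul]
  exact d_pure k q 0 a

theorem rho_natCast_pure (q j : ℕ) (a : Fin (q + 1) → A) :
    (hochschild k A).rho q j (pure k q a) = ((-1 : k) ^ q) ^ j • pure k q (rot^[j] a) := by
  induction j with
  | zero => simp
  | succ j ih =>
    rw [Nat.cast_succ, add_comm (j : ℤ), ← CyclicModule.rho_rho, ih, CyclicModule.rho_one,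
      CyclicModule.signedT, map_smul, LinearMap.smul_apply, t_pure, smul_smul,
      Function.iterate_succ_apply', pow_succ]

/-- The tuple of linear maps applied entrywise. -/
noncomputable def entrywise (q : ℕ) (g : Fin (q + 1) → A →ₗ[k] A) :
    (hochschild k A).obj q →ₗ[k] (hochschild k A).obj q :=
  PiTensorProduct.map g

theorem entrywise_pure (q : ℕ) (g : Fin (q + 1) → A →ₗ[k] A) (a : Fin (q + 1) → A) :
    entrywise k q g (pure k q a) = pure k q fun k => g k (a k) :=
  PiTensorProduct.map_tprod _ _

theorem face_zero_apply_zero {X : Type*} [Monoid X] {q : ℕ} (a : Fin (q + 2) → X) :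
    face 0 a 0 = a 0 * a 1 := by
  have h : (0 : Fin (q + 2)) ≠ Fin.last (q + 1) := by simp [Fin.ext_iff]
  rw [face, if_neg h, Fin.contractNth_apply_of_eq _ _ _ _ rfl]
  rfl

theorem face_zero_apply_succ {X : Type*} [Monoid X] {q : ℕ} (a : Fin (q + 2) → X) (k : Fin q) :
    face 0 a k.succ = a k.succ.succ := by
  have h : (0 : Fin (q + 2)) ≠ Fin.last (q + 1) := by simp [Fin.ext_iff]
  rw [face, if_neg h, Fin.contractNth_apply_of_gt _ _ _ _ (by simp)]

/-- The tuple read from its entry of index `j`. -/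
def shift {X : Type*} {q : ℕ} (j : ℕ) (a : Fin (q + 1) → X) : Fin (q + 1) → X :=
  fun k => a (k + j • (1 : Fin (q + 1)))

theorem rot_iterate_shift {X : Type u} {q : ℕ} (j : ℕ) (a : Fin (q + 1) → X) :
    rot^[j] (shift j a) = a := by
  rw [rot_iterate]
  funext k
  simp [shift]

theorem ofFn_shift {X : Type*} {q : ℕ} (j : ℕ) (a : Fin (q + 1) → X) :
    List.ofFn (shift j a) = (List.ofFn a).rotate j := by
  refine List.ext_getElem (by simp) fun k h1 h2 => ?_
  simp only [List.getElem_ofFn, List.getElem_rotate, List.length_ofFn, shift]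
  congr 1
  ext
  have h : ((j • (1 : Fin (q + 1)) : Fin (q + 1)) : ℕ) = j % (q + 1) := by
    clear h1 h2
    induction j with
    | zero => simp
    | succ j ih =>
      rw [succ_nsmul, Fin.val_add, ih]
      rcases q with _ | q
      · simp [Nat.mod_one]
      · simp
  rw [Fin.val_add, h]
  simp

end Pure

/-- A decomposition of an algebra into subspaces of letters, whose types are in a monoid with zero,
such that the types of letters multiply unless both are `1`. -/
structure Letters (T : Type) [MonoidWithZero T] [Fintype T] (k : Type) [CommRing k] (A : Type u)
    [Ring A] [Algebra k A] where
  p : T → A →ₗ[k] A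
  sum_p : ∀ a, ∑ x, p x a = a
  p_p : ∀ x a, p x (p x a) = p x a
  p_p_of_ne : ∀ x y a, x ≠ y → p x (p y a) = 0
  p_zero : ∀ a, p 0 a = 0
  mul : ∀ x y a b, ¬ (x = 1 ∧ y = 1) → p (x * y) (p x a * p y b) = p x a * p y b

/-- A rule for marking the initial letter of a word, depending on the types of its letters, which
behaves as a derivation when two letters are merged. -/
structure Marking (T : Type) [MonoidWithZero T] where
  mark : List T → ℤ
  mark_merge : ∀ (c x y : T) (u v : List T), x * y ≠ 0 →
    mark (c :: (v ++ (x * y) :: u)) = mark (c :: (v ++ x :: y :: u))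
  mark_mul : ∀ (x y : T) (l : List T), x * y ≠ 0 →
    mark ((x * y) :: l) = mark (x :: y :: l) + mark (y :: (l ++ [x]))
  mark_eq_zero : ∀ (x y : T) (l : List T), x ≠ 1 → x * y ≠ 0 → mark (y :: (l ++ [x])) = 0
  eq_one_of_mul : ∀ x y : T, x * y = 1 → x = 1

section Types

variable {T : Type} [MonoidWithZero T]

theorem ofFn_succ_succ {X : Type*} {q : ℕ} (σ : Fin (q + 2) → X) :
    List.ofFn σ = σ 0 :: σ 1 :: List.ofFn fun k : Fin q => σ k.succ.succ := by
  rw [List.ofFn_succ, List.ofFn_succ]; rfl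

theorem ofFn_face_zero {q : ℕ} (σ : Fin (q + 2) → T) :
    List.ofFn (face 0 σ) = (σ 0 * σ 1) :: List.ofFn fun k : Fin q => σ k.succ.succ := by
  rw [List.ofFn_succ, face_zero_apply_zero]
  simp only [face_zero_apply_succ]

theorem mark_rotate_merge (m : Marking T) (x y : T) (l : List T) (h : x * y ≠ 0) (k : ℕ) (hk : k < l.length) :
    m.mark (((x * y) :: l).rotate (k + 1)) = m.mark ((x :: y :: l).rotate (k + 2)) := by
  obtain ⟨u, c, v, rfl, rfl⟩ : ∃ u c v, l = u ++ c :: v ∧ u.length = k :=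
    ⟨l.take k, l[k], l.drop (k + 1), by simp, by simp [hk.le]⟩
  have h1 : ((x * y) :: (u ++ c :: v)).rotate (u.length + 1) = c :: (v ++ (x * y) :: u) :=
    List.rotate_append_length_eq ((x * y) :: u) (c :: v)
  have h2 : (x :: y :: (u ++ c :: v)).rotate (u.length + 2) = c :: (v ++ x :: y :: u) :=
    List.rotate_append_length_eq (x :: y :: u) (c :: v)
  rw [h1, h2, m.mark_merge _ _ _ _ _ h]

/-- The number of marks of a word. -/
def Marking.total (m : Marking T) (l : List T) : ℤ := ∑ j ∈ Finset.range l.length, m.mark (l.rotate j)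

variable [DecidableEq T]

/-- The number of letters of type different from `1`. -/
def deg {q : ℕ} (σ : Fin q → T) : ℕ := ∑ k, if σ k = 1 then 0 else 1

theorem deg_le {q : ℕ} (σ : Fin q → T) : deg σ ≤ q := by
  refine (Finset.sum_le_card_nsmul _ _ 1 fun k _ => ?_).trans (by simp)
  split_ifs <;> simp

theorem deg_rot {q : ℕ} (σ : Fin (q + 1) → T) : deg (rot σ) = deg σ :=
  (Equiv.subRight (1 : Fin (q + 1))).sum_comp fun k => if σ k = 1 then 0 else 1

theorem deg_face_zero {q : ℕ} (σ : Fin (q + 2) → T) :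
    deg (face 0 σ) + (if σ 0 = 1 then 0 else 1) + (if σ 1 = 1 then 0 else 1) =
      deg σ + if σ 0 * σ 1 = 1 then 0 else 1 := by
  rw [deg, deg, Fin.sum_univ_succ, Fin.sum_univ_succ (n := q + 1), Fin.sum_univ_succ (n := q)]
  have h1 : σ (Fin.succ 0) = σ 1 := rfl
  simp only [face_zero_apply_zero, face_zero_apply_succ, h1]
  omega

theorem deg_update_face_zero {q : ℕ} (σ : Fin (q + 2) → T) (x : T) (h0 : σ 0 = 1) (h1 : σ 1 = 1) :
    deg (Function.update (face 0 σ) 0 x) = deg σ + if x = 1 then 0 else 1 := by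
  rw [deg, deg, Fin.sum_univ_succ, Fin.sum_univ_succ (n := q + 1), Fin.sum_univ_succ (n := q)]
  simp only [Function.update_self, face_zero_apply_succ, Fin.succ_zero_eq_one, h0, h1,
    ne_eq, Fin.succ_ne_zero, not_false_eq_true, Function.update_of_ne]
  simp [add_comm]

/-- Twice the degree, corrected by the type of the initial letter. -/
def fineDeg {q : ℕ} (σ : Fin (q + 1) → T) : ℕ := 2 * deg σ + if σ 0 = 1 then 0 else 1

end Types

section Words

variable {T : Type} [MonoidWithZero T] [Fintype T] {k : Type} [CommRing k] {A : Type u} [Ring A]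
  [Algebra k A] (ℓ : Letters T k A)

/-- A tuple of letters of given types. -/
def IsWord {q : ℕ} (σ : Fin q → T) (a : Fin q → A) : Prop := ∀ k, ℓ.p (σ k) (a k) = a k

/-- The span of the words with types in a given set. -/
noncomputable def wordSpan (q : ℕ) (S : Set (Fin (q + 1) → T)) :
    Submodule k ((hochschild k A).obj q) :=
  Submodule.span k {x | ∃ σ ∈ S, ∃ a, IsWord ℓ σ a ∧ x = pure k q a}

variable {ℓ}

theorem pure_mem_wordSpan {q : ℕ} {S : Set (Fin (q + 1) → T)} {σ : Fin (q + 1) → T} (hσ : σ ∈ S)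
    {a : Fin (q + 1) → A} (ha : IsWord ℓ σ a) : pure k q a ∈ wordSpan ℓ q S :=
  Submodule.subset_span ⟨σ, hσ, a, ha, rfl⟩

theorem map_mem_of_wordSpan {q : ℕ} {S : Set (Fin (q + 1) → T)} {N : Type*} [AddCommGroup N]
    [Module k N] (g : (hochschild k A).obj q →ₗ[k] N) (P : Submodule k N)
    (h : ∀ σ ∈ S, ∀ a, IsWord ℓ σ a → g (pure k q a) ∈ P) :
    ∀ x ∈ wordSpan ℓ q S, g x ∈ P := by
  have : wordSpan ℓ q S ≤ P.comap g := by
    refine Submodule.span_le.mpr ?_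
    rintro _ ⟨σ, hσ, a, ha, rfl⟩
    exact h σ hσ a ha
  exact fun x hx => this hx

theorem wordSpan_mono {q : ℕ} {S S' : Set (Fin (q + 1) → T)} (h : S ⊆ S') :
    wordSpan ℓ q S ≤ wordSpan ℓ q S' :=
  map_mem_of_wordSpan LinearMap.id _ fun _ hσ _ ha => pure_mem_wordSpan (h hσ) ha

theorem sum_pure_letters (q : ℕ) (a : Fin (q + 1) → A) :
    ∑ σ : Fin (q + 1) → T, pure k q (fun k => ℓ.p (σ k) (a k)) = pure k q a := by
  conv_rhs => rw [show a = fun k => ∑ x, ℓ.p x (a k) from funext fun k => (ℓ.sum_p _).symm]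
  rw [MultilinearMap.map_sum]

theorem isWord_letters {q : ℕ} (σ : Fin q → T) (a : Fin q → A) :
    IsWord ℓ σ fun k => ℓ.p (σ k) (a k) := fun _ => ℓ.p_p _ _

theorem sum_update_letters (q : ℕ) (a : Fin (q + 1) → A) :
    ∑ x, pure k q (Function.update a 0 (ℓ.p x (a 0))) = pure k q a := by
  rw [← MultilinearMap.map_update_sum, ℓ.sum_p, Function.update_eq_self]

theorem wordSpan_univ (q : ℕ) : wordSpan ℓ q Set.univ = ⊤ := by
  rw [eq_top_iff, ← span_pure, Submodule.span_le]
  rintro _ ⟨a, rfl⟩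
  rw [← sum_pure_letters (ℓ := ℓ)]
  exact sum_mem fun σ _ => pure_mem_wordSpan (Set.mem_univ σ) (isWord_letters σ a)

theorem IsWord.apply_of_ne {q : ℕ} {σ : Fin q → T} {a : Fin q → A} (ha : IsWord ℓ σ a) {x : T}
    {k : Fin q} (h : x ≠ σ k) : ℓ.p x (a k) = 0 := by
  rw [← ha k, ℓ.p_p_of_ne _ _ _ h]

theorem IsWord.pure_eq_zero {q : ℕ} {σ : Fin (q + 1) → T} {a : Fin (q + 1) → A}
    (ha : IsWord ℓ σ a) {i : Fin (q + 1)} (h : σ i = 0) : pure k q a = 0 := by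
  refine MultilinearMap.map_coord_zero _ i ?_
  rw [← ha i, h, ℓ.p_zero]

theorem IsWord.shift {q : ℕ} {σ : Fin (q + 1) → T} {a : Fin (q + 1) → A}
    (ha : IsWord ℓ σ a) (j : ℕ) : IsWord ℓ (shift j σ) (shift j a) := fun _ => ha _

theorem IsWord.rot {q : ℕ} {σ : Fin (q + 1) → T} {a : Fin (q + 1) → A}
    (ha : IsWord ℓ σ a) : IsWord ℓ (rot σ) (rot a) := fun _ => ha _

theorem IsWord.update {q : ℕ} {σ : Fin (q + 1) → T} {a : Fin (q + 1) → A}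
    (ha : ∀ k : Fin q, ℓ.p (σ k.succ) (a k.succ) = a k.succ) (x : T) (b : A)
    (hb : ℓ.p x b = b) :
    IsWord ℓ (Function.update σ 0 x) (Function.update a 0 b) := by
  intro k
  refine Fin.cases ?_ (fun k => ?_) k
  · simpa using hb
  · simpa using ha k

theorem IsWord.face_zero_succ {q : ℕ} {σ : Fin (q + 2) → T} {a : Fin (q + 2) → A}
    (ha : IsWord ℓ σ a) (k : Fin q) :
    ℓ.p (face 0 σ k.succ) (face 0 a k.succ) = face 0 a k.succ := by
  rw [face_zero_apply_succ, face_zero_apply_succ]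
  exact ha _

theorem IsWord.face_zero {q : ℕ} {σ : Fin (q + 2) → T} {a : Fin (q + 2) → A}
    (ha : IsWord ℓ σ a) (h : ¬ (σ 0 = 1 ∧ σ 1 = 1)) : IsWord ℓ (face 0 σ) (face 0 a) := by
  intro k
  refine Fin.cases ?_ (fun k => ?_) k
  · rw [face_zero_apply_zero, face_zero_apply_zero, ← ha 0, ← ha 1]
    exact ℓ.mul _ _ _ _ h
  · exact ha.face_zero_succ k

variable [Algebra ℚ A] [SMulCommClass ℚ k A]

variable (ℓ) in
/-- The operator that scales the words by rational numbers depending on their types. -/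
noncomputable def diag (q : ℕ) (c : (Fin (q + 1) → T) → ℚ) :
    (hochschild k A).obj q →ₗ[k] (hochschild k A).obj q :=
  -- The tensor powers are over `k`, which need not contain `ℚ`, so the rational scalar is carried
  -- by the initial entry.
  ∑ σ, entrywise k q fun k => ((if k = 0 then c σ else 1) • ℓ.p (σ k))

theorem diag_pure {q : ℕ} (c : (Fin (q + 1) → T) → ℚ) {σ : Fin (q + 1) → T} {a : Fin (q + 1) → A}
    (ha : IsWord ℓ σ a) : diag ℓ q c (pure k q a) = pure k q (Function.update a 0 (c σ • a 0)) := by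
  rw [diag, LinearMap.sum_apply, Finset.sum_eq_single σ]
  · rw [entrywise_pure]
    congr 1
    funext k
    refine Fin.cases ?_ (fun k => ?_) k
    · simp [ha 0]
    · simp [ha k.succ]
  · intro σ' _ h
    obtain ⟨i, hi⟩ := Function.ne_iff.mp h
    rw [entrywise_pure]
    refine MultilinearMap.map_coord_zero _ i ?_
    rw [LinearMap.smul_apply, ha.apply_of_ne hi, smul_zero]
  · simp

theorem IsWord.update_smul {q : ℕ} {σ : Fin (q + 1) → T} {a : Fin (q + 1) → A}
    (ha : IsWord ℓ σ a) (c : ℚ) : IsWord ℓ σ (Function.update a 0 (c • a 0)) := by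
  intro k
  refine Fin.cases ?_ (fun k => ?_) k
  · rw [Function.update_self, map_rat_smul, ha 0]
  · simp [ha k.succ]

theorem diag_mem {q : ℕ} (c : (Fin (q + 1) → T) → ℚ) (S : Set (Fin (q + 1) → T)) :
    ∀ x ∈ wordSpan ℓ q S, diag ℓ q c x ∈ wordSpan ℓ q S :=
  map_mem_of_wordSpan _ _ fun σ hσ a ha => by
    rw [diag_pure c ha]
    exact pure_mem_wordSpan hσ (ha.update_smul _)

theorem pure_update_intCast_smul (q : ℕ) (a : Fin (q + 1) → A) (n : ℤ) :
    pure k q (Function.update a 0 ((n : ℚ) • a 0)) = n • pure k q a := by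
  rw [Int.cast_smul_eq_zsmul, ← Int.cast_smul_eq_zsmul k, MultilinearMap.map_update_smul,
    Function.update_eq_self, Int.cast_smul_eq_zsmul]

variable (ℓ) (m : Marking T)

/-- The operator marking the initial letter of a word. -/
noncomputable def markOp (q : ℕ) : (hochschild k A).obj q →ₗ[k] (hochschild k A).obj q :=
  diag ℓ q fun σ => (m.mark (List.ofFn σ) : ℚ)

variable {ℓ}

theorem markOp_pure {q : ℕ} {σ : Fin (q + 1) → T} {a : Fin (q + 1) → A} (ha : IsWord ℓ σ a) :
    markOp ℓ m q (pure k q a) = m.mark (List.ofFn σ) • pure k q a := by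
  rw [markOp, diag_pure _ ha, pure_update_intCast_smul]

/-- Conjugation moves the marking to the letter of index `j`, the word being read cyclically from
there. The sign of the rotation occurs twice and cancels. -/
theorem conj_markOp_pure {q : ℕ} {σ : Fin (q + 1) → T} {a : Fin (q + 1) → A} (ha : IsWord ℓ σ a)
    (j : ℕ) : (hochschild k A).conj (markOp ℓ m) q j (pure k q a) =
      m.mark ((List.ofFn σ).rotate j) • pure k q a := by
  have h := rho_natCast_pure k q j (shift j a)
  rw [rot_iterate_shift] at h
  have hs : ((-1 : k) ^ q) ^ j * ((-1 : k) ^ q) ^ j = 1 := by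
    rw [← mul_pow, ← mul_pow]; simp
  have h' : pure k q a = ((-1 : k) ^ q) ^ j • (hochschild k A).rho q j (pure k q (shift j a)) := by
    rw [h, smul_smul, hs, one_smul]
  rw [h', map_smul, CyclicModule.conj_rho, sub_self, CyclicModule.conj_zero,
    markOp_pure m (ha.shift j), ofFn_shift, map_zsmul, smul_comm]

variable [DecidableEq T]

variable (ℓ) in
/-- The span of the words with at least `r` letters of type different from `1`. -/
noncomputable def degFiltration (r q : ℕ) : Submodule k ((hochschild k A).obj q) :=
  wordSpan ℓ q {σ | r ≤ deg σ}

variable (ℓ) in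
/-- The filtration by the refined degree. -/
noncomputable def fineFiltration (s q : ℕ) : Submodule k ((hochschild k A).obj q) :=
  wordSpan ℓ q {σ | s ≤ fineDeg σ}

theorem degFiltration_le_fineFiltration {r s : ℕ} (h : s ≤ 2 * r) (q : ℕ) :
    degFiltration ℓ r q ≤ fineFiltration ℓ s q :=
  wordSpan_mono fun σ hσ => by
    have : r ≤ deg σ := hσ
    change s ≤ 2 * deg σ + _
    omega

theorem rho_mem_degFiltration (r q : ℕ) (z : ℤ) (x : (hochschild k A).obj q)
    (hx : x ∈ degFiltration ℓ r q) : (hochschild k A).rho q z x ∈ degFiltration ℓ r q := by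
  refine CyclicModule.rho_mem_of_signedT (hochschild k A) (K := fun q => degFiltration ℓ r q) ?_
    q z x hx
  intro q
  refine map_mem_of_wordSpan _ _ fun σ hσ a ha => ?_
  rw [CyclicModule.signedT, LinearMap.smul_apply, t_pure]
  refine Submodule.smul_mem _ _ (pure_mem_wordSpan ?_ ha.rot)
  change r ≤ deg (rot σ)
  rwa [deg_rot]

/-- Unless the two merged letters both have type `1`, their product is a single letter and the
derivation rules of the marking make the defect vanish. If both have type `1`, the product is
decomposed: its component of type `1` again gives no defect, and every other component adds a letter
of type different from `1`. -/
theorem defect_natCast_mem (q r j : ℕ) (hj : j < q + 1) :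
    ∀ x ∈ degFiltration ℓ r (q + 1),
      (hochschild k A).defect (markOp ℓ m) q j x ∈ degFiltration ℓ (r + 1) q := by
  refine map_mem_of_wordSpan _ _ fun σ hσ a ha => ?_
  have hσ : r ≤ deg σ := hσ
  set N : ℤ := if j = 0 then m.mark (List.ofFn σ) + m.mark ((List.ofFn σ).rotate 1)
    else m.mark ((List.ofFn σ).rotate (j + 1)) with hN
  have hshift : (hochschild k A).conjShift (markOp ℓ m) q j (pure k (q + 1) a) =
      N • pure k (q + 1) a := by
    by_cases h0 : j = 0
    · subst h0
      have e0 := conj_markOp_pure m ha 0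
      have e1 := conj_markOp_pure m ha 1
      rw [Nat.cast_zero, List.rotate_zero] at e0
      rw [Nat.cast_one] at e1
      rw [Nat.cast_zero, CyclicModule.conjShift_zero, e0, e1, ← add_smul, hN, if_pos rfl]
    · rw [CyclicModule.conjShift_of_pos _ _ _ _ (by omega) (by omega), ← Nat.cast_succ,
        conj_markOp_pure m ha, hN, if_neg h0]
  have hmark : σ 0 * σ 1 ≠ 0 → m.mark ((List.ofFn (face 0 σ)).rotate j) = N := by
    intro h
    rw [ofFn_face_zero, hN]
    rcases j with _ | j
    · rw [if_pos rfl, List.rotate_zero, m.mark_mul _ _ _ h, ofFn_succ_succ]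
      simp
    · rw [if_neg (by omega), mark_rotate_merge m _ _ _ h j (by simp; omega), ofFn_succ_succ]
  rw [CyclicModule.defect, LinearMap.sub_apply, LinearMap.comp_apply, LinearMap.comp_apply, hshift,
    map_zsmul, signedD_zero_pure]
  by_cases h : σ 0 = 1 ∧ σ 1 = 1
  · rw [← sum_update_letters (ℓ := ℓ), map_sum, Finset.smul_sum, ← Finset.sum_sub_distrib]
    refine sum_mem fun x _ => ?_
    have hw : IsWord ℓ (Function.update (face 0 σ) 0 x)
        (Function.update (face 0 a) 0 (ℓ.p x (face 0 a 0))) :=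
      IsWord.update ha.face_zero_succ x _ (ℓ.p_p _ _)
    rw [conj_markOp_pure m hw, ← sub_smul]
    by_cases hx : x = 1
    · have h1 : Function.update (face 0 σ) 0 x = face 0 σ := by
        rw [Function.update_eq_self_iff, face_zero_apply_zero, h.1, h.2, one_mul, hx]
      -- The rules for marks require a nonzero product of types. In the degenerate case `0 = 1`
      -- every word vanishes.
      rcases subsingleton_or_nontrivial T with hT | hT
      · rw [hw.pure_eq_zero (i := 0) (Subsingleton.elim _ _), smul_zero]
        exact zero_mem _
      · rw [h1, hmark (by rw [h.1, h.2, one_mul]; exact one_ne_zero), sub_self, zero_smul]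
        exact zero_mem _
    · refine zsmul_mem (pure_mem_wordSpan ?_ hw) _
      change r + 1 ≤ deg _
      rw [deg_update_face_zero σ x h.1 h.2, if_neg hx]
      omega
  · have hw := ha.face_zero h
    rw [conj_markOp_pure m hw, ← sub_smul]
    by_cases h0 : σ 0 * σ 1 = 0
    · rw [hw.pure_eq_zero (i := 0) (by rw [face_zero_apply_zero, h0]), smul_zero]
      exact zero_mem _
    · rw [hmark h0, sub_self, zero_smul]
      exact zero_mem _

theorem defect_mem (q r : ℕ) (z : ℤ) (x : (hochschild k A).obj (q + 1))
    (hx : x ∈ degFiltration ℓ r (q + 1)) :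
    (hochschild k A).defect (markOp ℓ m) q z x ∈ degFiltration ℓ (r + 1) q := by
  have h0 : 0 ≤ z % ((q : ℤ) + 1) := Int.emod_nonneg _ (by omega)
  have h1 : z % ((q : ℤ) + 1) < q + 1 := Int.emod_lt_of_pos _ (by omega)
  obtain ⟨j, hj⟩ := Int.eq_ofNat_of_zero_le h0
  rw [← CyclicModule.defect_emod, hj]
  exact defect_natCast_mem m q r j (by omega) x hx

/-- The fine degree is at most `2 * deg + 1`, while a defect raises `deg` by one and so forces fine
degree at least `2 * deg + 2`; rotations preserve `deg`. -/
theorem errorOne_mem (n : ℤ) (s q : ℕ) : ∀ x ∈ fineFiltration ℓ s (q + 1),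
    (hochschild k A).errorOne (markOp ℓ m) n q x ∈ fineFiltration ℓ (s + 1) q := by
  refine map_mem_of_wordSpan _ _ fun σ hσ a ha => ?_
  have hs : s ≤ 2 * deg σ + 1 := by
    have h1 : s ≤ fineDeg σ := hσ
    have h2 : fineDeg σ ≤ 2 * deg σ + 1 := by unfold fineDeg; split_ifs <;> omega
    omega
  refine degFiltration_le_fineFiltration (r := deg σ + 1) (by omega) q ?_
  have hw : pure k (q + 1) a ∈ degFiltration ℓ (deg σ) (q + 1) :=
    pure_mem_wordSpan (le_refl (deg σ)) ha
  unfold CyclicModule.errorOne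
  split_ifs
  · simp only [LinearMap.sum_apply, LinearMap.comp_apply]
    exact sum_mem fun j _ => rho_mem_degFiltration _ _ _ _ (defect_mem _ _ _ _ _
      (rho_mem_degFiltration _ _ _ _ hw))
  · simp only [LinearMap.neg_apply, LinearMap.sum_apply, LinearMap.comp_apply]
    exact neg_mem (sum_mem fun i _ => sum_mem fun l _ => sum_mem fun j _ =>
      rho_mem_degFiltration _ _ _ _ (defect_mem _ _ _ _ _ (rho_mem_degFiltration _ _ _ _ hw)))

/-- Merging can lose one letter of type different from `1`, but then the resulting initial letter is
itself not of type `1`. The correction in the fine degree records this. -/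
theorem signedD_zero_mem (hT : ∀ x y : T, x * y = 1 → x = 1) (q r : ℕ) :
    ∀ x ∈ degFiltration ℓ (r + 1) (q + 1),
      (hochschild k A).signedD q 0 x ∈ fineFiltration ℓ (2 * r + 1) q := by
  refine map_mem_of_wordSpan _ _ fun σ hσ a ha => ?_
  have hσ : r + 1 ≤ deg σ := hσ
  rw [signedD_zero_pure]
  by_cases h : σ 0 = 1 ∧ σ 1 = 1
  · rw [← sum_update_letters (ℓ := ℓ)]
    refine sum_mem fun x _ => pure_mem_wordSpan ?_
      (IsWord.update ha.face_zero_succ x _ (ℓ.p_p _ _))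
    change 2 * r + 1 ≤ 2 * deg _ + _
    rw [deg_update_face_zero σ x h.1 h.2]
    omega
  · refine pure_mem_wordSpan ?_ (ha.face_zero h)
    have h1 := deg_face_zero σ
    have h2 : ¬ σ 0 * σ 1 = 1 := by
      intro h3
      have h4 := hT _ _ h3
      exact h ⟨h4, by rwa [h4, one_mul] at h3⟩
    change 2 * r + 1 ≤ 2 * deg _ + _
    rw [if_neg h2] at h1
    rw [face_zero_apply_zero, if_neg h2]
    split_ifs at h1 <;> omega

variable (ℓ) in
/-- The span of the pure tensors with an initial entry that has no component of type `1`. -/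
noncomputable def initialSpan (q : ℕ) : Submodule k ((hochschild k A).obj q) :=
  Submodule.span k {x | ∃ a, ℓ.p 1 (a 0) = 0 ∧ x = pure k q a}

theorem p_one_mul (hT : ∀ x y : T, x * y = 1 → x = 1) (x y : T) (h : ¬ (x = 1 ∧ y = 1)) (a b : A) :
    ℓ.p 1 (ℓ.p x a * ℓ.p y b) = 0 := by
  rw [← ℓ.mul _ _ _ _ h]
  refine ℓ.p_p_of_ne _ _ _ fun h1 => h ?_
  have h2 := hT _ _ h1.symm
  exact ⟨h2, by rwa [h2, one_mul, eq_comm] at h1⟩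

theorem p_one_mul_eq_zero (hT : ∀ x y : T, x * y = 1 → x = 1) {a : A} (ha : ℓ.p 1 a = 0) (b : A) :
    ℓ.p 1 (a * b) = 0 ∧ ℓ.p 1 (b * a) = 0 := by
  constructor
  · rw [← ℓ.sum_p a, ← ℓ.sum_p b, Finset.sum_mul_sum, map_sum]
    refine Finset.sum_eq_zero fun x _ => ?_
    rw [map_sum]
    refine Finset.sum_eq_zero fun y _ => ?_
    by_cases hx : x = 1
    · rw [hx, ha, zero_mul, map_zero]
    · exact p_one_mul hT _ _ (fun h => hx h.1) _ _
  · rw [← ℓ.sum_p a, ← ℓ.sum_p b, Finset.sum_mul_sum, map_sum]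
    refine Finset.sum_eq_zero fun y _ => ?_
    rw [map_sum]
    refine Finset.sum_eq_zero fun x _ => ?_
    by_cases hx : x = 1
    · rw [hx, ha, mul_zero, map_zero]
    · exact p_one_mul hT _ _ (fun h => hx h.2) _ _

/-- The elements without component of type `1` form a two-sided ideal, and each face either keeps
the initial entry or multiplies it by another one. -/
theorem b_mem_initialSpan (hT : ∀ x y : T, x * y = 1 → x = 1) (q : ℕ) :
    ∀ x ∈ initialSpan ℓ (q + 1), (hochschild k A).b q x ∈ initialSpan ℓ q := by
  have : initialSpan ℓ (q + 1) ≤ (initialSpan ℓ q).comap ((hochschild k A).b q) := by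
    refine Submodule.span_le.mpr ?_
    rintro _ ⟨a, ha, rfl⟩
    change (hochschild k A).b q (pure k (q + 1) a) ∈ initialSpan ℓ q
    rw [CyclicModule.b, LinearMap.sum_apply]
    refine sum_mem fun i _ => ?_
    rw [LinearMap.smul_apply, d_pure]
    refine Submodule.smul_mem _ _ (Submodule.subset_span ⟨_, ?_, rfl⟩)
    rcases eq_or_ne i (Fin.last (q + 1)) with rfl | hi
    · simp only [face, if_true]
      exact (p_one_mul_eq_zero hT ha _).2
    · rcases eq_or_ne i 0 with rfl | h0
      · rw [face_zero_apply_zero]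
        exact (p_one_mul_eq_zero hT ha _).1
      · rw [face, if_neg hi, Fin.contractNth_apply_of_lt _ _ _ _ (by
          exact Fin.pos_iff_ne_zero.mpr h0)]
        exact ha
  exact fun x hx => this hx

/-- The face part of the homotopy marks the second letter and multiplies it by the first. If the
first has type different from `1`, either the product vanishes or, by `mark_eq_zero`, the second
letter carries no mark. -/
theorem homotopyFace_initialSpan (q : ℕ) :
    ∀ x ∈ initialSpan ℓ (q + 1), (hochschild k A).homotopyFace (markOp ℓ m) q x = 0 := by
  have : initialSpan ℓ (q + 1) ≤
      LinearMap.ker ((hochschild k A).homotopyFace (markOp ℓ m) q) := by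
    refine Submodule.span_le.mpr ?_
    rintro _ ⟨a, ha, rfl⟩
    change (hochschild k A).homotopyFace (markOp ℓ m) q (pure k (q + 1) a) = 0
    rw [← sum_pure_letters (ℓ := ℓ), map_sum]
    refine Finset.sum_eq_zero fun σ _ => ?_
    have hw := isWord_letters (ℓ := ℓ) σ a
    by_cases h1 : σ 0 = 1
    · rw [MultilinearMap.map_coord_zero _ 0 (by rw [h1, ha]), map_zero]
    · have hc := conj_markOp_pure m hw 1
      rw [Nat.cast_one] at hc
      rw [CyclicModule.homotopyFace, LinearMap.comp_apply, hc, map_zsmul, signedD_zero_pure]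
      by_cases h0 : σ 0 * σ 1 = 0
      · rw [(hw.face_zero fun h => h1 h.1).pure_eq_zero (i := 0)
          (by rw [face_zero_apply_zero, h0]), smul_zero]
      · have := m.mark_eq_zero _ _ (List.ofFn fun k : Fin q => σ k.succ.succ) h1 h0
        rw [ofFn_succ_succ, List.rotate_cons_succ, List.rotate_zero, List.cons_append, this,
          zero_smul]
  exact fun x hx => this hx

/-- This is why the filtration is by fine degree. Here a defect is followed by a face, which may
undo the gain in `deg`. If the initial letter has type `1`, the fine degree still grows from `2 *
deg` to at least `2 * deg + 1`; otherwise the error is zero. -/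
theorem errorTwo_mem (n : ℤ) (s q : ℕ) : ∀ x ∈ fineFiltration ℓ s (q + 2),
    (hochschild k A).errorTwo (markOp ℓ m) n q x ∈ fineFiltration ℓ (s + 1) q := by
  refine map_mem_of_wordSpan _ _ fun σ hσ a ha => ?_
  have hs : s ≤ fineDeg σ := hσ
  unfold CyclicModule.errorTwo
  split_ifs
  · rw [LinearMap.add_apply, LinearMap.comp_apply, LinearMap.comp_apply]
    by_cases h : σ 0 = 1
    · rw [fineDeg, if_pos h] at hs
      have hw : pure k (q + 2) a ∈ degFiltration ℓ (deg σ) (q + 2) :=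
        pure_mem_wordSpan (le_refl (deg σ)) ha
      rw [CyclicModule.homotopyFace_b]
      refine neg_mem (sum_mem fun j _ => ?_)
      have h1 := rho_mem_degFiltration (deg σ) (q + 2) (-(j : ℤ)) _ hw
      have h2 := rho_mem_degFiltration _ _ (j : ℤ) _
        (defect_mem m (q + 1) (deg σ) (1 - (j : ℤ)) _ h1)
      have h3 := signedD_zero_mem m.eq_one_of_mul q (deg σ) _ h2
      refine wordSpan_mono (fun τ hτ => ?_) h3
      exact le_trans (by omega : s + 1 ≤ 2 * deg σ + 1) hτ
    · have hw : pure k (q + 2) a ∈ initialSpan ℓ (q + 2) :=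
        Submodule.subset_span ⟨a, ha.apply_of_ne (Ne.symm h), rfl⟩
      rw [homotopyFace_initialSpan m _ _ hw, homotopyFace_initialSpan m _ _
        (b_mem_initialSpan m.eq_one_of_mul _ _ hw), map_zero, add_zero]
      exact zero_mem _
  · exact zero_mem _

theorem totalConj_markOp_pure {q : ℕ} {σ : Fin (q + 1) → T} {a : Fin (q + 1) → A}
    (ha : IsWord ℓ σ a) : (hochschild k A).totalConj (markOp ℓ m) q (pure k q a) =
      m.total (List.ofFn σ) • pure k q a := by
  rw [CyclicModule.totalConj_apply, Marking.total, Finset.sum_smul, List.length_ofFn]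
  exact Finset.sum_congr rfl fun j _ => conj_markOp_pure m ha j

/-- Acyclicity of the subcomplex spanned by words that have marks. -/
theorem exists_totalD_eq_of_marking (K : ∀ q, Submodule k ((hochschild k A).obj q))
    (S : ∀ q, Set (Fin (q + 1) → T)) (hK : ∀ q, K q = wordSpan ℓ q (S q))
    (hS : ∀ q, ∀ σ ∈ S q, m.total (List.ofFn σ) ≠ 0)
    (hd : ∀ q i, ∀ x ∈ K (q + 1), (hochschild k A).d q i x ∈ K q)
    (ht : ∀ q, ∀ x ∈ K q, (hochschild k A).t q x ∈ K q)
    (n : ℤ) (x : ∀ q, (hochschild k A).obj q) (hx : ∀ q, x q ∈ K q)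
    (hdx : (hochschild k A).totalD n x = 0) :
    ∃ y : ∀ q, (hochschild k A).obj q,
      (∀ q, y q ∈ K q) ∧ (hochschild k A).totalD (n + 1) y = x := by
  set W : ∀ q, (hochschild k A).obj q →ₗ[k] (hochschild k A).obj q := fun q =>
    diag ℓ q fun σ => (m.total (List.ofFn σ) : ℚ)⁻¹ with hW
  have hWp : ∀ q, ∀ σ ∈ S q, ∀ a, IsWord ℓ σ a →
      m.total (List.ofFn σ) • W q (pure k q a) = pure k q a := by
    intro q σ hσ a ha
    have h0 : (m.total (List.ofFn σ) : ℚ) ≠ 0 := by exact_mod_cast hS q σ hσ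
    rw [hW]
    simp only
    rw [diag_pure _ ha, ← pure_update_intCast_smul]
    rw [Function.update_self, Function.update_idem, smul_smul, mul_inv_cancel₀ h0, one_smul,
      Function.update_eq_self]
  -- A word in row `q` has `q + 1` letters, hence fine degree at most `2 * q + 3`; the filtration is
  -- therefore zero from level `2 * q + 4` on.
  refine CyclicModule.exists_totalD_eq_of_filtration (hochschild k A) (markOp ℓ m) K hd ht
    (fun q x hx => ?_) (fineFiltration ℓ) (fun q => 2 * q + 4) (fun q => ?_) (fun s q => ?_)
    (fun s q hs => ?_) W (fun q x hx => ?_) (fun s q => diag_mem _ _) (fun q => ?_) (fun q => ?_)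
    (errorOne_mem m) (errorTwo_mem m) n x hx hdx
  · rw [hK] at hx ⊢
    exact diag_mem _ _ x hx
  · rw [fineFiltration]
    simpa using wordSpan_univ q
  · exact wordSpan_mono fun σ hσ => (Nat.le_succ s).trans hσ
  · rw [eq_bot_iff]
    refine map_mem_of_wordSpan LinearMap.id _ fun σ hσ a ha => ?_
    exfalso
    have h1 : s ≤ fineDeg σ := hσ
    have h2 := deg_le σ
    unfold fineDeg at h1
    split_ifs at h1 <;> omega
  · rw [hK] at hx ⊢
    exact diag_mem _ _ x hx
  · rw [hK]
    intro x hx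
    have := map_mem_of_wordSpan ((hochschild k A).totalConj (markOp ℓ m) q ∘ₗ W q - LinearMap.id) ⊥
      (fun σ hσ a ha => by
        have h1 : W q (pure k q a) = _ := diag_pure _ ha
        rw [LinearMap.sub_apply, LinearMap.comp_apply, h1,
          totalConj_markOp_pure m (ha.update_smul _), ← h1, hWp q σ hσ a ha]
        simp) x hx
    simpa [sub_eq_zero] using this
  · rw [hK]
    intro x hx
    have := map_mem_of_wordSpan (W q ∘ₗ (hochschild k A).totalConj (markOp ℓ m) q - LinearMap.id) ⊥
      (fun σ hσ a ha => by
        rw [LinearMap.sub_apply, LinearMap.comp_apply,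
          totalConj_markOp_pure m ha, map_zsmul, hWp q σ hσ a ha]
        simp) x hx
    simpa [sub_eq_zero] using this

end Words

end HochschildWord

namespace HochschildWord

/-! ### Kernels of Hochschild maps as spans of words -/

section Kernels

open CyclicTuple

variable {T : Type} [MonoidWithZero T] [Fintype T] {k : Type} [CommRing k] {A B C : Type u} [Ring A]
  [Algebra k A] [Ring B] [Algebra k B] [Ring C] [Algebra k C] {ℓ : Letters T k A}

theorem hochschildMap_pure (f : A →ₐ[k] B) (q : ℕ) (a : Fin (q + 1) → A) :
    (hochschildMap k f).app q (pure k q a) = pure k q fun i => f (a i) :=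
  PiTensorProduct.map_tprod _ _

/-- The entrywise projections sum to the identity, so only the components with types in `S` survive.
-/
theorem mem_wordSpan_of_entrywise {q : ℕ} (S : Set (Fin (q + 1) → T))
    (x : (hochschild k A).obj q)
    (hx : ∀ σ ∉ S, entrywise k q (fun i => ℓ.p (σ i)) x = 0) : x ∈ wordSpan ℓ q S := by
  have h1 : ∑ σ : Fin (q + 1) → T, entrywise k q (fun i => ℓ.p (σ i)) = LinearMap.id := by
    refine LinearMap.ext_on_range (span_pure k q) fun a => ?_
    rw [LinearMap.sum_apply]
    simp only [entrywise_pure]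
    exact sum_pure_letters q a
  have h2 : ∑ σ : Fin (q + 1) → T, entrywise k q (fun i => ℓ.p (σ i)) x = x := by
    have := LinearMap.congr_fun h1 x
    rwa [LinearMap.sum_apply] at this
  rw [← h2]
  refine sum_mem fun σ _ => ?_
  by_cases hσ : σ ∈ S
  · have h3 : ⊤ ≤ (wordSpan ℓ q S).comap (entrywise k q (fun i => ℓ.p (σ i))) := by
      rw [← span_pure, Submodule.span_le]
      rintro _ ⟨a, rfl⟩
      change entrywise k q (fun i => ℓ.p (σ i)) (pure k q a) ∈ wordSpan ℓ q S
      rw [entrywise_pure]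
      exact pure_mem_wordSpan hσ (isWord_letters σ a)
    exact h3 (Submodule.mem_top (x := x))
  · rw [hx σ hσ]
    exact zero_mem _

/-- If each projection factors through `f`, their tensor product factors through the tensor power of
`f`. This identifies kernels without describing their generators by hand. -/
theorem entrywise_eq_zero {q : ℕ} (f : A →ₐ[k] B) (σ : Fin (q + 1) → T)
    (hσ : ∀ i, ∃ s : B →ₗ[k] A, ∀ a, s (f a) = ℓ.p (σ i) a) (x : (hochschild k A).obj q)
    (hx : (hochschildMap k f).app q x = 0) : entrywise k q (fun i => ℓ.p (σ i)) x = 0 := by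
  choose s hs using hσ
  let g : (hochschild k B).obj q →ₗ[k] (hochschild k A).obj q := PiTensorProduct.map s
  have hg : entrywise k q (fun i => ℓ.p (σ i)) = g ∘ₗ (hochschildMap k f).app q := by
    refine LinearMap.ext_on_range (span_pure k q) fun a => ?_
    rw [entrywise_pure, LinearMap.comp_apply, hochschildMap_pure]
    have : g (pure k q fun i => f (a i)) = pure k q fun i => s i (f (a i)) :=
      PiTensorProduct.map_tprod _ _
    rw [this]
    simp only [hs]
  rw [hg, LinearMap.comp_apply, hx, map_zero]

theorem entrywise_eq_zero_of_zero {q : ℕ} (σ : Fin (q + 1) → T) (i : Fin (q + 1)) (hσ : σ i = 0)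
    (x : (hochschild k A).obj q) : entrywise k q (fun i => ℓ.p (σ i)) x = 0 := by
  have : entrywise k q (fun i => ℓ.p (σ i)) = 0 := by
    refine LinearMap.ext_on_range (span_pure k q) fun a => ?_
    rw [entrywise_pure, LinearMap.zero_apply]
    exact MultilinearMap.map_coord_zero _ i (by rw [hσ, ℓ.p_zero])
  rw [this, LinearMap.zero_apply]

theorem hochschildMap_wordSpan {q : ℕ} (f : A →ₐ[k] B) (y : T)
    (hy : ∀ a, f (ℓ.p y a) = 0) (S : Set (Fin (q + 1) → T)) (hS : ∀ σ ∈ S, ∃ i, σ i = y) :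
    ∀ x ∈ wordSpan ℓ q S, (hochschildMap k f).app q x = 0 := by
  refine map_mem_of_wordSpan _ ⊥ fun σ hσ a ha => ?_
  obtain ⟨i, hi⟩ := hS σ hσ
  rw [hochschildMap_pure, Submodule.mem_bot]
  refine MultilinearMap.map_coord_zero _ i ?_
  rw [← ha i, hi, hy]

theorem hochschildMap_d {f : A →ₐ[k] B} {q : ℕ} (i : Fin (q + 2)) {x : (hochschild k A).obj (q + 1)}
    (hx : (hochschildMap k f).app (q + 1) x = 0) :
    (hochschildMap k f).app q ((hochschild k A).d q i x) = 0 := by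
  have := LinearMap.congr_fun ((hochschildMap k f).comp_d q i) x
  rw [LinearMap.comp_apply, LinearMap.comp_apply, hx, map_zero] at this
  exact this

theorem hochschildMap_t {f : A →ₐ[k] B} {q : ℕ} {x : (hochschild k A).obj q}
    (hx : (hochschildMap k f).app q x = 0) :
    (hochschildMap k f).app q ((hochschild k A).t q x) = 0 := by
  have := LinearMap.congr_fun ((hochschildMap k f).comp_t q) x
  rw [LinearMap.comp_apply, LinearMap.comp_apply, hx, map_zero] at this
  exact this

end Kernels

/-! ### The markings for a square-zero ideal and for two ideals with zero intersection -/

section Marks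

variable {T : Type} [MonoidWithZero T]

/-- Marks are nonnegative, so a single positive one, found in any rotation, makes the sum positive.
-/
theorem Marking.total_ne_zero (m : Marking T) (hm : ∀ l, 0 ≤ m.mark l) {l l' : List T} {c : T}
    (h : l.IsRotated (c :: l')) (hl : 0 < m.mark (c :: l')) : m.total l ≠ 0 := by
  obtain ⟨n, hn⟩ := h
  have hlen : 0 < l.length := by
    rw [← List.length_rotate (n := n), hn]
    exact Nat.succ_pos _
  rw [← hn, ← List.rotate_mod] at hl
  refine (lt_of_lt_of_le hl ?_).ne'
  exact Finset.single_le_sum (f := fun j => m.mark (l.rotate j)) (fun j _ => hm _)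
    (Finset.mem_range.mpr (Nat.mod_lt n hlen))

end Marks

/-- The types of letters for a square zero ideal. -/
inductive NilType
  | one
  | nil
  | zero
  deriving DecidableEq

namespace NilType

instance : Fintype NilType := ⟨{one, nil, zero}, by rintro (_ | _ | _) <;> simp⟩

instance : MonoidWithZero NilType where
  mul
    | one, y => y
    | nil, one => nil
    | nil, _ => zero
    | zero, _ => zero
  one := one
  zero := zero
  mul_assoc := by rintro (_ | _ | _) (_ | _ | _) (_ | _ | _) <;> rfl
  one_mul := by rintro (_ | _ | _) <;> rfl
  mul_one := by rintro (_ | _ | _) <;> rfl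
  zero_mul := by rintro (_ | _ | _) <;> rfl
  mul_zero := by rintro (_ | _ | _) <;> rfl

/-- The marking of the letters in a square zero ideal. -/
def marking : Marking NilType where
  mark
    | nil :: _ => 1
    | _ => 0
  mark_merge := by rintro (_ | _ | _) x y u v _ <;> rfl
  mark_mul := by
    rintro (_ | _ | _) (_ | _ | _) l h <;> first | rfl | exact absurd rfl h
  mark_eq_zero := by
    rintro (_ | _ | _) (_ | _ | _) l h h' <;>
      first | rfl | exact absurd rfl h' | exact absurd rfl h
  eq_one_of_mul := by decide

theorem marking_total_ne_zero {l : List NilType} (h : nil ∈ l) : marking.total l ≠ 0 := by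
  obtain ⟨u, v, rfl⟩ := List.append_of_mem h
  refine marking.total_ne_zero (fun l => ?_) (c := nil) (l' := v ++ u) ⟨u.length, ?_⟩ one_pos
  · rcases l with _ | ⟨(_ | _ | _), l⟩ <;> simp [marking]
  · exact List.rotate_append_length_eq u (nil :: v)

/-- The letters for a projection onto a square zero ideal. -/
def letters {k : Type} [CommRing k] {A : Type u} [Ring A] [Algebra k A] (e : A →ₗ[k] A)
    (he : ∀ a, e (e a) = e a) (hl : ∀ a b, e (e a * b) = e a * b) (hr : ∀ a b, e (b * e a) = b * e a)
    (hsq : ∀ a b, e a * e b = 0) : Letters NilType k A where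
  p
    | one => LinearMap.id - e
    | nil => e
    | zero => 0
  sum_p a := by
    have : (Finset.univ : Finset NilType) = {one, nil, zero} := rfl
    simp [this]
  p_p := by rintro (_ | _ | _) a <;> simp [he]
  p_p_of_ne := by rintro (_ | _ | _) (_ | _ | _) a h <;> simp [he] <;> exact absurd rfl h
  p_zero _ := rfl
  mul := by
    rintro (_ | _ | _) (_ | _ | _) a b h
    · exact absurd ⟨rfl, rfl⟩ h
    · exact hr _ _
    · simp
    · exact hl _ _
    · change (0 : A) = e a * e b
      rw [hsq]
    · simp
    · simp
    · simp
    · simp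

end NilType

/-- The types of letters for two ideals with zero intersection. -/
inductive PairType
  | one
  | left
  | right
  | zero
  deriving DecidableEq

namespace PairType

instance : Fintype PairType :=
  ⟨{one, left, right, zero}, by rintro (_ | _ | _ | _) <;> simp⟩

instance : MonoidWithZero PairType where
  mul
    | one, y => y
    | left, one => left
    | left, left => left
    | right, one => right
    | right, right => right
    | _, _ => zero
  one := one
  zero := zero
  mul_assoc := by rintro (_ | _ | _ | _) (_ | _ | _ | _) (_ | _ | _ | _) <;> rfl
  one_mul := by rintro (_ | _ | _ | _) <;> rfl
  mul_one := by rintro (_ | _ | _ | _) <;> rfl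
  zero_mul := by rintro (_ | _ | _ | _) <;> rfl
  mul_zero := by rintro (_ | _ | _ | _) <;> rfl

/-- The type of the last letter which is not of type `one`. -/
def lastLetter (l : List PairType) : Option PairType := (l.filter (· ≠ one)).getLast?

theorem lastLetter_append (l l' : List PairType) :
    lastLetter (l ++ l') = (lastLetter l').or (lastLetter l) := by
  rw [lastLetter, List.filter_append, List.getLast?_append]; rfl

theorem lastLetter_singleton (x : PairType) :
    lastLetter [x] = if x = one then none else some x := by
  cases x <;> rfl

theorem lastLetter_cons (x : PairType) (l : List PairType) :
    lastLetter (x :: l) = (lastLetter l).or (if x = one then none else some x) := by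
  rw [← List.singleton_append, lastLetter_append, lastLetter_singleton]

/-- The marking of the letters of type `right` for which the preceding letter of type different
from `one` is of type `left`. -/
def marking : Marking PairType where
  mark
    | right :: l => if lastLetter l = some left then 1 else 0
    | _ => 0
  mark_merge := by
    rintro (_ | _ | _ | _) x y u v h <;> try rfl
    have : lastLetter (v ++ (x * y) :: u) = lastLetter (v ++ x :: y :: u) := by
      simp only [lastLetter_append, lastLetter_cons]
      rcases x with _ | _ | _ | _ <;> rcases y with _ | _ | _ | _ <;>
        first | exact absurd rfl h | (cases lastLetter u <;> rfl)
    simp only [this]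
  mark_mul := by
    rintro (_ | _ | _ | _) (_ | _ | _ | _) l h <;>
      first
      | exact absurd rfl h
      | rfl
      | (change (if lastLetter l = some left then (1 : ℤ) else 0) = _
         simp only [lastLetter_append, lastLetter_cons]
         cases lastLetter l <;> simp [lastLetter])
  mark_eq_zero := by
    rintro (_ | _ | _ | _) (_ | _ | _ | _) l h h' <;>
      first
      | rfl
      | exact absurd rfl h'
      | exact absurd rfl h
      | simp [lastLetter_append, lastLetter_singleton]
  eq_one_of_mul := by decide

/-- Start at a letter `left` and go round to the first `right`. Everything between is `one` or
`left`, so the last letter other than `one` before this `right` is `left`, and it is marked. -/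
theorem marking_total_ne_zero {l : List PairType} (h1 : left ∈ l) (h2 : right ∈ l)
    (h0 : zero ∉ l) : marking.total l ≠ 0 := by
  obtain ⟨u, v, rfl⟩ := List.append_of_mem h1
  have h3 : right ∈ v ++ u := by simpa [or_comm] using h2
  obtain ⟨s, t, hst, hs⟩ := List.eq_append_cons_of_mem h3
  have h4 : zero ∉ v ++ u := by simp at h0 ⊢; tauto
  have hleft : ∀ x ∈ left :: s, x ≠ one → x = left := by
    intro x hx hx1
    rcases List.mem_cons.mp hx with rfl | hx
    · rfl
    · rw [hst] at h4
      rcases x with _ | _ | _ | _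
      · exact absurd rfl hx1
      · rfl
      · exact absurd hx hs
      · exact absurd (List.mem_append_left _ hx) h4
  have hlast : lastLetter (left :: s) = some left := by
    have hne : ((left :: s).filter (· ≠ one)) ≠ [] := by simp
    rw [lastLetter, List.getLast?_eq_some_getLast hne]
    have := List.getLast_mem hne
    rw [List.mem_filter] at this
    exact congrArg some (hleft _ this.1 (by simpa using this.2))
  have hrot : (u ++ left :: v).IsRotated (right :: (t ++ left :: s)) := by
    have e1 : (u ++ left :: v).IsRotated ((left :: s) ++ right :: t) := by
      have : (left :: s) ++ right :: t = (left :: v) ++ u := by simp [hst]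
      rw [this]
      exact List.isRotated_append
    exact e1.trans List.isRotated_append
  refine marking.total_ne_zero (fun l => ?_) hrot ?_
  · rcases l with _ | ⟨(_ | _ | _ | _), l⟩ <;> simp only [marking, le_refl]
    split_ifs <;> simp
  · change (0 : ℤ) < if lastLetter (t ++ left :: s) = some left then 1 else 0
    rw [lastLetter_append, hlast]
    simp

/-- The letters for projections onto two ideals with zero intersection. -/
def letters {k : Type} [CommRing k] {A : Type u} [Ring A] [Algebra k A] (e₁ e₂ : A →ₗ[k] A)
    (h₁ : ∀ a, e₁ (e₁ a) = e₁ a) (h₂ : ∀ a, e₂ (e₂ a) = e₂ a)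
    (h₁₂ : ∀ a, e₁ (e₂ a) = 0) (h₂₁ : ∀ a, e₂ (e₁ a) = 0)
    (hl₁ : ∀ a b, e₁ (e₁ a * b) = e₁ a * b) (hr₁ : ∀ a b, e₁ (b * e₁ a) = b * e₁ a)
    (hl₂ : ∀ a b, e₂ (e₂ a * b) = e₂ a * b) (hr₂ : ∀ a b, e₂ (b * e₂ a) = b * e₂ a) :
    Letters PairType k A where
  p
    | one => LinearMap.id - e₁ - e₂
    | left => e₁
    | right => e₂
    | zero => 0
  sum_p a := by
    have : (Finset.univ : Finset PairType) = {one, left, right, zero} := rfl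
    simp [this]
  p_p := by rintro (_ | _ | _ | _) a <;> simp [h₁, h₂, h₁₂, h₂₁]
  p_p_of_ne := by
    rintro (_ | _ | _ | _) (_ | _ | _ | _) a h <;> simp [h₁, h₂, h₁₂, h₂₁] <;> exact absurd rfl h
  p_zero _ := rfl
  mul := by
    have e12 : ∀ a b, e₁ a * e₂ b = 0 := by
      intro a b
      rw [← hl₁, ← hr₂, h₁₂]
    have e21 : ∀ a b, e₂ a * e₁ b = 0 := by
      intro a b
      rw [← hl₂, ← hr₁, h₂₁]
    rintro (_ | _ | _ | _) (_ | _ | _ | _) a b h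
    · exact absurd ⟨rfl, rfl⟩ h
    · exact hr₁ _ _
    · exact hr₂ _ _
    · simp
    · exact hl₁ _ _
    · exact hl₁ _ _
    · change (0 : A) = e₁ a * e₂ b
      rw [e12]
    · simp
    · exact hl₂ _ _
    · change (0 : A) = e₂ a * e₁ b
      rw [e21]
    · exact hl₂ _ _
    · simp
    · simp
    · simp
    · simp
    · simp

end PairType

end HochschildWord

namespace HochschildWord

/-! ### Acyclicity of the relative and birelative complexes -/

section RationalKernels

variable {A B C : Type u} [Ring A] [Algebra ℚ A] [Ring B] [Algebra ℚ B] [Ring C] [Algebra ℚ C]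

/-- A `ℚ`-linear section of `f` exists; only its additivity is retained, since the tensor products
are over `ℤ`. -/
theorem exists_factor (f : A →ₐ[ℚ] B) (hf : Function.Surjective f) (p : A →ₗ[ℤ] A)
    (hp : ∀ a, f a = 0 → p a = 0) :
    ∃ s : B →ₗ[ℤ] A, ∀ a, s ((f : A →+* B).toIntAlgHom a) = p a := by
  obtain ⟨s, hs⟩ := f.toLinearMap.exists_rightInverse_of_surjective
    (LinearMap.range_eq_top.mpr hf)
  refine ⟨p ∘ₗ s.restrictScalars ℤ, fun a => ?_⟩
  have h : f (s (f a)) = f a := LinearMap.congr_fun hs (f a)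
  have := hp (s (f a) - a) (by rw [map_sub, h, sub_self])
  rw [map_sub, sub_eq_zero] at this
  exact this

/-- The relative product total complex of a square zero ideal is acyclic. -/
theorem exists_totalD_eq_of_square_zero (f : A →ₐ[ℚ] B) (hf : Function.Surjective f)
    (hsq : ∀ a b, f a = 0 → f b = 0 → a * b = 0)
    (n : ℤ) (x : ∀ q, (hochschild ℤ A).obj q)
    (hx : ∀ q, (hochschildMap ℤ (f : A →+* B).toIntAlgHom).app q (x q) = 0)
    (hdx : (hochschild ℤ A).totalD n x = 0) :
    ∃ y : ∀ q, (hochschild ℤ A).obj q,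
      (∀ q, (hochschildMap ℤ (f : A →+* B).toIntAlgHom).app q (y q) = 0) ∧
        (hochschild ℤ A).totalD (n + 1) y = x := by
  obtain ⟨s, hs⟩ := f.toLinearMap.exists_rightInverse_of_surjective
    (LinearMap.range_eq_top.mpr hf)
  set e : A →ₗ[ℤ] A := (LinearMap.id - s ∘ₗ f.toLinearMap).restrictScalars ℤ with he
  have hea : ∀ a, e a = a - s (f a) := fun a => rfl
  have hfe : ∀ a, f (e a) = 0 := fun a => by
    have h : f (s (f a)) = f a := LinearMap.congr_fun hs (f a)
    rw [hea, map_sub, h, sub_self]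
  have hef : ∀ a, f a = 0 → e a = a := fun a ha => by rw [hea, ha, map_zero, sub_zero]
  let ℓ := NilType.letters e (fun a => hef _ (hfe a))
    (fun a b => hef _ (by rw [map_mul, hfe, zero_mul]))
    (fun a b => hef _ (by rw [map_mul, hfe, mul_zero])) (fun a b => hsq _ _ (hfe a) (hfe b))
  refine exists_totalD_eq_of_marking (ℓ := ℓ) NilType.marking
    (fun q => LinearMap.ker ((hochschildMap ℤ (f : A →+* B).toIntAlgHom).app q))
    (fun q => {σ | ∃ i, σ i = NilType.nil}) (fun q => le_antisymm (fun x hx => ?_) ?_)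
    (fun q σ hσ => ?_) (fun q i x hx => hochschildMap_d i hx) (fun q x hx => hochschildMap_t hx)
    n x hx hdx
  · refine mem_wordSpan_of_entrywise _ x fun σ hσ => ?_
    refine entrywise_eq_zero (f : A →+* B).toIntAlgHom σ (fun i => ?_) x hx
    refine exists_factor f hf _ fun a ha => ?_
    have hσi : σ i ≠ NilType.nil := fun h => hσ ⟨i, h⟩
    rcases h : σ i with _ | _ | _
    · change a - e a = 0
      rw [hef a ha, sub_self]
    · exact absurd h hσi
    · rfl
  · exact hochschildMap_wordSpan (ℓ := ℓ) (f : A →+* B).toIntAlgHom NilType.nil hfe _ fun σ hσ => hσ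
  · obtain ⟨i, hi⟩ := hσ
    exact NilType.marking_total_ne_zero (List.mem_ofFn.mpr ⟨i, hi⟩)

/-- Project along a complement of `I` chosen to contain `J`. Used in both orders, this gives two
projections that annihilate each other. -/
theorem exists_projections (I J : Submodule ℚ A) (h : Disjoint I J) :
    ∃ e : A →ₗ[ℚ] A, (∀ a, e a ∈ I) ∧ (∀ a ∈ I, e a = a) ∧ ∀ a ∈ J, e a = 0 := by
  obtain ⟨Y, hJY, hY⟩ := h.symm.exists_isCompl
  refine ⟨Submodule.projection I Y hY.symm, fun a => ?_, fun a ha => ?_, fun a ha => ?_⟩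
  · exact Submodule.projection_apply_mem hY.symm a
  · exact Submodule.projection_apply_left hY.symm ⟨a, ha⟩
  · exact Submodule.projection_apply_of_mem_right hY.symm (hJY ha)

/-- The birelative product total complex of two ideals with zero intersection is acyclic. -/
theorem exists_totalD_eq_of_disjoint (g₁ : A →ₐ[ℚ] B) (g₂ : A →ₐ[ℚ] C)
    (hg₁ : Function.Surjective g₁) (hg₂ : Function.Surjective g₂)
    (hg : ∀ a, g₁ a = 0 → g₂ a = 0 → a = 0)
    (n : ℤ) (x : ∀ q, (hochschild ℤ A).obj q)
    (hx₁ : ∀ q, (hochschildMap ℤ (g₁ : A →+* B).toIntAlgHom).app q (x q) = 0)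
    (hx₂ : ∀ q, (hochschildMap ℤ (g₂ : A →+* C).toIntAlgHom).app q (x q) = 0)
    (hdx : (hochschild ℤ A).totalD n x = 0) :
    ∃ y : ∀ q, (hochschild ℤ A).obj q,
      (∀ q, (hochschildMap ℤ (g₁ : A →+* B).toIntAlgHom).app q (y q) = 0) ∧
        (∀ q, (hochschildMap ℤ (g₂ : A →+* C).toIntAlgHom).app q (y q) = 0) ∧
          (hochschild ℤ A).totalD (n + 1) y = x := by
  have hdis : Disjoint (LinearMap.ker g₁.toLinearMap) (LinearMap.ker g₂.toLinearMap) :=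
    Submodule.disjoint_def.mpr fun a h1 h2 => hg a h1 h2
  obtain ⟨e₁, r₁, i₁, z₁⟩ := exists_projections _ _ hdis
  obtain ⟨e₂, r₂, i₂, z₂⟩ := exists_projections _ _ hdis.symm
  have k₁ : ∀ a, g₁ (e₁ a) = 0 := r₁
  have k₂ : ∀ a, g₂ (e₂ a) = 0 := r₂
  let ℓ := PairType.letters (e₁.restrictScalars ℤ) (e₂.restrictScalars ℤ)
    (fun a => i₁ _ (r₁ a)) (fun a => i₂ _ (r₂ a)) (fun a => z₁ _ (r₂ a)) (fun a => z₂ _ (r₁ a))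
    (fun a b => i₁ _ (by change g₁ (e₁ a * b) = 0; rw [map_mul, k₁, zero_mul]))
    (fun a b => i₁ _ (by change g₁ (b * e₁ a) = 0; rw [map_mul, k₁, mul_zero]))
    (fun a b => i₂ _ (by change g₂ (e₂ a * b) = 0; rw [map_mul, k₂, zero_mul]))
    (fun a b => i₂ _ (by change g₂ (b * e₂ a) = 0; rw [map_mul, k₂, mul_zero]))
  refine (exists_totalD_eq_of_marking (ℓ := ℓ) PairType.marking
    (fun q => LinearMap.ker ((hochschildMap ℤ (g₁ : A →+* B).toIntAlgHom).app q) ⊓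
      LinearMap.ker ((hochschildMap ℤ (g₂ : A →+* C).toIntAlgHom).app q))
    (fun q => {σ | (∃ i, σ i = PairType.left) ∧ (∃ i, σ i = PairType.right) ∧
      ∀ i, σ i ≠ PairType.zero}) (fun q => le_antisymm (fun x hx => ?_) (le_inf ?_ ?_))
    (fun q σ hσ => ?_) (fun q i x hx => ⟨hochschildMap_d i hx.1, hochschildMap_d i hx.2⟩)
    (fun q x hx => ⟨hochschildMap_t hx.1, hochschildMap_t hx.2⟩)
    n x (fun q => ⟨hx₁ q, hx₂ q⟩) hdx).imp fun y hy =>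
      ⟨fun q => (hy.1 q).1, fun q => (hy.1 q).2, hy.2⟩
  · refine mem_wordSpan_of_entrywise _ x fun σ hσ => ?_
    by_cases h0 : ∃ i, σ i = PairType.zero
    · obtain ⟨i, hi⟩ := h0
      exact entrywise_eq_zero_of_zero σ i hi x
    by_cases hl : ∃ i, σ i = PairType.left
    · have hr : ∀ i, σ i ≠ PairType.right := fun i hi => hσ ⟨hl, ⟨i, hi⟩, not_exists.mp h0⟩
      refine entrywise_eq_zero (g₂ : A →+* C).toIntAlgHom σ (fun i => ?_) x hx.2
      refine exists_factor g₂ hg₂ _ fun a ha => ?_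
      rcases h : σ i with _ | _ | _ | _
      · change a - e₁ a - e₂ a = 0
        rw [z₁ a ha, i₂ a ha, sub_zero, sub_self]
      · exact z₁ a ha
      · exact absurd h (hr i)
      · rfl
    · refine entrywise_eq_zero (g₁ : A →+* B).toIntAlgHom σ (fun i => ?_) x hx.1
      refine exists_factor g₁ hg₁ _ fun a ha => ?_
      rcases h : σ i with _ | _ | _ | _
      · change a - e₁ a - e₂ a = 0
        rw [i₁ a ha, z₂ a ha, sub_zero, sub_self]
      · exact absurd ⟨i, h⟩ hl
      · exact z₂ a ha
      · rfl
  · exact hochschildMap_wordSpan (ℓ := ℓ) (g₁ : A →+* B).toIntAlgHom PairType.left k₁ _ fun σ hσ => hσ.1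
  · exact hochschildMap_wordSpan (ℓ := ℓ) (g₂ : A →+* C).toIntAlgHom PairType.right k₂ _ fun σ hσ => hσ.2.1
  · obtain ⟨⟨i, hi⟩, ⟨j, hj⟩, h0⟩ := hσ
    refine PairType.marking_total_ne_zero (List.mem_ofFn.mpr ⟨i, hi⟩) (List.mem_ofFn.mpr ⟨j, hj⟩) ?_
    rintro h
    obtain ⟨l, hl⟩ := List.mem_ofFn.mp h
    exact h0 l hl

end RationalKernels

end HochschildWord

namespace CyclicModule

/-! ### Periodic homology in terms of explicit cycles -/

section HomologyClass

variable {k : Type v} [CommRing k] (M : CyclicModule.{u} k)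

theorem periodicComplex_d {m n : ℤ} (h : m + 1 = n) :
    M.periodicComplex.d n m = ModuleCat.ofHom (M.totalD n) := if_pos h

/-- The cycles of the product total complex as elements of the object of cycles. -/
noncomputable def toCycles (n : ℤ) :
    ModuleCat.of k (LinearMap.ker (M.totalD n)) ⟶ M.periodicComplex.cycles n :=
  M.periodicComplex.liftCycles (ModuleCat.ofHom (LinearMap.ker (M.totalD n)).subtype) (n - 1)
    (ChainComplex.next ℤ n) (by
      rw [periodicComplex_d M (sub_add_cancel n 1)]
      ext x
      exact x.2)

/-- The class of a cycle of the product total complex. -/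
noncomputable def homologyClass (n : ℤ) :
    LinearMap.ker (M.totalD n) →ₗ[k] M.periodicHomology n :=
  (M.toCycles n ≫ M.periodicComplex.homologyπ n).hom

theorem iCycles_toCycles (n : ℤ) (x : LinearMap.ker (M.totalD n)) :
    (M.periodicComplex.iCycles n).hom ((M.toCycles n).hom x) = x.1 := by
  have : M.toCycles n ≫ M.periodicComplex.iCycles n =
      ModuleCat.ofHom (LinearMap.ker (M.totalD n)).subtype :=
    HomologicalComplex.liftCycles_i ..
  exact congrArg (fun g => g.hom x) this

theorem iCycles_injective (n : ℤ) : Function.Injective (M.periodicComplex.iCycles n).hom :=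
  (ModuleCat.mono_iff_injective _).mp inferInstance

theorem exists_homologyClass_eq {n : ℤ} (h : M.periodicHomology n) :
    ∃ x : LinearMap.ker (M.totalD n), M.homologyClass n x = h := by
  obtain ⟨z, rfl⟩ := (ModuleCat.epi_iff_surjective (M.periodicComplex.homologyπ n)).mp
    inferInstance h
  have hz : M.totalD n ((M.periodicComplex.iCycles n).hom z) = 0 := by
    have := M.periodicComplex.iCycles_d n (n - 1)
    rw [periodicComplex_d M (sub_add_cancel n 1)] at this
    exact congrArg (fun g => g.hom z) this
  refine ⟨⟨_, hz⟩, ?_⟩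
  change (M.periodicComplex.homologyπ n).hom ((M.toCycles n).hom _) = _
  congr 1
  exact M.iCycles_injective n (M.iCycles_toCycles n _)

theorem homologyClass_eq_zero_iff {m n : ℤ} (h : m + 1 = n) (x : LinearMap.ker (M.totalD m)) :
    M.homologyClass m x = 0 ↔ ∃ y, M.totalD n y = x.1 := by
  have hprev : (ComplexShape.down ℤ).prev m = n := by
    rw [ChainComplex.prev, h]
  have hex := ShortComplex.exact_of_g_is_cokernel
    (ShortComplex.mk _ _ (M.periodicComplex.toCycles_comp_homologyπ n m))
    (M.periodicComplex.homologyIsCokernel n m hprev)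
  rw [ShortComplex.moduleCat_exact_iff] at hex
  have hd : ∀ y, (M.periodicComplex.iCycles m).hom ((M.periodicComplex.toCycles n m).hom y) =
      M.totalD n y := by
    intro y
    have := M.periodicComplex.toCycles_i n m
    rw [periodicComplex_d M h] at this
    exact congrArg (fun g => g.hom y) this
  constructor
  · intro hx
    obtain ⟨y, hy⟩ := hex ((M.toCycles m).hom x) hx
    refine ⟨y, ?_⟩
    rw [← hd, ← M.iCycles_toCycles m x]
    exact congrArg _ hy
  · rintro ⟨y, hy⟩
    have hx : (M.toCycles m).hom x = (M.periodicComplex.toCycles n m).hom y := by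
      refine M.iCycles_injective m ?_
      exact (M.iCycles_toCycles m x).trans (hy.symm.trans (hd y).symm)
    change (M.periodicComplex.homologyπ m).hom ((M.toCycles m).hom x) = 0
    rw [hx]
    exact congrArg (fun g => g.hom y) (M.periodicComplex.toCycles_comp_homologyπ n m)

theorem homologyClass_eq_iff {m n : ℤ} (h : m + 1 = n) (x y : LinearMap.ker (M.totalD m)) :
    M.homologyClass m x = M.homologyClass m y ↔ ∃ w, M.totalD n w = x.1 - y.1 := by
  rw [← sub_eq_zero, ← map_sub, homologyClass_eq_zero_iff M h]
  rfl

end HomologyClass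

section Map

variable {k : Type v} [CommRing k] {L M N : CyclicModule.{u} k}

theorem Hom.totalMap_totalD (f : Hom M N) (n : ℤ) (x : ∀ q, M.obj q) :
    f.totalMap (M.totalD n x) = N.totalD n (f.totalMap x) :=
  LinearMap.congr_fun (f.totalMap_comp n) x

/-- The map induced on cycles of the product total complexes. -/
def Hom.mapCycle (f : Hom M N) (n : ℤ) (x : LinearMap.ker (M.totalD n)) :
    LinearMap.ker (N.totalD n) :=
  ⟨f.totalMap x.1, by
    rw [LinearMap.mem_ker, ← f.totalMap_totalD, LinearMap.mem_ker.mp x.2, map_zero]⟩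

theorem Hom.periodicHomologyMap_homologyClass (f : Hom M N) (n : ℤ)
    (x : LinearMap.ker (M.totalD n)) :
    (f.periodicHomologyMap n).hom (M.homologyClass n x) = N.homologyClass n (f.mapCycle n x) := by
  have h := congrArg (fun g => g.hom ((M.toCycles n).hom x))
    (HomologicalComplex.homologyπ_naturality f.periodicComplexMap n)
  have h2 : (HomologicalComplex.cyclesMap f.periodicComplexMap n).hom ((M.toCycles n).hom x) =
      (N.toCycles n).hom (f.mapCycle n x) := by
    refine N.iCycles_injective n ?_
    rw [iCycles_toCycles]
    have h3 := congrArg (fun g => g.hom ((M.toCycles n).hom x))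
      (HomologicalComplex.cyclesMap_i f.periodicComplexMap n)
    refine h3.trans ?_
    change f.totalMap ((M.periodicComplex.iCycles n).hom ((M.toCycles n).hom x)) = _
    rw [iCycles_toCycles]
    rfl
  refine h.trans ?_
  change (N.periodicComplex.homologyπ n).hom
    ((HomologicalComplex.cyclesMap f.periodicComplexMap n).hom ((M.toCycles n).hom x)) = _
  rw [h2]
  rfl

theorem Hom.totalMap_surjective (f : Hom M N) (hf : ∀ q, Function.Surjective (f.app q)) :
    Function.Surjective f.totalMap := fun y => by
  choose x hx using fun q => hf q (y q)
  exact ⟨x, funext hx⟩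

/-- A surjection of cyclic modules with acyclic kernel is an isomorphism on periodic homology. -/
theorem Hom.bijective_periodicHomologyMap (f : Hom M N) (hf : Function.Surjective f.totalMap)
    (hK : ∀ (n : ℤ) (x : ∀ q, M.obj q), f.totalMap x = 0 → M.totalD n x = 0 →
      ∃ y, f.totalMap y = 0 ∧ M.totalD (n + 1) y = x) (n : ℤ) :
    Function.Bijective (f.periodicHomologyMap n).hom := by
  constructor
  · rw [injective_iff_map_eq_zero]
    intro c hc
    obtain ⟨x, rfl⟩ := M.exists_homologyClass_eq c
    rw [f.periodicHomologyMap_homologyClass, homologyClass_eq_zero_iff _ rfl] at hc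
    obtain ⟨z, hz⟩ := hc
    obtain ⟨y, rfl⟩ := hf z
    obtain ⟨w, -, hw⟩ := hK n (x.1 - M.totalD (n + 1) y)
      (by rw [map_sub, f.totalMap_totalD, hz]; exact sub_self _)
      (by rw [map_sub, totalD_totalD, LinearMap.mem_ker.mp x.2, sub_self])
    rw [homologyClass_eq_zero_iff _ rfl]
    exact ⟨w + y, by rw [map_add, hw, sub_add_cancel]⟩
  · intro c
    obtain ⟨z, rfl⟩ := N.exists_homologyClass_eq c
    obtain ⟨y, hy⟩ := hf z.1
    obtain ⟨m, rfl⟩ : ∃ m, m + 1 = n := ⟨n - 1, sub_add_cancel n 1⟩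
    obtain ⟨w, hw, hw'⟩ := hK m (M.totalD (m + 1) y)
      (by rw [f.totalMap_totalD, hy, LinearMap.mem_ker.mp z.2]) (totalD_totalD ..)
    refine ⟨M.homologyClass _ ⟨y - w, ?_⟩, ?_⟩
    · rw [LinearMap.mem_ker, map_sub, hw', sub_self]
    · rw [f.periodicHomologyMap_homologyClass]
      congr 1
      ext1
      change f.totalMap (y - w) = _
      rw [map_sub, hw, sub_zero, hy]

end Map

/-! ### The long exact sequence of an excisive square -/

section MayerVietoris

variable {k : Type v} [CommRing k]

/-- A square of cyclic modules which is exact as a sequence `M₀ → M₁ ⊕ M₂ → M₁₂ → 0` and for which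
the kernel of `M₀ → M₁ ⊕ M₂` has acyclic product total complex. -/
structure IsExcisive {M₀ M₁ M₂ M₁₂ : CyclicModule.{u} k} (g₁ : Hom M₀ M₁) (g₂ : Hom M₀ M₂)
    (f₁ : Hom M₁ M₁₂) (f₂ : Hom M₂ M₁₂) : Prop where
  comm : ∀ x, f₁.totalMap (g₁.totalMap x) = f₂.totalMap (g₂.totalMap x)
  surjective : Function.Surjective f₁.totalMap
  exists_lift : ∀ x y, f₁.totalMap x = f₂.totalMap y → ∃ z, g₁.totalMap z = x ∧ g₂.totalMap z = y
  acyclic : ∀ (n : ℤ) x, g₁.totalMap x = 0 → g₂.totalMap x = 0 → M₀.totalD n x = 0 →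
    ∃ y, g₁.totalMap y = 0 ∧ g₂.totalMap y = 0 ∧ M₀.totalD (n + 1) y = x

namespace IsExcisive

variable {M₀ M₁ M₂ M₁₂ : CyclicModule.{u} k} {g₁ : Hom M₀ M₁} {g₂ : Hom M₀ M₂}
  {f₁ : Hom M₁ M₁₂} {f₂ : Hom M₂ M₁₂} {m n : ℤ}

variable (g₁ g₂ f₁ f₂) in
/-- The graph of the connecting map on cycles. -/
def Connects (n : ℤ) (z : ∀ q, M₁₂.obj q) (x : ∀ q, M₀.obj q) : Prop :=
  ∃ y₁ y₂, f₁.totalMap y₁ - f₂.totalMap y₂ = z ∧ g₁.totalMap x = M₁.totalD n y₁ ∧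
    g₂.totalMap x = M₂.totalD n y₂

theorem Connects.add {z z' : ∀ q, M₁₂.obj q} {x x' : ∀ q, M₀.obj q}
    (h : Connects g₁ g₂ f₁ f₂ n z x) (h' : Connects g₁ g₂ f₁ f₂ n z' x') :
    Connects g₁ g₂ f₁ f₂ n (z + z') (x + x') := by
  obtain ⟨y₁, y₂, hz, h₁, h₂⟩ := h
  obtain ⟨y₁', y₂', hz', h₁', h₂'⟩ := h'
  refine ⟨y₁ + y₁', y₂ + y₂', ?_, ?_, ?_⟩
  · rw [← hz, ← hz', map_add, map_add]; abel
  · rw [map_add, map_add, h₁, h₁']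
  · rw [map_add, map_add, h₂, h₂']

theorem Connects.smul {z : ∀ q, M₁₂.obj q} {x : ∀ q, M₀.obj q} (c : k)
    (h : Connects g₁ g₂ f₁ f₂ n z x) : Connects g₁ g₂ f₁ f₂ n (c • z) (c • x) := by
  obtain ⟨y₁, y₂, hz, h₁, h₂⟩ := h
  refine ⟨c • y₁, c • y₂, ?_, ?_, ?_⟩
  · rw [← hz, map_smul, map_smul, smul_sub]
  · rw [map_smul, map_smul, h₁]
  · rw [map_smul, map_smul, h₂]

variable (h : IsExcisive g₁ g₂ f₁ f₂)
include h

/-- The boundary of `w` is a cycle in the acyclic common kernel, so `w` can be corrected to a cycle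
without changing its two images. -/
theorem exists_cycle (hmn : m + 1 = n) (w : ∀ q, M₀.obj q)
    (h₁ : M₁.totalD n (g₁.totalMap w) = 0) (h₂ : M₂.totalD n (g₂.totalMap w) = 0) :
    ∃ x : LinearMap.ker (M₀.totalD n), g₁.totalMap x.1 = g₁.totalMap w ∧
      g₂.totalMap x.1 = g₂.totalMap w := by
  subst hmn
  obtain ⟨y, hy₁, hy₂, hy⟩ := h.acyclic m (M₀.totalD (m + 1) w)
    (by rw [g₁.totalMap_totalD, h₁]) (by rw [g₂.totalMap_totalD, h₂]) (totalD_totalD ..)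
  refine ⟨⟨w - y, ?_⟩, ?_, ?_⟩
  · rw [LinearMap.mem_ker, map_sub, hy, sub_self]
  · rw [map_sub, hy₁, sub_zero]
  · rw [map_sub, hy₂, sub_zero]

theorem exists_connects (hmn : m + 1 = n) (z : LinearMap.ker (M₁₂.totalD n)) :
    ∃ x : LinearMap.ker (M₀.totalD m), Connects g₁ g₂ f₁ f₂ n z.1 x.1 := by
  obtain ⟨y, hy⟩ := h.surjective z.1
  obtain ⟨w, hw₁, hw₂⟩ := h.exists_lift (M₁.totalD n y) 0
    (by rw [f₁.totalMap_totalD, hy, LinearMap.mem_ker.mp z.2, map_zero])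
  obtain ⟨x, hx₁, hx₂⟩ := h.exists_cycle (sub_add_cancel m 1) w
    (by subst hmn; rw [hw₁, totalD_totalD]) (by rw [hw₂, map_zero])
  exact ⟨x, y, 0, by rw [hy, map_zero, sub_zero], hx₁.trans hw₁, by rw [hx₂, hw₂, map_zero]⟩

/-- Well-definedness of the connecting map. After subtracting a boundary from `y₁`, the pair lifts
to some `w`, and `∂w - x` is a cycle in the acyclic kernel. -/
theorem exists_totalD_eq_of_connects (hmn : m + 1 = n) {z : ∀ q, M₁₂.obj q}
    {x : LinearMap.ker (M₀.totalD m)} (hz : ∃ w, M₁₂.totalD (n + 1) w = z)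
    (hzx : Connects g₁ g₂ f₁ f₂ n z x.1) : ∃ y, M₀.totalD n y = x.1 := by
  subst hmn
  obtain ⟨v, hv⟩ := hz
  obtain ⟨v, rfl⟩ := h.surjective v
  obtain ⟨y₁, y₂, rfl, h₁, h₂⟩ := hzx
  obtain ⟨w, hw₁, hw₂⟩ := h.exists_lift (y₁ - M₁.totalD (m + 1 + 1) v) y₂
    (by rw [map_sub, f₁.totalMap_totalD, hv]; abel)
  obtain ⟨y, -, -, hy⟩ := h.acyclic m (M₀.totalD (m + 1) w - x.1)
    (by rw [map_sub, g₁.totalMap_totalD, hw₁, map_sub, totalD_totalD, h₁]; simp)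
    (by rw [map_sub, g₂.totalMap_totalD, hw₂, h₂, sub_self])
    (by rw [map_sub, totalD_totalD, LinearMap.mem_ker.mp x.2, sub_self])
  exact ⟨w - y, by rw [map_sub, hy, sub_sub_cancel]⟩

theorem existsUnique_class (hmn : m + 1 = n) (c : M₁₂.periodicHomology n) :
    ∃! e : M₀.periodicHomology m, ∃ (z : LinearMap.ker (M₁₂.totalD n))
      (x : LinearMap.ker (M₀.totalD m)), M₁₂.homologyClass n z = c ∧ M₀.homologyClass m x = e ∧
        Connects g₁ g₂ f₁ f₂ n z.1 x.1 := by
  obtain ⟨z, rfl⟩ := M₁₂.exists_homologyClass_eq c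
  obtain ⟨x, hx⟩ := h.exists_connects hmn z
  refine ⟨_, ⟨z, x, rfl, rfl, hx⟩, ?_⟩
  rintro _ ⟨z', x', hz', rfl, hx'⟩
  rw [homologyClass_eq_iff _ rfl] at hz'
  rw [homologyClass_eq_iff _ hmn]
  refine h.exists_totalD_eq_of_connects hmn (x := x' - x) hz' ?_
  have := hx'.add (hx.smul (-1))
  rw [neg_smul, one_smul, neg_smul, one_smul, ← sub_eq_add_neg, ← sub_eq_add_neg] at this
  exact this

/-- The connecting map. -/
noncomputable def connecting (hmn : m + 1 = n) : M₁₂.periodicHomology n →ₗ[k] M₀.periodicHomology m where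
  toFun c := (h.existsUnique_class hmn c).choose
  map_add' c c' := by
    obtain ⟨z, x, hz, hx, hzx⟩ := (h.existsUnique_class hmn c).choose_spec.1
    obtain ⟨z', x', hz', hx', hzx'⟩ := (h.existsUnique_class hmn c').choose_spec.1
    refine ((h.existsUnique_class hmn (c + c')).choose_spec.2 _
      ⟨z + z', x + x', ?_, ?_, hzx.add hzx'⟩).symm
    · rw [map_add, hz, hz']
    · rw [map_add, hx, hx']
  map_smul' a c := by
    obtain ⟨z, x, hz, hx, hzx⟩ := (h.existsUnique_class hmn c).choose_spec.1
    refine ((h.existsUnique_class hmn (a • c)).choose_spec.2 _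
      ⟨a • z, a • x, ?_, ?_, hzx.smul a⟩).symm
    · rw [map_smul, hz]
    · rw [map_smul, hx]; rfl

theorem connecting_eq (hmn : m + 1 = n) (z : LinearMap.ker (M₁₂.totalD n))
    (x : LinearMap.ker (M₀.totalD m)) (hzx : Connects g₁ g₂ f₁ f₂ n z.1 x.1) :
    h.connecting hmn (M₁₂.homologyClass n z) = M₀.homologyClass m x :=
  ((h.existsUnique_class hmn _).choose_spec.2 _ ⟨z, x, rfl, rfl, hzx⟩).symm

theorem exact_prod_coprod (n : ℤ) : Function.Exact
    ((g₁.periodicHomologyMap n).hom.prod (g₂.periodicHomologyMap n).hom)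
    ((f₁.periodicHomologyMap n).hom.coprod (-(f₂.periodicHomologyMap n).hom)) := by
  rintro ⟨c₁, c₂⟩
  constructor
  · intro hc
    obtain ⟨y₁, rfl⟩ := M₁.exists_homologyClass_eq c₁
    obtain ⟨y₂, rfl⟩ := M₂.exists_homologyClass_eq c₂
    rw [LinearMap.coprod_apply, LinearMap.neg_apply, ← sub_eq_add_neg, sub_eq_zero,
      Hom.periodicHomologyMap_homologyClass, Hom.periodicHomologyMap_homologyClass,
      homologyClass_eq_iff _ rfl] at hc
    obtain ⟨v, hv⟩ := hc
    obtain ⟨v, rfl⟩ := h.surjective v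
    obtain ⟨w, hw₁, hw₂⟩ := h.exists_lift (y₁.1 - M₁.totalD (n + 1) v) y₂.1 (by
      rw [map_sub, f₁.totalMap_totalD, hv]; exact sub_sub_cancel _ _)
    obtain ⟨x, hx₁, hx₂⟩ := h.exists_cycle (sub_add_cancel n 1) w
      (by rw [hw₁, map_sub, totalD_totalD, LinearMap.mem_ker.mp y₁.2, sub_zero])
      (by rw [hw₂, LinearMap.mem_ker.mp y₂.2])
    refine ⟨M₀.homologyClass n x, ?_⟩
    rw [LinearMap.prod_apply, Function.prod_apply, Hom.periodicHomologyMap_homologyClass,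
      Hom.periodicHomologyMap_homologyClass]
    refine Prod.ext ?_ ?_
    · refine (homologyClass_eq_iff _ rfl _ _).mpr ⟨-v, ?_⟩
      change _ = g₁.totalMap x.1 - y₁.1
      rw [hx₁, hw₁, map_neg]
      abel
    · refine congrArg (M₂.homologyClass n) (Subtype.ext ?_)
      exact hx₂.trans hw₂
  · rintro ⟨e, he⟩
    obtain ⟨x, rfl⟩ := M₀.exists_homologyClass_eq e
    rw [← he, LinearMap.prod_apply, Function.prod_apply, LinearMap.coprod_apply, LinearMap.neg_apply,
      ← sub_eq_add_neg, sub_eq_zero]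
    simp only [Hom.periodicHomologyMap_homologyClass]
    exact congrArg _ (Subtype.ext (h.comm x.1))

theorem exact_coprod_connecting (hmn : m + 1 = n) : Function.Exact
    ((f₁.periodicHomologyMap n).hom.coprod (-(f₂.periodicHomologyMap n).hom))
    (h.connecting hmn) := by
  intro c
  constructor
  · intro hc
    obtain ⟨z, rfl⟩ := M₁₂.exists_homologyClass_eq c
    obtain ⟨x, hzx⟩ := h.exists_connects hmn z
    rw [h.connecting_eq hmn z x hzx, homologyClass_eq_zero_iff _ hmn] at hc
    obtain ⟨w, hw⟩ := hc
    obtain ⟨y₁, y₂, hz, h₁, h₂⟩ := hzx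
    -- If `x = ∂w`, subtracting the images of `w` makes both chains cycles; by commutativity of the
    -- square their difference in `M₁₂` is unchanged.
    have hy₁ : y₁ - g₁.totalMap w ∈ LinearMap.ker (M₁.totalD n) := by
      rw [LinearMap.mem_ker, map_sub, ← g₁.totalMap_totalD, hw, h₁, sub_self]
    have hy₂ : y₂ - g₂.totalMap w ∈ LinearMap.ker (M₂.totalD n) := by
      rw [LinearMap.mem_ker, map_sub, ← g₂.totalMap_totalD, hw, h₂, sub_self]
    refine ⟨(M₁.homologyClass n ⟨_, hy₁⟩, M₂.homologyClass n ⟨_, hy₂⟩), ?_⟩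
    rw [LinearMap.coprod_apply, LinearMap.neg_apply, ← sub_eq_add_neg,
      Hom.periodicHomologyMap_homologyClass, Hom.periodicHomologyMap_homologyClass, ← map_sub]
    refine congrArg _ (Subtype.ext ?_)
    change f₁.totalMap (y₁ - g₁.totalMap w) - f₂.totalMap (y₂ - g₂.totalMap w) = z.1
    rw [map_sub, map_sub, h.comm, sub_sub_sub_cancel_right, hz]
  · rintro ⟨⟨c₁, c₂⟩, rfl⟩
    obtain ⟨y₁, rfl⟩ := M₁.exists_homologyClass_eq c₁
    obtain ⟨y₂, rfl⟩ := M₂.exists_homologyClass_eq c₂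
    rw [LinearMap.coprod_apply, LinearMap.neg_apply, ← sub_eq_add_neg,
      Hom.periodicHomologyMap_homologyClass, Hom.periodicHomologyMap_homologyClass, ← map_sub,
      h.connecting_eq hmn _ 0 ⟨y₁.1, y₂.1, rfl, ?_, ?_⟩, map_zero]
    · exact (map_zero _).trans (LinearMap.mem_ker.mp y₁.2).symm
    · exact (map_zero _).trans (LinearMap.mem_ker.mp y₂.2).symm

theorem exact_connecting_prod (hmn : m + 1 = n) : Function.Exact (h.connecting hmn)
    ((g₁.periodicHomologyMap m).hom.prod (g₂.periodicHomologyMap m).hom) := by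
  intro e
  constructor
  · intro he
    obtain ⟨x, rfl⟩ := M₀.exists_homologyClass_eq e
    obtain ⟨he₁, he₂⟩ := Prod.ext_iff.mp he
    rw [LinearMap.prod_apply] at he₁ he₂
    obtain ⟨y₁, hy₁⟩ := (homologyClass_eq_zero_iff _ hmn _).mp
      ((g₁.periodicHomologyMap_homologyClass m x).symm.trans he₁)
    obtain ⟨y₂, hy₂⟩ := (homologyClass_eq_zero_iff _ hmn _).mp
      ((g₂.periodicHomologyMap_homologyClass m x).symm.trans he₂)
    have hz : f₁.totalMap y₁ - f₂.totalMap y₂ ∈ LinearMap.ker (M₁₂.totalD n) := by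
      rw [LinearMap.mem_ker, map_sub, ← f₁.totalMap_totalD, ← f₂.totalMap_totalD, hy₁, hy₂,
        sub_eq_zero]
      exact h.comm x.1
    exact ⟨M₁₂.homologyClass n ⟨_, hz⟩, h.connecting_eq hmn _ x ⟨y₁, y₂, rfl, hy₁.symm, hy₂.symm⟩⟩
  · rintro ⟨c, rfl⟩
    obtain ⟨z, rfl⟩ := M₁₂.exists_homologyClass_eq c
    obtain ⟨x, hzx⟩ := h.exists_connects hmn z
    rw [h.connecting_eq hmn z x hzx, LinearMap.prod_apply, Function.prod_apply,
      Hom.periodicHomologyMap_homologyClass, Hom.periodicHomologyMap_homologyClass]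
    obtain ⟨y₁, y₂, hz, h₁, h₂⟩ := hzx
    exact Prod.ext ((homologyClass_eq_zero_iff _ hmn _).mpr ⟨y₁, h₁.symm⟩)
      ((homologyClass_eq_zero_iff _ hmn _).mpr ⟨y₂, h₂.symm⟩)

end IsExcisive

end MayerVietoris

end CyclicModule

namespace HochschildWord

/-! ### Right exactness of the Hochschild modules of the square -/

section Exactness

variable {k : Type} [CommRing k] {A B C D : Type u} [Ring A] [Algebra k A] [Ring B] [Algebra k B]
  [Ring C] [Algebra k C] [Ring D] [Algebra k D]

theorem hochschildMap_surjective (f : A →ₐ[k] B) (hf : Function.Surjective f) (q : ℕ) :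
    Function.Surjective ((hochschildMap k f).app q) := by
  rw [← LinearMap.range_eq_top, ← top_le_iff, ← span_pure, Submodule.span_le]
  rintro _ ⟨b, rfl⟩
  choose a ha using fun i => hf (b i)
  exact ⟨pure k q a, by rw [hochschildMap_pure]; simp only [ha]⟩

theorem pure_update_sub (q : ℕ) (y : Fin (q + 1) → A) (i : Fin (q + 1)) (a b : A) :
    pure k q (Function.update y i a) - pure k q (Function.update y i b) =
      pure k q (Function.update y i (a - b)) :=
  ((PiTensorProduct.tprod k).map_update_sub y i a b).symm

/-- Replace the entries one at a time. Each replacement changes the tensor by one having an entry in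
the kernel of `f`. -/
theorem pure_sub_mem_of_congr (f : C →ₐ[k] D) (q : ℕ) (N : Submodule k ((hochschild k C).obj q))
    (hN : ∀ y i, f (y i) = 0 → pure k q y ∈ N) (y y' : Fin (q + 1) → C)
    (hy : ∀ i, f (y i) = f (y' i)) : pure k q y - pure k q y' ∈ N := by
  have key : ∀ S : Finset (Fin (q + 1)), pure k q y - pure k q (S.piecewise y' y) ∈ N := by
    intro S
    induction S using Finset.induction_on with
    | empty => simp
    | insert i S hi ih =>
      have h1 := pure_update_sub (k := k) q (S.piecewise y' y) i (y i) (y' i)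
      have h2 : Function.update (S.piecewise y' y) i (y i) = S.piecewise y' y := by
        rw [Function.update_eq_self_iff, Finset.piecewise_eq_of_notMem _ _ _ hi]
      rw [Finset.piecewise_insert, ← sub_add_sub_cancel _ (pure k q (S.piecewise y' y))]
      refine add_mem ih ?_
      rw [h2] at h1
      rw [h1]
      refine hN _ i ?_
      rw [Function.update_self, map_sub, hy, sub_self]
  simpa using key Finset.univ

/-- Using the section `s`, an element of the kernel is a combination of pure tensors with an entry
in the kernel of `f`. That entry lifts to one killed by `g₁`, and the others lift arbitrarily. -/
theorem exists_lift_of_hochschildMap_eq_zero (g₁ : A →ₐ[k] B) (g₂ : A →ₐ[k] C) (f : C →ₐ[k] D)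
    (hg₂ : Function.Surjective g₂) (hfg : ∀ c, f c = 0 → ∃ a, g₁ a = 0 ∧ g₂ a = c)
    (s : D →ₗ[k] C) (hs : ∀ d, f (s d) = d) (q : ℕ) (x : (hochschild k C).obj q)
    (hx : (hochschildMap k f).app q x = 0) :
    ∃ z, (hochschildMap k g₁).app q z = 0 ∧ (hochschildMap k g₂).app q z = x := by
  set N := (LinearMap.ker ((hochschildMap k g₁).app q)).map ((hochschildMap k g₂).app q) with hNdef
  have hN : ∀ y i, f (y i) = 0 → pure k q y ∈ N := by
    intro y i hi
    choose a ha using fun j => hg₂ (y j)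
    obtain ⟨c, hc₁, hc₂⟩ := hfg _ hi
    refine ⟨pure k q (Function.update a i c), ?_, ?_⟩
    · change (hochschildMap k g₁).app q _ = 0
      rw [hochschildMap_pure]
      exact MultilinearMap.map_coord_zero _ i (by rw [Function.update_self, hc₁])
    · rw [hochschildMap_pure]
      congr 1
      funext j
      by_cases hj : j = i
      · subst hj
        rw [Function.update_self, hc₂]
      · rw [Function.update_of_ne hj, ha]
  let g : (hochschild k D).obj q →ₗ[k] (hochschild k C).obj q := PiTensorProduct.map fun _ => s
  have hg : ∀ y, g ((hochschildMap k f).app q (pure k q y)) = pure k q fun i => s (f (y i)) :=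
    fun y => by
      rw [hochschildMap_pure]
      exact PiTensorProduct.map_tprod _ _
  have key : ⊤ ≤ N.comap (LinearMap.id - g ∘ₗ (hochschildMap k f).app q) := by
    rw [← span_pure, Submodule.span_le]
    rintro _ ⟨y, rfl⟩
    change pure k q y - g ((hochschildMap k f).app q (pure k q y)) ∈ N
    rw [hg]
    exact pure_sub_mem_of_congr f q N hN _ _ fun i => (hs _).symm
  have hxN : x - g ((hochschildMap k f).app q x) ∈ N := key (Submodule.mem_top (x := x))
  rw [hx, map_zero, sub_zero] at hxN
  exact hxN

theorem hochschildMap_comp (f : A →ₐ[k] B) (g : B →ₐ[k] C) (q : ℕ) (x : (hochschild k A).obj q) :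
    (hochschildMap k (g.comp f)).app q x =
      (hochschildMap k g).app q ((hochschildMap k f).app q x) := by
  have : (hochschildMap k (g.comp f)).app q =
      (hochschildMap k g).app q ∘ₗ (hochschildMap k f).app q := by
    refine LinearMap.ext_on_range (span_pure k q) fun a => ?_
    rw [LinearMap.comp_apply, hochschildMap_pure, hochschildMap_pure, hochschildMap_pure]
    rfl
  rw [this, LinearMap.comp_apply]

end Exactness

end HochschildWord

/-! ### Nilpotent extensions and cartesian squares -/

open CyclicModule HochschildWord

theorem HP.map_comp {A B C : Type u} [Ring A] [Ring B] [Ring C] (f : A →+* B) (g : B →+* C) (n : ℤ)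
    (x : HP A n) : HP.map (g.comp f) n x = HP.map g n (HP.map f n x) := by
  obtain ⟨x, rfl⟩ := (hochschild ℤ A).exists_homologyClass_eq x
  refine ((hochschildMap ℤ (g.comp f).toIntAlgHom).periodicHomologyMap_homologyClass n x).trans ?_
  refine Eq.trans ?_ (congrArg (HP.map g n)
    ((hochschildMap ℤ f.toIntAlgHom).periodicHomologyMap_homologyClass n x).symm)
  refine Eq.trans ?_ ((hochschildMap ℤ g.toIntAlgHom).periodicHomologyMap_homologyClass n _).symm
  refine congrArg _ (Subtype.ext (funext fun q => ?_))
  exact hochschildMap_comp f.toIntAlgHom g.toIntAlgHom q _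

theorem exists_mem_ker_pow {A B C : Type u} [Ring A] [Ring B] [Ring C] (p : A →+* C) (hp : Function.Surjective p)
    (g : C →+* B) (m : ℕ) : ∀ c ∈ RingHom.ker g ^ (m + 1),
      ∃ a ∈ RingHom.ker (g.comp p) ^ (m + 1), p a = c := by
  induction m with
  | zero =>
    intro c hc
    rw [zero_add, Submodule.pow_one] at hc ⊢
    obtain ⟨a, rfl⟩ := hp c
    exact ⟨a, hc, rfl⟩
  | succ m ih =>
    intro c hc
    rw [Submodule.pow_succ] at hc ⊢
    refine Submodule.mul_induction_on hc (fun c hc d hd => ?_) fun c d hc hd => ?_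
    · obtain ⟨a, ha, rfl⟩ := ih c hc
      obtain ⟨b, rfl⟩ := hp d
      exact ⟨a * b, Ideal.mul_mem_mul ha hd, map_mul p a b⟩
    · obtain ⟨a, ha, rfl⟩ := hc
      obtain ⟨b, hb, rfl⟩ := hd
      exact ⟨a + b, add_mem ha hb, map_add p a b⟩

section Rational

variable {A B : Type u} [Ring A] [Algebra ℚ A] [Ring B] [Algebra ℚ B]

theorem HP.bijective_map_of_square_zero (f : A →ₐ[ℚ] B) (hf : Function.Surjective f)
    (hsq : ∀ a b, f a = 0 → f b = 0 → a * b = 0) (n : ℤ) :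
    Function.Bijective (HP.map (f : A →+* B) n) := by
  refine Hom.bijective_periodicHomologyMap (hochschildMap ℤ (f : A →+* B).toIntAlgHom)
    (Hom.totalMap_surjective _ (hochschildMap_surjective _ hf)) (fun n x hx hdx => ?_) n
  obtain ⟨y, hy, hy'⟩ := exists_totalD_eq_of_square_zero f hf hsq n x (fun q => congrFun hx q) hdx
  exact ⟨y, funext hy, hy'⟩

theorem HP.bijective_map_of_ker_pow (m : ℕ) : ∀ {A : Type u} [Ring A] [Algebra ℚ A]
    (f : A →ₐ[ℚ] B), Function.Surjective f → RingHom.ker f ^ (m + 1) = ⊥ →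
      ∀ n : ℤ, Function.Bijective (HP.map (f : A →+* B) n) := by
  induction m with
  | zero =>
    intro A _ _ f hf hm n
    refine HP.bijective_map_of_square_zero f hf (fun a b ha hb => ?_) n
    rw [zero_add, Submodule.pow_one] at hm
    have : a ∈ RingHom.ker f := ha
    rw [hm] at this
    rw [(Submodule.mem_bot A).mp this, zero_mul]
  | succ m ih =>
    intro A _ _ f hf hm n
    have hle : RingHom.ker f ^ (m + 1) ≤ RingHom.ker f := Ideal.pow_le_self m.succ_ne_zero
    let p : A →ₐ[ℚ] A ⧸ RingHom.ker f ^ (m + 1) := Ideal.Quotient.mkₐ ℚ _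
    let g : A ⧸ RingHom.ker f ^ (m + 1) →ₐ[ℚ] B := Ideal.Quotient.liftₐ _ f fun a ha => hle ha
    have hp : Function.Surjective p := Ideal.Quotient.mkₐ_surjective ℚ _
    have hp0 : ∀ a, p a = 0 ↔ a ∈ RingHom.ker f ^ (m + 1) := fun a =>
      Ideal.Quotient.eq_zero_iff_mem
    have hgp : (g : (A ⧸ RingHom.ker f ^ (m + 1)) →+* B).comp
        (p : A →+* A ⧸ RingHom.ker f ^ (m + 1)) = (f : A →+* B) := RingHom.ext fun a => rfl
    -- With `I` the kernel of `f`, the product of two elements of `I^(m+1)` lies in `I^(m+1) * I =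
    -- I^(m+2) = 0`.
    have hpn := HP.bijective_map_of_square_zero p hp (fun a b ha hb => by
      have := Ideal.mul_mem_mul ((hp0 a).mp ha) (hle ((hp0 b).mp hb))
      rw [← Submodule.pow_succ, hm] at this
      exact (Submodule.mem_bot A).mp this) n
    have hg : Function.Surjective g := fun b => by
      obtain ⟨a, rfl⟩ := hf b
      exact ⟨p a, rfl⟩
    have hgn := ih g hg (by
      rw [eq_bot_iff]
      intro c hc
      obtain ⟨a, ha, rfl⟩ := exists_mem_ker_pow (p : A →+* A ⧸ RingHom.ker f ^ (m + 1)) hp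
        (g : (A ⧸ RingHom.ker f ^ (m + 1)) →+* B) m c hc
      rw [hgp] at ha
      exact (hp0 a).mpr ha) n
    rw [← hgp]
    convert hgn.comp hpn using 1
    exact funext fun x => HP.map_comp ..

theorem HP.bijective_map_of_isNilpotent_ker (f : A →ₐ[ℚ] B) (hf : Function.Surjective f)
    (h : IsNilpotent (RingHom.ker f)) (n : ℤ) : Function.Bijective (HP.map (f : A →+* B) n) := by
  obtain ⟨m, hm⟩ := h
  refine HP.bijective_map_of_ker_pow m f hf ?_ n
  rw [eq_bot_iff]
  -- Passing from exponent `m` to `m + 1` also covers `m = 0`.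
  exact (Ideal.pow_le_pow_right m.le_succ).trans hm.le

/-- To lift a compatible pair `(x, y)`, lift `x` first. The remaining error in `y` is killed by
`f₂`, and is corrected by a lift of zero image under `g₁`, since `(0, c)` lifts to `A₀` whenever `f₂
c = 0`. Uniqueness in the cartesian condition says that the kernels of `g₁` and `g₂` intersect
trivially, which gives acyclicity. -/
theorem isExcisive_of_cartesian {A₀ A₁ A₂ A₁₂ : Type u} [Ring A₀] [Algebra ℚ A₀] [Ring A₁]
    [Algebra ℚ A₁] [Ring A₂] [Algebra ℚ A₂] [Ring A₁₂] [Algebra ℚ A₁₂]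
    (g₁ : A₀ →ₐ[ℚ] A₁) (g₂ : A₀ →ₐ[ℚ] A₂) (f₁ : A₁ →ₐ[ℚ] A₁₂) (f₂ : A₂ →ₐ[ℚ] A₁₂)
    (hg₁ : Function.Surjective g₁) (hg₂ : Function.Surjective g₂)
    (hf₁ : Function.Surjective f₁) (hf₂ : Function.Surjective f₂) (hcomm : f₁.comp g₁ = f₂.comp g₂)
    (hcart : ∀ (x : A₁) (y : A₂), f₁ x = f₂ y → ∃! a : A₀, g₁ a = x ∧ g₂ a = y) :
    IsExcisive (hochschildMap ℤ (g₁ : A₀ →+* A₁).toIntAlgHom)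
      (hochschildMap ℤ (g₂ : A₀ →+* A₂).toIntAlgHom)
      (hochschildMap ℤ (f₁ : A₁ →+* A₁₂).toIntAlgHom)
      (hochschildMap ℤ (f₂ : A₂ →+* A₁₂).toIntAlgHom) := by
  have hcomm' : (f₁ : A₁ →+* A₁₂).toIntAlgHom.comp (g₁ : A₀ →+* A₁).toIntAlgHom =
      (f₂ : A₂ →+* A₁₂).toIntAlgHom.comp (g₂ : A₀ →+* A₂).toIntAlgHom :=
    AlgHom.ext fun a => DFunLike.congr_fun hcomm a
  have hc : ∀ q x, (hochschildMap ℤ (f₁ : A₁ →+* A₁₂).toIntAlgHom).app q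
        ((hochschildMap ℤ (g₁ : A₀ →+* A₁).toIntAlgHom).app q x) =
      (hochschildMap ℤ (f₂ : A₂ →+* A₁₂).toIntAlgHom).app q
        ((hochschildMap ℤ (g₂ : A₀ →+* A₂).toIntAlgHom).app q x) := fun q x => by
    refine (hochschildMap_comp _ _ q x).symm.trans (Eq.trans ?_ (hochschildMap_comp _ _ q x))
    rw [hcomm']
  obtain ⟨s, hs⟩ := f₂.toLinearMap.exists_rightInverse_of_surjective
    (LinearMap.range_eq_top.mpr hf₂)
  refine ⟨fun x => funext fun q => hc q (x q),
    Hom.totalMap_surjective _ (hochschildMap_surjective _ hf₁), fun x y hxy => ?_,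
    fun n x hx₁ hx₂ hdx => ?_⟩
  · have key : ∀ q, ∃ z, (hochschildMap ℤ (g₁ : A₀ →+* A₁).toIntAlgHom).app q z = x q ∧
        (hochschildMap ℤ (g₂ : A₀ →+* A₂).toIntAlgHom).app q z = y q := fun q => by
      obtain ⟨z, hz⟩ := hochschildMap_surjective (g₁ : A₀ →+* A₁).toIntAlgHom hg₁ q (x q)
      obtain ⟨w, hw₁, hw₂⟩ := exists_lift_of_hochschildMap_eq_zero (g₁ : A₀ →+* A₁).toIntAlgHom
        (g₂ : A₀ →+* A₂).toIntAlgHom (f₂ : A₂ →+* A₁₂).toIntAlgHom hg₂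
        (fun c h => (hcart 0 c ((map_zero f₁).trans h.symm)).exists)
        (s.restrictScalars ℤ) (fun d => LinearMap.congr_fun hs d) q
        (y q - (hochschildMap ℤ (g₂ : A₀ →+* A₂).toIntAlgHom).app q z)
        (by rw [map_sub, ← hc, hz]; exact sub_eq_zero.mpr (congrFun hxy q).symm)
      exact ⟨z + w, by rw [map_add, hw₁, hz, add_zero], by rw [map_add, hw₂, add_sub_cancel]⟩
    choose z hz₁ hz₂ using key
    exact ⟨z, funext hz₁, funext hz₂⟩
  · obtain ⟨y, hy₁, hy₂, hy⟩ := exists_totalD_eq_of_disjoint g₁ g₂ hg₁ hg₂ (fun a h₁ h₂ =>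
      (hcart 0 0 (by rw [map_zero, map_zero])).unique ⟨h₁, h₂⟩ ⟨map_zero g₁, map_zero g₂⟩)
      n x (fun q => congrFun hx₁ q) (fun q => congrFun hx₂ q) hdx
    exact ⟨y, funext hy₁, funext hy₂, hy⟩

end Rational

theorem proposition1p3 :
    -- a surjection of `ℚ`-algebras with nilpotent kernel induces isomorphisms on `HP_n`
    (∀ (A B : Type u) [Ring A] [Algebra ℚ A] [Ring B] [Algebra ℚ B] (f : A →ₐ[ℚ] B),
      Function.Surjective f → IsNilpotent (RingHom.ker f) →
        ∀ n : ℤ, Function.Bijective (HP.map (f : A →+* B) n)) ∧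
    -- a cartesian square of `ℚ`-algebras and surjections has a Mayer-Vietoris sequence
    (∀ (A₀ A₁ A₂ A₁₂ : Type u) [Ring A₀] [Algebra ℚ A₀] [Ring A₁] [Algebra ℚ A₁]
        [Ring A₂] [Algebra ℚ A₂] [Ring A₁₂] [Algebra ℚ A₁₂]
        (g₁ : A₀ →ₐ[ℚ] A₁) (g₂ : A₀ →ₐ[ℚ] A₂) (f₁ : A₁ →ₐ[ℚ] A₁₂) (f₂ : A₂ →ₐ[ℚ] A₁₂),
      Function.Surjective g₁ → Function.Surjective g₂ →
      Function.Surjective f₁ → Function.Surjective f₂ →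
      f₁.comp g₁ = f₂.comp g₂ →
      (∀ (x : A₁) (y : A₂), f₁ x = f₂ y → ∃! a : A₀, g₁ a = x ∧ g₂ a = y) →
        ∃ δ : ∀ n : ℤ, HP A₁₂ n →ₗ[ℤ] HP A₀ (n - 1), ∀ n : ℤ,
          Function.Exact ((HP.map (g₁ : A₀ →+* A₁) n).prod (HP.map (g₂ : A₀ →+* A₂) n))
            ((HP.map (f₁ : A₁ →+* A₁₂) n).coprod (-HP.map (f₂ : A₂ →+* A₁₂) n)) ∧
          Function.Exact ((HP.map (f₁ : A₁ →+* A₁₂) n).coprod (-HP.map (f₂ : A₂ →+* A₁₂) n))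
            (δ n) ∧
          Function.Exact (δ n)
            ((HP.map (g₁ : A₀ →+* A₁) (n - 1)).prod (HP.map (g₂ : A₀ →+* A₂) (n - 1)))) := by
  refine ⟨fun A B _ _ _ _ f hf hker n => HP.bijective_map_of_isNilpotent_ker f hf hker n, ?_⟩
  intro A₀ A₁ A₂ A₁₂ _ _ _ _ _ _ _ _ g₁ g₂ f₁ f₂ hg₁ hg₂ hf₁ hf₂ hcomm hcart
  have h := isExcisive_of_cartesian g₁ g₂ f₁ f₂ hg₁ hg₂ hf₁ hf₂ hcomm hcart
  exact ⟨fun n => h.connecting (sub_add_cancel n 1), fun n => ⟨h.exact_prod_coprod n,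
    h.exact_coprod_connecting (sub_add_cancel n 1), h.exact_connecting_prod (sub_add_cancel n 1)⟩⟩
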